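/- **Conventions.** A *ternary ring of operators* (TRO) is a norm-closed subspace $T\subseteq B(H,K)$ with $xy^*z\in T$ for $x,y,z\in T$; its left and right $C^*$-algebras $\mathcal L(T)\subseteq B(K)$, $\mathcal R(T)\subseteq B(H)$ are generated by the products $xy^*$, respectively $x^*y$, and its linking algebra is $\begin{pmatrix}\mathcal L(T)&T\\T^*&\mathcal R(T)\end{pmatrix}$. For a $JB^*$-triple $Z$ let $\rho_Z:Z\to T^*(Z)$ be its universal enveloping TRO: $\rho_Z$ is a homomorphism for $\{x,y,z\}=\frac12(xy^*z+zy^*x)$, $\rho_Z(Z)$ generates $T^*(Z)$ as a TRO, and each such homomorphism of $Z$ into a TRO lifts uniquely to a TRO-homomorphism on $T^*(Z)$. Put $K_0^{JB^*}(Z)=K_0(\mathcal L(T^*(Z)))$. The K-JB* invariant of $Z$ is $$\mathcal{KJB}^*(Z)=\bigl(K_0^{JB^*}(Z),\,K_0^{JB^*}(Z)_+,\,\Sigma_{\mathcal L}(Z),\,\Sigma_{\mathcal R}(Z),\,\Delta(Z)\bigr),$$ where $K_0^{JB^*}(Z)_+$ is the set of classes of projections in matrix algebras over $\mathcal L(T^*(Z))$;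 $\Sigma_{\mathcal L}(Z)$ is the set of classes of projections (including $0$) in $\mathcal L(T^*(Z))$; $\Sigma_{\mathcal R}(Z)$ is the set of classes of projections in $\mathcal R(T^*(Z))$, carried to $K_0^{JB^*}(Z)$ through the $K_0$-group of the linking algebra; and $\Delta(Z)=\{[\rho_Z(g)\rho_Z(g)^*] : g\in Z,\ g\neq0,\ \{g,g,g\}=g\}$. An equality $\mathcal{KJB}^*(Z)=(G,P,L,R,D)$ means that one group isomorphism $K_0^{JB^*}(Z)\cong G$ carries the four sets to $P,L,R,D$. **Proposition.** Let $Z$ be a $JB^*$-triple. In each of the following cases the universal enveloping TRO of $Z$ exists, and the K-JB* invariant is as stated. ("Isomorphic" means isomorphic as a $JB^*$-triple; spaces of matrices carry the triple product $\frac12(ab^*c+cb^*a)$.) (a) (i) If $Z$ is isomorphic to $C^1_{1,n}=M_{1,n}(\mathbb C)$, $n\ge1$ (a Hilbert space of dimension $n$), then $$\mathcal{KJB}^*(Z)=\Bigl(\mathbb Z^n,\ \mathbb N_0^n,\ \prod_{k=1}^n\bigl\{0,\dots,\tbinom nk\bigr\},\ \prod_{k=1}^n\bigl\{0,\dots,\tbinom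 n{k-1}\bigr\},\ \bigl\{\bigl(\tbinom{n-1}0,\tbinom{n-1}1,\dots,\tbinom{n-1}{n-1}\bigr)\bigr\}\Bigr).$$ (ii) If $Z$ is isomorphic to $C^1_{n,m}=M_{n,m}(\mathbb C)$ with $n,m\ge2$, then $$\mathcal{KJB}^*(Z)=\bigl(\mathbb Z^2,\ \mathbb N_0^2,\ \{0,\dots,n\}\times\{0,\dots,m\},\ \{0,\dots,m\}\times\{0,\dots,n\},\ \{(r,r):1\le r\le\min(n,m)\}\bigr).$$ (b) If $Z$ is isomorphic to the space $C^2_n$ of skew-symmetric complex $n\times n$ matrices and $\dim Z\ge10$, then $$\mathcal{KJB}^*(Z)=(\mathbb Z,\ \mathbb N_0,\ \{0,\dots,n\},\ \{0,\dots,n\},\ \{2,4,\dots,k\}),$$ where $k$ is the greatest even integer less than or equal to $n$. (c) If $Z$ is isomorphic to the space $C^3_n$ of symmetric complex $n\times n$ matrices, $n\ge2$, then $$\mathcal{KJB}^*(Z)=(\mathbb Z,\ \mathbb N_0,\ \{0,\dots,n\},\ \{0,\dots,n\},\ \{1,\dots,n\}).$$ (d) Let $Z$ be a spin factor of dimension $k+1$,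 that is, isomorphic to the linear span of $1,s_1,\dots,s_k$ for self-adjoint complex matrices $s_i$ of some size $N\ge1$ with $s_is_j+s_js_i=2\delta_{ij}1$. (i) If $k=2n-1$ with $n\ge2$, then $$\mathcal{KJB}^*(Z)=\bigl(\mathbb Z^2,\ \mathbb N_0^2,\ \{0,\dots,2^{n-1}\}^2,\ \{0,\dots,2^{n-1}\}^2,\ \{(2^{n-2},2^{n-2}),(2^{n-1},2^{n-1})\}\bigr).$$ (ii) If $k=2n$ with $n\ge2$, then $$\mathcal{KJB}^*(Z)=\bigl(\mathbb Z,\ \mathbb N_0,\ \{0,\dots,2^n\},\ \{0,\dots,2^n\},\ \{2^{n-1},2^n\}\bigr).$$ In both cases $\Delta(Z)$ has exactly two elements: the first one listed is the class of every minimal tripotent ($g\ne0$ with $\{z:\{g,g,z\}=z\}=\mathbb Cg$), the second one that of every maximal tripotent ($g\neq0$ with $\{g,g,z\}=0$ only for $z=0$). -/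

import Mathlib

open scoped Matrix InnerProductSpace

universe u v w

noncomputable section

namespace KJB

/-! ## `K₀` of a `C*`-algebra -/

section KTheory

variable {A B : Type*} [NonUnitalRing A] [StarRing A] [NonUnitalRing B] [StarRing B]

/-- Murray-von Neumann equivalence of square matrices (in practice projections), possibly of
different sizes. -/
def MvN {ι κ : Type*} [Fintype ι] [Fintype κ] (p : Matrix ι ι A) (q : Matrix κ κ A) : Prop :=
  ∃ v : Matrix ι κ A, v * vᴴ = p ∧ vᴴ * v = q

theorem MvN.symm {ι κ : Type*} [Fintype ι] [Fintype κ] {p : Matrix ι ι A} {q : Matrix κ κ A}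
    (h : MvN p q) : MvN q p := by
  obtain ⟨v, h1, h2⟩ := h
  exact ⟨vᴴ, by simpa using h2, by simpa using h1⟩

theorem MvN.trans {ι κ l : Type*} [Fintype ι] [Fintype κ] [Fintype l]
    {p : Matrix ι ι A} {q : Matrix κ κ A} {r : Matrix l l A}
    (hp : p * p = p) (hr : r * r = r) (h : MvN p q) (h' : MvN q r) : MvN p r := by
  obtain ⟨x, h1, h2⟩ := h
  obtain ⟨y, h3, h4⟩ := h'
  refine ⟨x * y, ?_, ?_⟩
  · rw [Matrix.conjTranspose_mul, Matrix.mul_assoc, ← Matrix.mul_assoc y, h3, ← h2,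
      Matrix.mul_assoc xᴴ, h1, ← Matrix.mul_assoc, h1, hp]
  · rw [Matrix.conjTranspose_mul, Matrix.mul_assoc, ← Matrix.mul_assoc xᴴ, h2, ← h3,
      Matrix.mul_assoc y, h4, ← Matrix.mul_assoc, h4, hr]

/-- A projection does not change its class under reindexing. -/
theorem MvN.reindex {ι κ : Type*} [Fintype ι] [Fintype κ] {p : Matrix ι ι A}
    (hp : IsStarProjection p) (e : κ ≃ ι) : MvN p (p.submatrix e e) := by
  have h1 : p * p = p := hp.isIdempotentElem
  have h2 : pᴴ = p := hp.isSelfAdjoint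
  refine ⟨p.submatrix id e, ?_, ?_⟩
  · rw [Matrix.conjTranspose_submatrix, h2, Matrix.submatrix_mul_equiv p p id e id, h1,
      Matrix.submatrix_id_id]
  · rw [Matrix.conjTranspose_submatrix, h2,
      ← Matrix.submatrix_mul p p e id e Function.bijective_id, h1]

/-- The block diagonal sum of equivalent projections is equivalent. -/
theorem MvN.blocks {ι κ ι' κ' : Type*} [Fintype ι] [Fintype κ] [Fintype ι'] [Fintype κ']
    {p : Matrix ι ι A} {q : Matrix κ κ A} {p' : Matrix ι' ι' A} {q' : Matrix κ' κ' A}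
    (h : MvN p p') (h' : MvN q q') :
    MvN (Matrix.fromBlocks p 0 0 q) (Matrix.fromBlocks p' 0 0 q') := by
  obtain ⟨x, h1, h2⟩ := h
  obtain ⟨y, h3, h4⟩ := h'
  refine ⟨Matrix.fromBlocks x 0 0 y, ?_, ?_⟩ <;>
    simp [Matrix.fromBlocks_conjTranspose, Matrix.fromBlocks_multiply, h1, h2, h3, h4]

theorem isStarProjection_blocks {ι κ : Type*} [Fintype ι] [Fintype κ]
    {p : Matrix ι ι A} {q : Matrix κ κ A} (hp : IsStarProjection p) (hq : IsStarProjection q) :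
    IsStarProjection (Matrix.fromBlocks p 0 0 q) := by
  have h1 : p * p = p := hp.isIdempotentElem
  have h2 : pᴴ = p := hp.isSelfAdjoint
  have h3 : q * q = q := hq.isIdempotentElem
  have h4 : qᴴ = q := hq.isSelfAdjoint
  refine ⟨?_, ?_⟩
  · simp [IsIdempotentElem, Matrix.fromBlocks_multiply, h1, h3]
  · simp [IsSelfAdjoint, Matrix.star_eq_conjTranspose, Matrix.fromBlocks_conjTranspose, h2, h4]

theorem isStarProjection_submatrix {ι κ : Type*} [Fintype ι] [Fintype κ]
    {p : Matrix ι ι A} (hp : IsStarProjection p) (e : κ ≃ ι) :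
    IsStarProjection (p.submatrix e e) := by
  have h1 : p * p = p := hp.isIdempotentElem
  have h2 : pᴴ = p := hp.isSelfAdjoint
  refine ⟨?_, ?_⟩
  · rw [IsIdempotentElem, Matrix.submatrix_mul_equiv, h1]
  · rw [IsSelfAdjoint, Matrix.star_eq_conjTranspose, Matrix.conjTranspose_submatrix, h2]

variable (A) in
/-- Projections in matrices of arbitrary finite size over `A`. -/
structure Proj where
  size : ℕ
  mat : Matrix (Fin size) (Fin size) A
  isProj : IsStarProjection mat

/-- Murray-von Neumann equivalence of projections over `A`. -/
instance projSetoid : Setoid (Proj A) where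
  r p q := MvN p.mat q.mat
  iseqv :=
    { refl := fun p => ⟨p.mat, by
          have h1 : p.mat * p.mat = p.mat := p.isProj.isIdempotentElem
          have h2 : p.matᴴ = p.mat := p.isProj.isSelfAdjoint
          rw [h2, h1]; exact ⟨rfl, rfl⟩⟩
      symm := fun h => h.symm
      trans := fun {p _ r} h h' =>
        MvN.trans p.isProj.isIdempotentElem r.isProj.isIdempotentElem h h' }

theorem Proj.equiv_iff (p q : Proj A) : p ≈ q ↔ MvN p.mat q.mat := Iff.rfl

/-- Orthogonal (block diagonal) sum of two projections. -/
def Proj.add (p q : Proj A) : Proj A where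
  size := p.size + q.size
  mat := (Matrix.fromBlocks p.mat 0 0 q.mat).submatrix finSumFinEquiv.symm finSumFinEquiv.symm
  isProj := isStarProjection_submatrix (isStarProjection_blocks p.isProj q.isProj) _

theorem Proj.add_mvN (p q : Proj A) :
    MvN (p.add q).mat (Matrix.fromBlocks p.mat 0 0 q.mat) :=
  (MvN.reindex (isStarProjection_blocks p.isProj q.isProj) _).symm

/-- The empty projection. -/
def Proj.zero : Proj A where
  size := 0
  mat := 0
  isProj := ⟨Subsingleton.elim _ _, Subsingleton.elim _ _⟩

variable (A) in
/-- The monoid of equivalence classes of projections in matrices over `A`. -/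
def V : Type _ := Quotient (projSetoid (A := A))

theorem Proj.equiv_of {κ : Type*} [Fintype κ] {p q : Proj A} {r : Matrix κ κ A}
    (h : MvN p.mat r) (h' : MvN q.mat r) : p ≈ q :=
  MvN.trans p.isProj.isIdempotentElem q.isProj.isIdempotentElem h h'.symm

theorem Proj.mvN_trans {κ l : Type*} [Fintype κ] [Fintype l] {p : Proj A} {q : Matrix κ κ A}
    {r : Matrix l l A} (h : MvN p.mat q) (hr : IsStarProjection r) (h' : MvN q r) :
    MvN p.mat r :=
  MvN.trans p.isProj.isIdempotentElem hr.isIdempotentElem h h'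

theorem MvN.refl {ι : Type*} [Fintype ι] {p : Matrix ι ι A} (hp : IsStarProjection p) :
    MvN p p := by
  simpa using MvN.reindex hp (Equiv.refl _)

instance : Add (V A) where
  add := Quotient.map₂ Proj.add (by
    intro p p' h q q' h'
    have hb := MvN.blocks ((Proj.equiv_iff _ _).1 h) ((Proj.equiv_iff _ _).1 h')
    exact Proj.equiv_of (Proj.mvN_trans (Proj.add_mvN p q)
      (isStarProjection_blocks p'.isProj q'.isProj) hb) (Proj.add_mvN p' q'))

instance : Zero (V A) where
  zero := Quotient.mk _ Proj.zero

instance : AddCommMonoid (V A) where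
  nsmul := nsmulRec
  add_assoc := by
    rintro ⟨p⟩ ⟨q⟩ ⟨r⟩
    refine Quotient.sound ?_
    have h1 := isStarProjection_blocks (isStarProjection_blocks p.isProj q.isProj) r.isProj
    have h2 := isStarProjection_blocks p.isProj (isStarProjection_blocks q.isProj r.isProj)
    refine Proj.equiv_of (r := Matrix.fromBlocks p.mat 0 0 (Matrix.fromBlocks q.mat 0 0 r.mat))
      ?_ ?_
    · refine Proj.mvN_trans (Proj.mvN_trans (Proj.add_mvN _ _) h1
        (MvN.blocks (Proj.add_mvN p q) (MvN.refl r.isProj))) h2 ?_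
      convert! MvN.reindex h1 (Equiv.sumAssoc _ _ _).symm using 1
      ext (i | i | i) (j | j | j) <;> rfl
    · exact Proj.mvN_trans (Proj.add_mvN _ _) h2
        (MvN.blocks (MvN.refl p.isProj) (Proj.add_mvN q r))
  zero_add := by
    rintro ⟨p⟩
    refine Quotient.sound (Proj.equiv_of (Proj.add_mvN Proj.zero p) ?_)
    convert! MvN.reindex p.isProj (Equiv.emptySum (Fin 0) (Fin p.size)) using 1
    ext (i | i) (j | j)
    · exact i.elim0
    · exact i.elim0
    · exact j.elim0
    · rfl
  add_zero := by
    rintro ⟨p⟩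
    refine Quotient.sound (Proj.equiv_of (Proj.add_mvN p Proj.zero) ?_)
    convert! MvN.reindex p.isProj (Equiv.sumEmpty (Fin p.size) (Fin 0)) using 1
    ext (i | i) (j | j)
    · rfl
    · exact j.elim0
    · exact i.elim0
    · exact i.elim0
  add_comm := by
    rintro ⟨p⟩ ⟨q⟩
    refine Quotient.sound (Proj.equiv_of (r := Matrix.fromBlocks q.mat 0 0 p.mat) ?_
      (Proj.add_mvN q p))
    refine Proj.mvN_trans (Proj.add_mvN p q) (isStarProjection_blocks q.isProj p.isProj) ?_
    convert! MvN.reindex (isStarProjection_blocks p.isProj q.isProj) (Equiv.sumComm _ _) using 1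
    ext (i | i) (j | j) <;> rfl

theorem isStarProjection_map {ι : Type*} [Fintype ι] (f : A →⋆ₙ+* B) {p : Matrix ι ι A}
    (hp : IsStarProjection p) : IsStarProjection (p.map f) := by
  have h1 : p * p = p := hp.isIdempotentElem
  have h2 : pᴴ = p := hp.isSelfAdjoint
  refine ⟨?_, ?_⟩
  · rw [IsIdempotentElem, ← Matrix.map_mul, h1]
  · rw [IsSelfAdjoint, Matrix.star_eq_conjTranspose,
      ← Matrix.conjTranspose_map f (fun a => map_star f a), h2]

theorem MvN.map {ι κ : Type*} [Fintype ι] [Fintype κ] (f : A →⋆ₙ+* B) {p : Matrix ι ι A}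
    {q : Matrix κ κ A} (h : MvN p q) : MvN (p.map f) (q.map f) := by
  obtain ⟨x, h1, h2⟩ := h
  refine ⟨x.map f, ?_, ?_⟩
  · rw [← Matrix.conjTranspose_map f (fun a => map_star f a), ← Matrix.map_mul, h1]
  · rw [← Matrix.conjTranspose_map f (fun a => map_star f a), ← Matrix.map_mul, h2]

/-- The entrywise image of a projection under a `*`-homomorphism. -/
def Proj.map (f : A →⋆ₙ+* B) (p : Proj A) : Proj B :=
  ⟨p.size, p.mat.map f, isStarProjection_map f p.isProj⟩

/-- Functoriality of `V`. -/
def V.map (f : A →⋆ₙ+* B) : V A →+ V B where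
  toFun := Quotient.map (Proj.map f) fun _ _ h => MvN.map f h
  map_zero' := Quotient.sound ⟨0, Matrix.ext fun i => i.elim0, Matrix.ext fun i => i.elim0⟩
  map_add' := by
    rintro ⟨p⟩ ⟨q⟩
    refine Quotient.sound (Proj.equiv_of (r := Matrix.fromBlocks (p.mat.map f) 0 0 (q.mat.map f))
      ?_ (Proj.add_mvN (p.map f) (q.map f)))
    convert! MvN.map f (Proj.add_mvN p q) using 1
    ext (i | i) (j | j) <;> simp

variable (A) in
/-- The Grothendieck group of the monoid of classes of projections. For an algebra with a unit
this is `K₀`. -/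
abbrev K00 : Type _ := Algebra.GrothendieckAddGroup (V A)

/-- Functoriality of `K00`. -/
def K00.map (f : A →⋆ₙ+* B) : K00 A →+ K00 B :=
  Algebra.GrothendieckAddGroup.lift (Algebra.GrothendieckAddGroup.of.comp (V.map f))

/-- The class of a projection matrix in `K00`. -/
def K00.mk (p : Proj A) : K00 A := Algebra.GrothendieckAddGroup.of (Quotient.mk _ p : V A)

theorem K00.map_mk (f : A →⋆ₙ+* B) (p : Proj A) : K00.map f (K00.mk p) = K00.mk (p.map f) :=
  DFunLike.congr_fun (Algebra.GrothendieckAddGroup.lift.symm_apply_apply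
    (Algebra.GrothendieckAddGroup.of.comp (V.map f))) (Quotient.mk _ p : V A)

theorem K00.mk_zero (n : ℕ) (h : IsStarProjection (0 : Matrix (Fin n) (Fin n) A)) :
    K00.mk ⟨n, 0, h⟩ = 0 := by
  have : (Quotient.mk _ (⟨n, 0, h⟩ : Proj A) : V A) = (0 : V A) :=
    Quotient.sound (⟨0, by simp, Matrix.ext fun i => i.elim0⟩ :
      MvN (0 : Matrix (Fin n) (Fin n) A) (Proj.zero : Proj A).mat)
  rw [K00.mk, this, map_zero]

end KTheory

section KTheoryCStar

variable (A : Type*) [NonUnitalRing A] [StarRing A] [Module ℂ A] [IsScalarTower ℂ A A]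
  [SMulCommClass ℂ A A] [StarModule ℂ A]
variable {B : Type*} [NonUnitalRing B] [StarRing B] [Module ℂ B] [IsScalarTower ℂ B B]
  [SMulCommClass ℂ B B] [StarModule ℂ B]

/-- The scalar part `A~ → ℂ` of the unitization. -/
def scalarPart : Unitization ℂ A →⋆ₙ+* ℂ where
  toFun x := x.fst
  map_mul' := Unitization.fst_mul
  map_zero' := Unitization.fst_zero
  map_add' := Unitization.fst_add
  map_star' := Unitization.fst_star

/-- The inclusion `A → A~`. -/
def inclUnitization : A →⋆ₙ+* Unitization ℂ A where
  toFun := Unitization.inr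
  map_mul' := Unitization.inr_mul ℂ
  map_zero' := Unitization.inr_zero ℂ
  map_add' := Unitization.inr_add ℂ
  map_star' := fun a => Unitization.inr_star a

/-- `K₀(A)`, the kernel of `K₀(A~) → K₀(ℂ)`; the algebra `A` need not have a unit. -/
def K0 : AddSubgroup (K00 (Unitization ℂ A)) := (K00.map (scalarPart A)).ker

variable {A}

/-- The class in `K₀(A)` of a projection in a matrix algebra over `A`. -/
def K0.mk (p : Proj A) : K0 A :=
  ⟨K00.mk (p.map (inclUnitization A)), by
    have h : (p.map (inclUnitization A)).mat.map (scalarPart A) = 0 := by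
      ext i j
      exact Unitization.fst_inr ℂ (p.mat i j)
    have h' : ((p.map (inclUnitization A)).map (scalarPart A)) =
        ⟨p.size, 0, IsStarProjection.zero _⟩ := by
      simp only [Proj.map] at h ⊢
      congr 1
    rw [K0, AddMonoidHom.mem_ker, K00.map_mk, h', K00.mk_zero]⟩

/-- The class in `K₀(A)` of a projection of `A` itself. -/
def K0.cls (p : A) (hp : IsStarProjection p) : K0 A :=
  K0.mk ⟨1, Matrix.of fun _ _ => p, by
    have h1 : p * p = p := hp.isIdempotentElem
    have h2 : star p = p := hp.isSelfAdjoint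
    refine ⟨?_, ?_⟩
    · ext i j
      simp [Matrix.mul_apply, h1]
    · ext i j
      simp [h2]⟩

variable (A) in
/-- The positive cone: classes of projections in matrix algebras over `A`. -/
def K0.pos : Set (K0 A) := Set.range K0.mk

variable (A) in
/-- The scale: classes of projections in `A` itself. -/
def K0.scale : Set (K0 A) := {x | ∃ (p : A) (hp : IsStarProjection p), x = K0.cls p hp}

/-- The extension of a `*`-homomorphism to the unitizations. -/
def unitizationMap (f : A →⋆ₙₐ[ℂ] B) : Unitization ℂ A →⋆ₙ+* Unitization ℂ B where
  toFun := Unitization.starMap f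
  map_mul' := map_mul _
  map_zero' := map_zero _
  map_add' := map_add _
  map_star' := map_star _

/-- Functoriality of `K₀`. -/
def K0.map (f : A →⋆ₙₐ[ℂ] B) : K0 A →+ K0 B :=
  ((K00.map (unitizationMap f)).comp (K0 A).subtype).codRestrict (K0 B) (by
    rintro ⟨x, hx⟩
    have key : (K00.map (scalarPart B)).comp (K00.map (unitizationMap f))
        = K00.map (scalarPart A) := by
      refine Algebra.GrothendieckAddGroup.lift.symm.injective ?_
      ext ⟨p⟩
      change K00.map _ (K00.map _ (K00.mk p)) = K00.map _ (K00.mk p)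
      rw [K00.map_mk, K00.map_mk, K00.map_mk]
      congr 1
      simp only [Proj.map, Matrix.map_map]
      congr 1
      ext i j
      change (Unitization.starMap f (p.mat i j)).fst = (p.mat i j).fst
      induction p.mat i j using Unitization.ind with
      | inl_add_inr r a => simp [Unitization.algebraMap_eq_inl]
    have := DFunLike.congr_fun key x
    rw [K0, AddMonoidHom.mem_ker] at hx
    rw [K0, AddMonoidHom.mem_ker]
    exact this.trans hx)

end KTheoryCStar

/-! ## Ternary rings of operators -/

/-- A ternary ring of operators: a norm closed subspace of `B(H, K)` that is closed under
`x y* z`. -/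
structure TRO where
  (H K : Type v)
  [instH₁ : NormedAddCommGroup H]
  [instH₂ : InnerProductSpace ℂ H]
  [instH₃ : CompleteSpace H]
  [instK₁ : NormedAddCommGroup K]
  [instK₂ : InnerProductSpace ℂ K]
  [instK₃ : CompleteSpace K]
  carrier : Submodule ℂ (H →L[ℂ] K)
  isClosed_carrier : IsClosed (carrier : Set (H →L[ℂ] K))
  ternary_mem : ∀ x ∈ carrier, ∀ y ∈ carrier, ∀ z ∈ carrier,
    x ∘L ContinuousLinearMap.adjoint y ∘L z ∈ carrier

attribute [instance] TRO.instH₁ TRO.instH₂ TRO.instH₃ TRO.instK₁ TRO.instK₂ TRO.instK₃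

namespace TRO

variable (T : TRO.{v})

/-- The ternary product `x y* z`. -/
def tern (x y z : T.carrier) : T.carrier :=
  ⟨x.1 ∘L ContinuousLinearMap.adjoint y.1 ∘L z.1, T.ternary_mem _ x.2 _ y.2 _ z.2⟩

/-- The left `C*`-algebra `L(T)`, generated by the products `x y*`. -/
def left : NonUnitalStarSubalgebra ℂ (T.K →L[ℂ] T.K) :=
  (NonUnitalStarAlgebra.adjoin ℂ {a | ∃ x ∈ T.carrier, ∃ y ∈ T.carrier,
    a = x ∘L ContinuousLinearMap.adjoint y}).topologicalClosure

/-- The right `C*`-algebra `R(T)`, generated by the products `x* y`. -/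
def right : NonUnitalStarSubalgebra ℂ (T.H →L[ℂ] T.H) :=
  (NonUnitalStarAlgebra.adjoin ℂ {a | ∃ x ∈ T.carrier, ∃ y ∈ T.carrier,
    a = ContinuousLinearMap.adjoint x ∘L y}).topologicalClosure

/-- The Hilbert space direct sum `K ⊕ H`. -/
abbrev E : Type v := WithLp 2 (T.K × T.H)

/-- The isometric inclusion `K → K ⊕ H`. -/
def inK : T.K →ₗᵢ[ℂ] T.E where
  toFun k := WithLp.toLp 2 (k, 0)
  map_add' x y := by
    rw [← WithLp.toLp_add, Prod.mk_add_mk, add_zero]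
  map_smul' c x := by
    rw [RingHom.id_apply, ← WithLp.toLp_smul, Prod.smul_mk, smul_zero]
  norm_map' x := by simp

/-- The isometric inclusion `H → K ⊕ H`. -/
def inH : T.H →ₗᵢ[ℂ] T.E where
  toFun h := WithLp.toLp 2 (0, h)
  map_add' x y := by
    rw [← WithLp.toLp_add, Prod.mk_add_mk, add_zero]
  map_smul' c x := by
    rw [RingHom.id_apply, ← WithLp.toLp_smul, Prod.smul_mk, smul_zero]
  norm_map' x := by simp

/-- The operator on `K ⊕ H` with `x : H → K` in its upper right corner. -/
def cornerOp (x : T.H →L[ℂ] T.K) : T.E →L[ℂ] T.E :=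
  T.inK.toContinuousLinearMap ∘L x ∘L
    ContinuousLinearMap.adjoint T.inH.toContinuousLinearMap

/-- The linking `C*`-algebra, with the corners `L(T)`, `T`, `T*`, `R(T)`; it is generated by the
corner `T`. -/
def linking : NonUnitalStarSubalgebra ℂ (T.E →L[ℂ] T.E) :=
  (NonUnitalStarAlgebra.adjoin ℂ (T.cornerOp '' T.carrier)).topologicalClosure

end TRO

section Compress

variable {F G : Type*} [NormedAddCommGroup F] [InnerProductSpace ℂ F] [CompleteSpace F]
  [NormedAddCommGroup G] [InnerProductSpace ℂ G] [CompleteSpace G]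

theorem adjoint_comp_isometry (j : F →ₗᵢ[ℂ] G) :
    ContinuousLinearMap.adjoint j.toContinuousLinearMap ∘L j.toContinuousLinearMap
      = ContinuousLinearMap.id ℂ F :=
  (ContinuousLinearMap.norm_map_iff_adjoint_comp_self _).1 fun x => j.norm_map x

/-- The `*`-homomorphism `a ↦ j a j*` for an isometry `j`. -/
def corner (j : F →ₗᵢ[ℂ] G) : (F →L[ℂ] F) →⋆ₙₐ[ℂ] (G →L[ℂ] G) where
  toFun a := j.toContinuousLinearMap ∘L a ∘L ContinuousLinearMap.adjoint j.toContinuousLinearMap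
  map_smul' c a := by ext x; simp
  map_zero' := by ext x; simp
  map_add' a b := by ext x; simp
  map_mul' a b := by
    ext x
    have := DFunLike.congr_fun (adjoint_comp_isometry j)
      (b (ContinuousLinearMap.adjoint j.toContinuousLinearMap x))
    exact congrArg (fun y => j (a y)) this.symm
  map_star' a := by
    simp only [ContinuousLinearMap.star_eq_adjoint, ContinuousLinearMap.adjoint_comp,
      ContinuousLinearMap.adjoint_adjoint, ContinuousLinearMap.comp_assoc]

theorem continuous_corner (j : F →ₗᵢ[ℂ] G) : Continuous (corner j) := by
  change Continuous fun a : F →L[ℂ] F =>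
    j.toContinuousLinearMap ∘L a ∘L ContinuousLinearMap.adjoint j.toContinuousLinearMap
  fun_prop

theorem corner_mem_closure (j : F →ₗᵢ[ℂ] G) {s : Set (F →L[ℂ] F)}
    {S : NonUnitalStarSubalgebra ℂ (G →L[ℂ] G)} (h : ∀ a ∈ s, corner j a ∈ S) {a : F →L[ℂ] F}
    (ha : a ∈ (NonUnitalStarAlgebra.adjoin ℂ s).topologicalClosure) :
    corner j a ∈ S.topologicalClosure := by
  have h1 : NonUnitalStarAlgebra.adjoin ℂ s ≤ S.comap (corner j) :=
    NonUnitalStarAlgebra.adjoin_le h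
  exact map_mem_closure (continuous_corner j) ha fun x hx => h1 hx

end Compress

namespace TRO

variable (T : TRO.{v})

theorem star_cornerOp (x : T.H →L[ℂ] T.K) : star (T.cornerOp x) =
    T.inH.toContinuousLinearMap ∘L ContinuousLinearMap.adjoint x ∘L
      ContinuousLinearMap.adjoint T.inK.toContinuousLinearMap := by
  simp only [cornerOp, ContinuousLinearMap.star_eq_adjoint, ContinuousLinearMap.adjoint_comp,
    ContinuousLinearMap.adjoint_adjoint, ContinuousLinearMap.comp_assoc]

/-- The canonical embedding of `L(T)` into the linking algebra. -/
def leftEmb : T.left →⋆ₙₐ[ℂ] T.linking :=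
  NonUnitalStarAlgHom.codRestrict
    ((corner T.inK).comp (NonUnitalStarSubalgebraClass.subtype T.left)) T.linking (by
      rintro ⟨a, ha⟩
      refine corner_mem_closure T.inK ?_ ha
      rintro _ ⟨x, hx, y, hy, rfl⟩
      have h : corner T.inK (x ∘L ContinuousLinearMap.adjoint y)
          = T.cornerOp x * star (T.cornerOp y) := by
        rw [star_cornerOp]
        ext z
        have := DFunLike.congr_fun (adjoint_comp_isometry T.inH)
          (ContinuousLinearMap.adjoint y
            (ContinuousLinearMap.adjoint T.inK.toContinuousLinearMap z))
        exact congrArg (fun k => T.inK (x k)) this.symm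
      rw [h]
      exact mul_mem (NonUnitalStarAlgebra.subset_adjoin ℂ _ ⟨x, hx, rfl⟩)
        (star_mem (NonUnitalStarAlgebra.subset_adjoin ℂ _ ⟨y, hy, rfl⟩)))

/-- The canonical embedding of `R(T)` into the linking algebra. -/
def rightEmb : T.right →⋆ₙₐ[ℂ] T.linking :=
  NonUnitalStarAlgHom.codRestrict
    ((corner T.inH).comp (NonUnitalStarSubalgebraClass.subtype T.right)) T.linking (by
      rintro ⟨a, ha⟩
      refine corner_mem_closure T.inH ?_ ha
      rintro _ ⟨x, hx, y, hy, rfl⟩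
      have h : corner T.inH (ContinuousLinearMap.adjoint x ∘L y)
          = star (T.cornerOp x) * T.cornerOp y := by
        rw [star_cornerOp]
        ext z
        have := DFunLike.congr_fun (adjoint_comp_isometry T.inK)
          (y (ContinuousLinearMap.adjoint T.inH.toContinuousLinearMap z))
        exact congrArg (fun k => T.inH (ContinuousLinearMap.adjoint x k)) this.symm
      rw [h]
      exact mul_mem (star_mem (NonUnitalStarAlgebra.subset_adjoin ℂ _ ⟨x, hx, rfl⟩))
        (NonUnitalStarAlgebra.subset_adjoin ℂ _ ⟨y, hy, rfl⟩))

/-- `K₀(T) = K₀(L(T))`. -/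
abbrev K0 : Type v := KJB.K0 T.left

/-- The positive cone of `K₀(T)`. -/
def pos : Set T.K0 := KJB.K0.pos T.left

/-- The left scale, the scale of `L(T)`. -/
def leftScale : Set T.K0 := KJB.K0.scale T.left

/-- The right scale: the scale of `R(T)`, carried to `K₀(L(T))` through the maps that the
embeddings of `L(T)` and `R(T)` into the linking algebra induce on `K₀`. -/
def rightScale : Set T.K0 :=
  {x | ∃ y ∈ KJB.K0.scale T.right, KJB.K0.map (B := T.linking) T.leftEmb x = KJB.K0.map (B := T.linking) T.rightEmb y}

end TRO

/-! ## `JB*`-triples and the universal TRO -/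

/-- A `JB*`-triple; `tri x y z` is `{x, y, z}` and `tri x y` is the operator `x □ y`. -/
class JBStarTriple (Z : Type u) [NormedAddCommGroup Z] [NormedSpace ℂ Z] [CompleteSpace Z] where
  /-- the triple product, linear in the outer variables and conjugate linear in the middle one -/
  tri : Z →L[ℂ] Z →L⋆[ℂ] Z →L[ℂ] Z
  tri_symm : ∀ x y z, tri x y z = tri z y x
  norm_tri : ∀ x, ‖tri x x x‖ = ‖x‖ ^ 3
  /-- `i (x □ x)` is a derivation -/
  derivation : ∀ x a b c,
    (Complex.I • tri x x) (tri a b c) = tri ((Complex.I • tri x x) a) b c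
      + tri a ((Complex.I • tri x x) b) c + tri a b ((Complex.I • tri x x) c)
  spectrum_nonneg : ∀ x, ∀ c ∈ spectrum ℂ (tri x x), ∃ r : ℝ, 0 ≤ r ∧ c = r
  exp_isometry : ∀ x (t : ℝ) z, ‖NormedSpace.exp ((t * Complex.I) • tri x x) z‖ = ‖z‖

open JBStarTriple (tri)

section Universal

variable {Z : Type u} [NormedAddCommGroup Z] [NormedSpace ℂ Z] [CompleteSpace Z] [JBStarTriple Z]

/-- Homomorphisms of a `JB*`-triple into a TRO with `{x, y, z} = (x y* z + z y* x) / 2`. -/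
def IsTripleHom (T : TRO.{v}) (φ : Z →ₗ[ℂ] T.carrier) : Prop :=
  ∀ x y z, φ (tri x y z) =
    (1 / 2 : ℂ) • (T.tern (φ x) (φ y) (φ z) + T.tern (φ z) (φ y) (φ x))

/-- TRO-homomorphisms. -/
def IsTROHom (T : TRO.{v}) (W : TRO.{w}) (f : T.carrier →ₗ[ℂ] W.carrier) : Prop :=
  ∀ x y z, f (T.tern x y z) = W.tern (f x) (f y) (f z)

/-- `T` with `ρ : Z → T` is the universal enveloping TRO of `Z`: it is generated by `ρ(Z)`, and
each homomorphism of `Z` into a TRO lifts uniquely to a TRO-homomorphism on `T`. -/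
structure IsUniversalTRO (T : TRO.{v}) (ρ : Z →ₗ[ℂ] T.carrier) : Prop where
  isTripleHom : IsTripleHom T ρ
  generates : ∀ S : Submodule ℂ T.carrier, IsClosed (S : Set T.carrier) →
    (∀ x ∈ S, ∀ y ∈ S, ∀ z ∈ S, T.tern x y z ∈ S) → (∀ x, ρ x ∈ S) → S = ⊤
  exists_unique_lift : ∀ (W : TRO.{w}) (φ : Z →ₗ[ℂ] W.carrier), IsTripleHom W φ →
    ∃! f : T.carrier →ₗ[ℂ] W.carrier, IsTROHom T W f ∧ f ∘ₗ ρ = φ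

variable (Z) in
/-- The nonzero tripotents. -/
def Tri : Set Z := {g | g ≠ 0 ∧ tri g g g = g}

variable (Z) in
/-- The minimal tripotents: nonzero tripotents with one-dimensional Peirce 2-space. -/
def minTri : Set Z := {g | g ∈ Tri Z ∧ ∀ z, tri g g z = z → ∃ c : ℂ, z = c • g}

variable (Z) in
/-- The maximal tripotents: nonzero tripotents with vanishing Peirce 0-space. -/
def maxTri : Set Z := {g | g ∈ Tri Z ∧ ∀ z, tri g g z = 0 → z = 0}

/-- The classes `[ρ(g) ρ(g)*]` in `K₀(T)` of the tripotents `g ∈ S`. -/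
def classes (T : TRO.{v}) (ρ : Z →ₗ[ℂ] T.carrier) (S : Set Z) : Set T.K0 :=
  {x | ∃ g ∈ S, ∃ (p : T.left) (hp : IsStarProjection p),
    (p : T.K →L[ℂ] T.K) = (ρ g : T.H →L[ℂ] T.K) ∘L
      ContinuousLinearMap.adjoint (ρ g : T.H →L[ℂ] T.K) ∧ x = K0.cls p hp}

/-- The set `Δ` of the classes of the tripotents. -/
def Delta (T : TRO.{v}) (ρ : Z →ₗ[ℂ] T.carrier) : Set T.K0 := classes T ρ (Tri Z)

/-- The group isomorphism `e` identifies the K-JB* invariant with `(G, P, L, R, D)`. -/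
structure IsInvariantIso (T : TRO.{v}) (ρ : Z →ₗ[ℂ] T.carrier) {G : Type} [AddCommGroup G]
    (P L R D : Set G) (e : T.K0 ≃+ G) : Prop where
  pos : e '' T.pos = P
  leftScale : e '' T.leftScale = L
  rightScale : e '' T.rightScale = R
  delta : e '' Delta T ρ = D

variable (Z) in
/-- The K-JB* invariant of `Z` is `(G, P, L, R, D)`: the universal TRO of `Z` exists, and for each
choice of it there is an isomorphism of `K₀` with `G` that carries the four sets to
`P`, `L`, `R`, `D`. -/
def HasInvariant {G : Type} [AddCommGroup G] (P L R D : Set G) : Prop :=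
  (∃ (T : TRO.{v}) (ρ : Z →ₗ[ℂ] T.carrier), IsUniversalTRO.{u, v, w} T ρ) ∧
  ∀ (T : TRO.{v}) (ρ : Z →ₗ[ℂ] T.carrier), IsUniversalTRO.{u, v, w} T ρ →
    ∃ e : T.K0 ≃+ G, IsInvariantIso T ρ P L R D e

variable (Z) in
/-- The K-JB* invariant of `Z` is `(G, P, L, R, {a, b})`, the set `Δ` has exactly two elements, and
`a` is the class of all minimal tripotents, `b` the class of all maximal ones. -/
def HasInvariantMinMax {G : Type} [AddCommGroup G] (P L R : Set G) (a b : G) : Prop :=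
  (∃ (T : TRO.{v}) (ρ : Z →ₗ[ℂ] T.carrier), IsUniversalTRO.{u, v, w} T ρ) ∧
  ∀ (T : TRO.{v}) (ρ : Z →ₗ[ℂ] T.carrier), IsUniversalTRO.{u, v, w} T ρ →
    (Delta T ρ).ncard = 2 ∧
    ∃ e : T.K0 ≃+ G, IsInvariantIso T ρ P L R {a, b} e ∧
      e '' classes T ρ (minTri Z) = {a} ∧ e '' classes T ρ (maxTri Z) = {b}

variable (Z) in
/-- `Z` is isomorphic, as a `JB*`-triple, to the space `S` of matrices with the triple product
`(a b* c + c b* a) / 2`. -/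
def IsoToMatrices {m n : Type} [Fintype m] [Fintype n] (S : Submodule ℂ (Matrix m n ℂ)) : Prop :=
  ∃ e : Z ≃ₗ[ℂ] S, ∀ x y z, (e (tri x y z) : Matrix m n ℂ) =
    (1 / 2 : ℂ) • ((e x : Matrix m n ℂ) * (e y : Matrix m n ℂ)ᴴ * (e z : Matrix m n ℂ)
      + (e z : Matrix m n ℂ) * (e y : Matrix m n ℂ)ᴴ * (e x : Matrix m n ℂ))

end Universal

/-! ## The classical Cartan factors of finite dimension -/

/-- The rectangular factor: all complex `n × m` matrices. -/
def C1 (n m : ℕ) : Submodule ℂ (Matrix (Fin n) (Fin m) ℂ) := ⊤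

/-- The symplectic factor: skew-symmetric matrices. -/
def C2 (n : ℕ) : Submodule ℂ (Matrix (Fin n) (Fin n) ℂ) where
  carrier := {a | aᵀ = -a}
  add_mem' {a b} ha hb := by
    rw [Set.mem_ofPred_eq] at *
    rw [Matrix.transpose_add, ha, hb, neg_add]
  zero_mem' := by simp
  smul_mem' c a ha := by
    rw [Set.mem_ofPred_eq] at *
    rw [Matrix.transpose_smul, ha, smul_neg]

/-- The hermitian factor: symmetric matrices. -/
def C3 (n : ℕ) : Submodule ℂ (Matrix (Fin n) (Fin n) ℂ) where
  carrier := {a | aᵀ = a}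
  add_mem' {a b} ha hb := by
    rw [Set.mem_ofPred_eq] at *
    rw [Matrix.transpose_add, ha, hb]
  zero_mem' := by simp
  smul_mem' c a ha := by
    rw [Set.mem_ofPred_eq] at *
    rw [Matrix.transpose_smul, ha]

/-- A spin system: self-adjoint matrices with `s_i s_j + s_j s_i = 2 δ_ij 1`. -/
def IsSpinSystem {k N : ℕ} (s : Fin k → Matrix (Fin N) (Fin N) ℂ) : Prop :=
  (∀ i, (s i)ᴴ = s i) ∧ ∀ i j, s i * s j + s j * s i = if i = j then 2 else 0

/-- The span of `1` and the matrices `s_i`. -/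
def spinSpan {k N : ℕ} (s : Fin k → Matrix (Fin N) (Fin N) ℂ) :
    Submodule ℂ (Matrix (Fin N) (Fin N) ℂ) :=
  Submodule.span ℂ (insert 1 (Set.range s))

/-- `Z` is a spin factor of dimension `k + 1`. -/
def IsSpinFactor (Z : Type u) [NormedAddCommGroup Z] [NormedSpace ℂ Z] [CompleteSpace Z]
    [JBStarTriple Z] (k : ℕ) : Prop :=
  2 ≤ k ∧ ∃ (N : ℕ) (s : Fin k → Matrix (Fin N) (Fin N) ℂ),
    0 < N ∧ IsSpinSystem s ∧ IsoToMatrices Z (spinSpan s)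

end KJB

end

open KJB

/-!
Every triple in question is finite dimensional, and its universal enveloping TRO turns out to be a
finite product of spaces of matrices `Mₙᵢ,ₘᵢ(ℂ)`. So it suffices to work with a linear map `ρ` from
`Z` into such a product. If `ρ` respects the triple product and its image generates (`IsModel`), and
if every homomorphism of `Z` into operators on a Hilbert space extends along `ρ` to a ternary map
(`HasLift`), then the product, realized as a TRO of block diagonal operators, is universal
(`IsModel.isUniversalTRO`), and every other universal TRO is isomorphic to it
(`IsModel.exists_iso`).

A ternary bijection from a product of matrix spaces onto a TRO `T` identifies `ℒ(T)`, `ℛ(T)` and the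
linking algebra with the products of the `Mₙᵢ(ℂ)`, the `Mₘᵢ(ℂ)` and the `Mₙᵢ₊ₘᵢ(ℂ)`, compatibly with
the two corner embeddings (`TRO.exists_block_reps`). `K₀` of a product of matrix algebras is free on
the blocks, the class of a projection being its vector of ranks (`rankEquiv`). Hence the positive
cone is the set of nonnegative vectors, the two scales are the boxes given by the numbers of rows
and of columns of the blocks, and the class of a tripotent `g` is the vector of traces of
`ρ(g)ρ(g)*` (`IsModel.exists_rankEquiv`). What is left for each type of triple is a model `ρ`, the
lifting property, and the traces of its tripotents (`IsModel.hasInvariant`).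

For matrices of size at least two in both directions, for skew-symmetric and for symmetric matrices
the lifts come from matrix units built out of the images of a grid of tripotents: a homomorphism
into a `*`-algebra splits, in the rectangular case, into a ternary and an anti-ternary part
(`RectRel.ternary`), while in the skew-symmetric case of size at least five and in the symmetric
case it extends to all matrices (`SkewRel.exists_units`, `exists_ternary_of_symmetric`). The models
are two copies (one of them transposed) or one copy of the matrix space.

For spin factors and Hilbert spaces the lifts come from counting dimensions. If `ρ` is paired with
another homomorphism, the TRO generated by the pair projects onto the one generated by `ρ`; when
every enveloping TRO has dimension at most that of the model, this projection is a bijection and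
its inverse gives the lift (`IsModel.hasLift_of_generatesSmall`).

* In a spin factor the TRO is spanned by the `2ᵏ` ordered Clifford monomials
  (`SpinChart.generatesSmall`), and the irreducible representations of the Clifford relations
  (`exists_spinors`) give one block of size `2ᵏᐟ²` for even `k` and two blocks of size
  `2⁽ᵏ⁻¹⁾ᐟ²` for odd `k`.
* In a Hilbert space of dimension `n` the TRO is spanned by alternating words `x(i₀) x(j₀)* x(i₁) ⋯
  x(j_{q-1})* x(i_q)`. Modulo shorter words these are antisymmetric in the `i`'s and in the `j`'s,
  so that the dimension is at most `∑ q, choose n (q + 1) * choose n q` (`generatesSmall_C1_one`).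
  The model is given by the creation operators between consecutive degrees of the antisymmetric Fock
  space (`exists_isFock`, `IsFock.isModel`), and the canonical anticommutation relations give the
  trace of a tripotent on each degree (`IsFock.trace_raisingBlocks`).
-/

noncomputable section

set_option linter.unusedSectionVars false
set_option linter.unusedSimpArgs false

open KJB.JBStarTriple (tri)

namespace KJB

/-! ### Projections in matrix algebras over the complex numbers -/

section MatrixProjections

variable {α β : Type*} [Fintype α] [DecidableEq α] [Fintype β] [DecidableEq β]

/-- A projection matrix is `v v*` for an isometry `v` from a space of dimension its rank: take the
eigenvectors with nonzero eigenvalue. -/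
theorem exists_isometry_of_isStarProjection {P : Matrix α α ℂ} (hP : IsStarProjection P) :
    ∃ v : Matrix α (Fin P.rank) ℂ, v * vᴴ = P ∧ vᴴ * v = 1 := by
  have hA : P.IsHermitian := hP.isSelfAdjoint
  have hPP : P * P = P := hP.isIdempotentElem
  set U : Matrix α α ℂ := (hA.eigenvectorUnitary : Matrix α α ℂ) with hU
  have hUU : star U * U = 1 := Unitary.coe_star_mul_self _
  have hUU' : U * star U = 1 := Unitary.coe_mul_star_self _
  set d : α → ℂ := RCLike.ofReal ∘ hA.eigenvalues with hd
  have hspec : P = U * Matrix.diagonal d * star U := by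
    conv_lhs => rw [hA.spectral_theorem, Unitary.conjStarAlgAut_apply]
  have hdd : Matrix.diagonal d = star U * P * U := by
    rw [hspec]
    calc Matrix.diagonal d = 1 * Matrix.diagonal d * 1 := by simp
      _ = (star U * U) * Matrix.diagonal d * (star U * U) := by rw [hUU]
      _ = _ := by simp only [Matrix.mul_assoc]
  have hd2 : ∀ i, d i * d i = d i := by
    have h : Matrix.diagonal d * Matrix.diagonal d = Matrix.diagonal d := by
      rw [hdd]
      calc star U * P * U * (star U * P * U) = star U * P * (U * star U) * P * U := by
            simp only [Matrix.mul_assoc]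
        _ = star U * (P * P) * U := by rw [hUU', Matrix.mul_one]; simp only [Matrix.mul_assoc]
        _ = _ := by rw [hPP]
    intro i
    have := congrFun (congrFun h i) i
    simpa [Matrix.diagonal_mul_diagonal] using this
  have hcard := hA.rank_eq_card_non_zero_eigs
  let e : Fin P.rank ≃ {i // hA.eigenvalues i ≠ 0} :=
    (finCongr hcard).trans (Fintype.equivFin _).symm
  refine ⟨U.submatrix id (fun j => (e j : α)), ?_, ?_⟩
  · ext a b
    have hab : P a b = ∑ j, U a j * d j * star (U b j) := by
      conv_lhs => rw [hspec, Matrix.mul_apply]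
      simp only [Matrix.mul_diagonal, Matrix.star_apply]
    rw [Matrix.mul_apply, hab]
    simp only [Matrix.submatrix_apply, id, Matrix.conjTranspose_apply]
    rw [Equiv.sum_comp e (fun j : {i // hA.eigenvalues i ≠ 0} => U a j * star (U b j))]
    have h1 : ∀ j, U a j * d j * star (U b j) =
        if hA.eigenvalues j ≠ 0 then U a j * star (U b j) else 0 := by
      intro j
      split_ifs with h
      · have : d j = 1 := by
          have h0 : d j ≠ 0 := by simpa [hd] using h
          exact mul_left_cancel₀ h0 (by rw [hd2, mul_one])
        rw [this, mul_one]
      · have : d j = 0 := by simpa [hd] using h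
        simp [this]
    simp_rw [h1]
    rw [← Finset.sum_filter]
    exact Finset.sum_subtype (p := fun i => hA.eigenvalues i ≠ 0) _ (by simp)
      (fun j => U a j * star (U b j)) |>.symm
  · ext i j
    have := congrFun (congrFun hUU (e i)) (e j)
    rw [Matrix.mul_apply] at this ⊢
    simp only [Matrix.star_apply] at this
    simp only [Matrix.conjTranspose_apply, Matrix.submatrix_apply, id]
    rw [this, Matrix.one_apply, Matrix.one_apply]
    simp [Subtype.ext_iff.symm]

theorem trace_eq_rank_of_isStarProjection {P : Matrix α α ℂ} (hP : IsStarProjection P) :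
    P.trace = P.rank := by
  obtain ⟨v, h1, h2⟩ := exists_isometry_of_isStarProjection hP
  conv_lhs => rw [← h1, Matrix.trace_mul_comm, h2]
  simp

/-- Over `ℂ`, projections with the same trace are Murray–von Neumann equivalent, also when their
sizes differ. -/
theorem mvN_of_trace_eq {P : Matrix α α ℂ} {Q : Matrix β β ℂ} (hP : IsStarProjection P)
    (hQ : IsStarProjection Q) (h : P.trace = Q.trace) : MvN P Q := by
  obtain ⟨v, h1, h2⟩ := exists_isometry_of_isStarProjection hP
  obtain ⟨w, h3, h4⟩ := exists_isometry_of_isStarProjection hQ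
  have hr : P.rank = Q.rank := by
    rw [trace_eq_rank_of_isStarProjection hP, trace_eq_rank_of_isStarProjection hQ] at h
    exact_mod_cast h
  rw [← h1]
  rw [← h3]
  revert v w
  rw [hr]
  intro v h1 h2 w h3 h4
  refine ⟨v * wᴴ, ?_, ?_⟩
  · rw [Matrix.conjTranspose_mul, Matrix.conjTranspose_conjTranspose, Matrix.mul_assoc,
      ← Matrix.mul_assoc wᴴ, h4, Matrix.one_mul]
  · rw [Matrix.conjTranspose_mul, Matrix.conjTranspose_conjTranspose, Matrix.mul_assoc,
      ← Matrix.mul_assoc vᴴ, h2, Matrix.one_mul]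

end MatrixProjections

/-! ### Ranks of projections over a finite product of matrix algebras -/

section Rank

variable {B : Type*} [NonUnitalRing B] [StarRing B] {κ : Type*} [Fintype κ] [DecidableEq κ]

/-- A matrix over `B`, read through a representation `f` of `B` by `κ × κ` matrices as one large
complex matrix. -/
def flatten (f : B →⋆ₙ+* Matrix κ κ ℂ) {α β : Type*} (p : Matrix α β B) :
    Matrix (α × κ) (β × κ) ℂ :=
  Matrix.of fun x y => f (p x.1 y.1) x.2 y.2

theorem flatten_mul (f : B →⋆ₙ+* Matrix κ κ ℂ) {α β γ : Type*} [Fintype β]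
    (p : Matrix α β B) (q : Matrix β γ B) : flatten f (p * q) = flatten f p * flatten f q := by
  ext x y
  simp [flatten, Matrix.mul_apply, Fintype.sum_prod_type, Matrix.sum_apply]

theorem flatten_conjTranspose (f : B →⋆ₙ+* Matrix κ κ ℂ) {α β : Type*} (p : Matrix α β B) :
    flatten f pᴴ = (flatten f p)ᴴ := by
  ext x y
  simp [flatten, map_star, Matrix.star_apply]

theorem isStarProjection_flatten (f : B →⋆ₙ+* Matrix κ κ ℂ) {α : Type*} [Fintype α]
    {p : Matrix α α B} (hp : IsStarProjection p) : IsStarProjection (flatten f p) := by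
  have h1 : p * p = p := hp.isIdempotentElem
  have h2 : pᴴ = p := hp.isSelfAdjoint
  refine ⟨?_, ?_⟩
  · rw [IsIdempotentElem, ← flatten_mul, h1]
  · rw [IsSelfAdjoint, Matrix.star_eq_conjTranspose, ← flatten_conjTranspose, h2]

theorem MvN.flatten {f : B →⋆ₙ+* Matrix κ κ ℂ} {α β : Type*} [Fintype α] [Fintype β]
    {p : Matrix α α B} {q : Matrix β β B} (h : MvN p q) :
    MvN (flatten f p) (flatten f q) := by
  obtain ⟨v, h1, h2⟩ := h
  exact ⟨KJB.flatten f v, by rw [← flatten_conjTranspose, ← flatten_mul, h1],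
    by rw [← flatten_conjTranspose, ← flatten_mul, h2]⟩

theorem MvN.trace_eq {α β : Type*} [Fintype α] [Fintype β]
    {P : Matrix α α ℂ} {Q : Matrix β β ℂ} (h : MvN P Q) : P.trace = Q.trace := by
  obtain ⟨v, h1, h2⟩ := h
  rw [← h1, ← h2, Matrix.trace_mul_comm]

theorem trace_flatten (f : B →⋆ₙ+* Matrix κ κ ℂ) {α : Type*} [Fintype α]
    (p : Matrix α α B) : (flatten f p).trace = ∑ a, (f (p a a)).trace := by
  simp [Matrix.trace, flatten, Fintype.sum_prod_type]

theorem trace_flatten_blocks (f : B →⋆ₙ+* Matrix κ κ ℂ) {α β : Type*} [Fintype α] [Fintype β]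
    (p : Matrix α α B) (q : Matrix β β B) :
    (flatten f (Matrix.fromBlocks p 0 0 q)).trace
      = (flatten f p).trace + (flatten f q).trace := by
  simp [trace_flatten]

/-- The rank of a class of projections over `B` in a representation `f` of `B` by matrices. -/
def rankV (f : B →⋆ₙ+* Matrix κ κ ℂ) : V B →+ ℕ where
  toFun := Quotient.lift (fun p : Proj B => (flatten f p.mat).rank) (by
    intro p q h
    have := (MvN.flatten (f := f) ((Proj.equiv_iff p q).1 h)).trace_eq
    rw [trace_eq_rank_of_isStarProjection (isStarProjection_flatten f p.isProj),
      trace_eq_rank_of_isStarProjection (isStarProjection_flatten f q.isProj)] at this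
    exact_mod_cast this)
  map_zero' := by
    have := trace_eq_rank_of_isStarProjection
      (isStarProjection_flatten f (Proj.zero : Proj B).isProj)
    have h0 : (flatten f (Proj.zero : Proj B).mat).trace = 0 := by
      rw [trace_flatten]; exact Finset.sum_empty
    rw [h0] at this
    change (flatten f (Proj.zero : Proj B).mat).rank = 0
    exact_mod_cast this.symm
  map_add' := by
    rintro ⟨p⟩ ⟨q⟩
    have h := (MvN.flatten (f := f) (Proj.add_mvN p q)).trace_eq
    rw [trace_flatten_blocks,
      trace_eq_rank_of_isStarProjection (isStarProjection_flatten f p.isProj),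
      trace_eq_rank_of_isStarProjection (isStarProjection_flatten f q.isProj),
      trace_eq_rank_of_isStarProjection (isStarProjection_flatten f (p.add q).isProj)] at h
    change (flatten f (p.add q).mat).rank = (flatten f p.mat).rank + (flatten f q.mat).rank
    exact_mod_cast h

/-- The rank homomorphism `K00 B → ℤ` of a representation of `B` by matrices. -/
def rankK (f : B →⋆ₙ+* Matrix κ κ ℂ) : K00 B →+ ℤ :=
  Algebra.GrothendieckAddGroup.lift ((Nat.castAddMonoidHom ℤ).comp (rankV f))

theorem rankK_of (f : B →⋆ₙ+* Matrix κ κ ℂ) (x : V B) :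
    rankK f (Algebra.GrothendieckAddGroup.of x) = rankV f x :=
  DFunLike.congr_fun (Algebra.GrothendieckAddGroup.lift.symm_apply_apply
    ((Nat.castAddMonoidHom ℤ).comp (rankV f))) x

theorem rankK_mk (f : B →⋆ₙ+* Matrix κ κ ℂ) (p : Proj B) :
    rankK f (K00.mk p) = ((flatten f p.mat).rank : ℤ) := rankK_of f _

theorem rankK_mk_cast (f : B →⋆ₙ+* Matrix κ κ ℂ) (p : Proj B) :
    ((rankK f (K00.mk p) : ℤ) : ℂ) = ∑ a, (f (p.mat a a)).trace := by
  rw [rankK_mk, ← trace_flatten,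
    trace_eq_rank_of_isStarProjection (isStarProjection_flatten f p.isProj)]
  simp

/-- Every element of `K00 B` is a difference of classes of projections. -/
theorem K00.exists_sub (x : K00 B) : ∃ p q : Proj B, x = K00.mk p - K00.mk q := by
  induction x using AddLocalization.induction_on with
  | H y =>
  obtain ⟨⟨p⟩, ⟨⟨q⟩, hq⟩⟩ := y
  refine ⟨p, q, ?_⟩
  rw [eq_sub_iff_add_eq, K00.mk, K00.mk]
  simp only [Algebra.GrothendieckAddGroup.of, AddLocalization.mk_eq_addMonoidOf_mk']
  exact AddSubmonoid.LocalizationMap.mk'_spec _ _ _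

/-- A family of representations that separates points determines matrices by their flattenings. -/
theorem flatten_ext {J : Type*} {κ : J → Type*} [∀ j, Fintype (κ j)]
    [∀ j, DecidableEq (κ j)] (f : ∀ j, B →⋆ₙ+* Matrix (κ j) (κ j) ℂ)
    (hf : Function.Injective fun b j => f j b) {α β : Type*} {x y : Matrix α β B}
    (h : ∀ j, flatten (f j) x = flatten (f j) y) : x = y := by
  ext a b
  refine hf (funext fun j => Matrix.ext fun s t => ?_)
  exact congrFun (congrFun (h j) (a, s)) (b, t)

/-- Projections over a finite product of matrix algebras are classified by their ranks. -/
theorem mvN_of_trace_flatten_eq {J : Type*} {κ : J → Type*} [∀ j, Fintype (κ j)]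
    [∀ j, DecidableEq (κ j)] (f : ∀ j, B →⋆ₙ+* Matrix (κ j) (κ j) ℂ)
    (hf : Function.Bijective fun b j => f j b) {α β : Type*} [Fintype α] [Fintype β]
    {p : Matrix α α B} {q : Matrix β β B} (hp : IsStarProjection p) (hq : IsStarProjection q)
    (h : ∀ j, (flatten (f j) p).trace = (flatten (f j) q).trace) : MvN p q := by
  classical
  have hv := fun j => mvN_of_trace_eq (isStarProjection_flatten (f j) hp)
    (isStarProjection_flatten (f j) hq) (h j)
  choose v h1 h2 using hv
  choose g hg using hf.2
  have hg' : ∀ x j, f j (g x) = x j := fun x j => congrFun (hg x) j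
  let V : Matrix α β B := Matrix.of fun a b => g fun j => Matrix.of fun s t => v j (a, s) (b, t)
  have hV : ∀ j, flatten (f j) V = v j := by
    intro j
    ext ⟨a, s⟩ ⟨b, t⟩
    simp [flatten, V, hg']
  refine ⟨V, flatten_ext f hf.1 fun j => ?_, flatten_ext f hf.1 fun j => ?_⟩
  · rw [flatten_mul, flatten_conjTranspose, hV, h1]
  · rw [flatten_mul, flatten_conjTranspose, hV, h2]

/-- The ranks in a complete family of matrix representations separate the points of `K00`. -/
theorem K00.eq_zero_of_rankK {J : Type*} {κ : J → Type*} [∀ j, Fintype (κ j)]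
    [∀ j, DecidableEq (κ j)] (f : ∀ j, B →⋆ₙ+* Matrix (κ j) (κ j) ℂ)
    (hf : Function.Bijective fun b j => f j b) (x : K00 B) (hx : ∀ j, rankK (f j) x = 0) :
    x = 0 := by
  obtain ⟨p, q, rfl⟩ := K00.exists_sub x
  rw [sub_eq_zero]
  have : (Quotient.mk _ p : V B) = Quotient.mk _ q := by
    refine Quotient.sound (mvN_of_trace_flatten_eq f hf p.isProj q.isProj fun j => ?_)
    have h := hx j
    rw [map_sub, sub_eq_zero] at h
    have h' := congrArg (Int.cast : ℤ → ℂ) h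
    rwa [rankK_mk_cast, rankK_mk_cast, ← trace_flatten, ← trace_flatten] at h'
  rw [K00.mk, K00.mk, this]

end Rank

/-! ### `K₀` of a finite product of matrix algebras -/

section K0Multimatrix

theorem rankK_comp {B C : Type*} [NonUnitalRing B] [StarRing B] [NonUnitalRing C] [StarRing C]
    {κ : Type*} [Fintype κ] [DecidableEq κ] (f : C →⋆ₙ+* Matrix κ κ ℂ) (g : B →⋆ₙ+* C)
    (x : K00 B) : rankK f (K00.map g x) = rankK (f.comp g) x := by
  obtain ⟨p, q, rfl⟩ := K00.exists_sub x
  rw [map_sub, map_sub, map_sub, K00.map_mk, K00.map_mk, rankK_mk, rankK_mk, rankK_mk, rankK_mk]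
  rfl

variable {A : Type*} [NonUnitalRing A] [StarRing A] [Module ℂ A] [IsScalarTower ℂ A A]
  [SMulCommClass ℂ A A] [StarModule ℂ A]

/-- The unital extension to `A~` of a representation of `A` by matrices. -/
def unitalRep {κ : Type*} [Fintype κ] [DecidableEq κ] (f : A →⋆ₙₐ[ℂ] Matrix κ κ ℂ) :
    Unitization ℂ A →⋆ₙ+* Matrix κ κ ℂ where
  toFun := Unitization.starLift f
  map_mul' := map_mul _
  map_zero' := map_zero _
  map_add' := map_add _
  map_star' := map_star _

theorem unitalRep_apply {κ : Type*} [Fintype κ] [DecidableEq κ] (f : A →⋆ₙₐ[ℂ] Matrix κ κ ℂ)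
    (x : Unitization ℂ A) : unitalRep f x = x.fst • (1 : Matrix κ κ ℂ) + f x.snd := by
  rw [← Algebra.algebraMap_eq_smul_one]
  rfl

/-- The one-dimensional representation of `ℂ`. -/
def scalarRep : ℂ →⋆ₙ+* Matrix Unit Unit ℂ where
  toFun c := Matrix.of fun _ _ => c
  map_mul' a b := by ext; simp [Matrix.mul_apply]
  map_zero' := rfl
  map_add' a b := rfl
  map_star' a := by ext; simp

variable {I : Type*} {ι : I → Type} [∀ i, Fintype (ι i)] [∀ i, DecidableEq (ι i)]

/-- Sizes of the matrix blocks of the unitization: one new block of size one. -/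
def unitIdx (ι : I → Type) : Option I → Type
  | none => Unit
  | some i => ι i

instance (j : Option I) : Fintype (unitIdx ι j) :=
  match j with
  | none => inferInstanceAs (Fintype Unit)
  | some i => inferInstanceAs (Fintype (ι i))

instance (j : Option I) : DecidableEq (unitIdx ι j) :=
  match j with
  | none => inferInstanceAs (DecidableEq Unit)
  | some i => inferInstanceAs (DecidableEq (ι i))

/-- The `i`-th block of a homomorphism into a product of matrix algebras. -/
def blockRep (π : A →⋆ₙₐ[ℂ] ∀ i, Matrix (ι i) (ι i) ℂ) (i : I) : A →⋆ₙₐ[ℂ] Matrix (ι i) (ι i) ℂ where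
  toFun a := π a i
  map_smul' c a := by simp
  map_zero' := by simp
  map_add' a b := by simp
  map_mul' a b := by simp
  map_star' a := by rw [map_star]; rfl

/-- The block representations of the unitization. -/
def unitizationRep (π : A →⋆ₙₐ[ℂ] ∀ i, Matrix (ι i) (ι i) ℂ) :
    ∀ j : Option I, Unitization ℂ A →⋆ₙ+* Matrix (unitIdx ι j) (unitIdx ι j) ℂ
  | none => scalarRep.comp (scalarPart A)
  | some i => unitalRep (blockRep π i)

/-- The unitization of a finite product of matrix algebras is the product with one more copy
of `ℂ`. -/
theorem bijective_unitizationRep (π : A →⋆ₙₐ[ℂ] ∀ i, Matrix (ι i) (ι i) ℂ)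
    (hπ : Function.Bijective π) : Function.Bijective fun b j => unitizationRep π j b := by
  constructor
  · intro x y hxy
    have h0 : x.fst = y.fst := congrFun (congrFun (congrFun hxy none) ()) ()
    refine Unitization.ext h0 (hπ.1 (funext fun i => ?_))
    have h1 : unitalRep (blockRep π i) x = unitalRep (blockRep π i) y := congrFun hxy (some i)
    rw [unitalRep_apply, unitalRep_apply, h0] at h1
    exact add_left_cancel h1
  · intro z
    let z0 : Matrix Unit Unit ℂ := z none
    let z1 : ∀ i, Matrix (ι i) (ι i) ℂ := fun i => z (some i)
    obtain ⟨a, ha⟩ := hπ.2 fun i => z1 i - z0 () () • (1 : Matrix (ι i) (ι i) ℂ)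
    refine ⟨Unitization.inl (z0 () ()) + Unitization.inr a,
      funext fun j => ?_⟩
    match j with
    | none =>
      refine Matrix.ext fun s t => ?_
      change z0 () () + 0 = z0 s t
      rw [add_zero]
      rfl
    | some i =>
      change unitalRep (blockRep π i) _ = z1 i
      rw [unitalRep_apply]
      simp only [Unitization.fst_add, Unitization.fst_inl, Unitization.fst_inr, add_zero,
        Unitization.snd_add, Unitization.snd_inl, Unitization.snd_inr, zero_add]
      change _ + π a i = _
      rw [ha]
      simp

/-- The ranks of a class in `K₀(A)` in the block representations of `A`. -/
def rankVec (π : A →⋆ₙₐ[ℂ] ∀ i, Matrix (ι i) (ι i) ℂ) : K0 A →+ (I → ℤ) :=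
  (AddMonoidHom.pi fun i => rankK (unitalRep (blockRep π i))).comp (K0 A).subtype

theorem rankVec_mk (π : A →⋆ₙₐ[ℂ] ∀ i, Matrix (ι i) (ι i) ℂ) (p : Proj A) (i : I) :
    rankVec π (K0.mk p) i = ((flatten (blockRep π i : A →⋆ₙ+* Matrix (ι i) (ι i) ℂ) p.mat).rank : ℤ) := by
  change rankK (unitalRep (blockRep π i)) (K00.mk (p.map (inclUnitization A))) = _
  rw [rankK_mk]
  congr 2
  ext x y
  change unitalRep (blockRep π i) (Unitization.inr (p.mat x.1 y.1)) x.2 y.2 =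
    blockRep π i (p.mat x.1 y.1) x.2 y.2
  rw [unitalRep_apply]
  simp

theorem rankVec_mk_cast (π : A →⋆ₙₐ[ℂ] ∀ i, Matrix (ι i) (ι i) ℂ) (p : Proj A) (i : I) :
    ((rankVec π (K0.mk p) i : ℤ) : ℂ) = ∑ a, (π (p.mat a a) i).trace := by
  rw [rankVec_mk, Int.cast_natCast,
    ← trace_eq_rank_of_isStarProjection (isStarProjection_flatten _ p.isProj), trace_flatten]
  rfl

theorem rankVec_cls_cast (π : A →⋆ₙₐ[ℂ] ∀ i, Matrix (ι i) (ι i) ℂ) (p : A)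
    (hp : IsStarProjection p) (i : I) :
    ((rankVec π (K0.cls p hp) i : ℤ) : ℂ) = (π p i).trace := by
  rw [K0.cls, rankVec_mk_cast]
  exact Fin.sum_univ_one _

/-- A class in `K₀(A)`, the kernel of the scalar part, has rank zero in the extra block of the
unitization, so its ranks in the blocks of `A` determine it. -/
theorem rankVec_injective (π : A →⋆ₙₐ[ℂ] ∀ i, Matrix (ι i) (ι i) ℂ) (hπ : Function.Bijective π) :
    Function.Injective (rankVec π) := by
  rw [injective_iff_map_eq_zero]
  rintro ⟨x, hx⟩ h
  refine Subtype.ext (K00.eq_zero_of_rankK _ (bijective_unitizationRep π hπ) x fun j => ?_)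
  match j with
  | none =>
    rw [K0, AddMonoidHom.mem_ker] at hx
    change rankK (scalarRep.comp (scalarPart A)) x = 0
    rw [← rankK_comp, hx, map_zero]
  | some i => exact congrFun h i

section Standard

theorem sum_fin_ite_lt {N m : ℕ} (h : m ≤ N) :
    ∑ a : Fin N, (if (a : ℕ) < m then (1 : ℂ) else 0) = m := by
  rw [Fin.sum_univ_eq_sum_range (fun a => if a < m then (1 : ℂ) else 0), ← Finset.sum_filter]
  have : (Finset.range N).filter (· < m) = Finset.range m := by
    ext a; simp; omega
  simp [this]

variable [∀ i, Nonempty (ι i)]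

theorem isStarProjection_diagonal_ite {κ : Type*} [Fintype κ] [DecidableEq κ] (P : κ → Prop)
    [DecidablePred P] :
    IsStarProjection (Matrix.diagonal fun s => if P s then (1 : ℂ) else 0) := by
  refine ⟨?_, ?_⟩
  · rw [IsIdempotentElem, Matrix.diagonal_mul_diagonal]
    simp
  · rw [IsSelfAdjoint, Matrix.star_eq_conjTranspose, Matrix.diagonal_conjTranspose]
    congr 1
    ext s
    simp [apply_ite star]

/-- Every vector of natural numbers is the rank vector of a projection over `A`. -/
theorem exists_proj_rankVec [Fintype I] (π : A →⋆ₙₐ[ℂ] ∀ i, Matrix (ι i) (ι i) ℂ)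
    (hπ : Function.Bijective π) (y : I → ℕ) :
    ∃ p : Proj A, ∀ i, rankVec π (K0.mk p) i = y i := by
  classical
  let s0 : ∀ i, ι i := fun i => Classical.arbitrary _
  -- a diagonal matrix of size `∑ yᵢ` over `A`, in which the block `i` has a rank one projection in
  -- the first `yᵢ` places
  let N := ∑ i, y i
  let d : Fin N → ∀ i, Matrix (ι i) (ι i) ℂ := fun a i =>
    Matrix.diagonal fun s => if s = s0 i ∧ (a : ℕ) < y i then 1 else 0
  choose g hg using hπ.2
  have hd : ∀ a, IsStarProjection (g (d a)) := by
    intro a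
    have h := fun i => isStarProjection_diagonal_ite fun s => s = s0 i ∧ (a : ℕ) < y i
    refine ⟨hπ.1 ?_, hπ.1 ?_⟩
    · rw [map_mul, hg]
      exact funext fun i => (h i).isIdempotentElem
    · rw [map_star, hg]
      exact funext fun i => (h i).isSelfAdjoint
  refine ⟨⟨N, Matrix.diagonal fun a => g (d a), ?_⟩, fun i => ?_⟩
  · refine ⟨?_, ?_⟩
    · rw [IsIdempotentElem, Matrix.diagonal_mul_diagonal]
      exact congrArg _ (funext fun a => (hd a).isIdempotentElem)
    · rw [IsSelfAdjoint, Matrix.star_eq_conjTranspose, Matrix.diagonal_conjTranspose]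
      exact congrArg _ (funext fun a => (hd a).isSelfAdjoint)
  · have h : y i ≤ N := Finset.single_le_sum (f := y) (fun _ _ => Nat.zero_le _) (Finset.mem_univ i)
    have := rankVec_mk_cast π ⟨N, Matrix.diagonal fun a => g (d a), ?_⟩ i
    · have h2 : ∑ a : Fin N, (π ((Matrix.diagonal fun a => g (d a)) a a) i).trace = (y i : ℂ) := by
        simp only [Matrix.diagonal_apply_eq, hg, d, Matrix.trace_diagonal]
        simp only [ite_and, Finset.sum_ite_eq', Finset.mem_univ, if_true]
        exact sum_fin_ite_lt h
      rw [h2] at this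
      exact_mod_cast this

theorem rankVec_surjective [Fintype I] (π : A →⋆ₙₐ[ℂ] ∀ i, Matrix (ι i) (ι i) ℂ)
    (hπ : Function.Bijective π) : Function.Surjective (rankVec π) := by
  intro y
  obtain ⟨p, hp⟩ := exists_proj_rankVec π hπ fun i => (y i).toNat
  obtain ⟨q, hq⟩ := exists_proj_rankVec π hπ fun i => (-y i).toNat
  refine ⟨K0.mk p - K0.mk q, funext fun i => ?_⟩
  rw [map_sub, Pi.sub_apply, hp, hq]
  exact Int.toNat_sub_toNat_neg (y i)

/-- `K₀` of a finite product of matrix algebras is free on the blocks. -/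
def rankEquiv [Fintype I] (π : A →⋆ₙₐ[ℂ] ∀ i, Matrix (ι i) (ι i) ℂ) (hπ : Function.Bijective π) :
    K0 A ≃+ (I → ℤ) :=
  AddEquiv.ofBijective (rankVec π) ⟨rankVec_injective π hπ, rankVec_surjective π hπ⟩

theorem rankVec_image_pos [Fintype I] (π : A →⋆ₙₐ[ℂ] ∀ i, Matrix (ι i) (ι i) ℂ)
    (hπ : Function.Bijective π) : rankVec π '' K0.pos A = {x | ∀ i, 0 ≤ x i} := by
  ext x
  constructor
  · rintro ⟨_, ⟨p, rfl⟩, rfl⟩ i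
    rw [rankVec_mk]
    positivity
  · intro hx
    obtain ⟨p, hp⟩ := exists_proj_rankVec π hπ fun i => (x i).toNat
    refine ⟨_, ⟨p, rfl⟩, funext fun i => ?_⟩
    rw [hp, Int.toNat_of_nonneg (hx i)]

theorem rankVec_image_scale (π : A →⋆ₙₐ[ℂ] ∀ i, Matrix (ι i) (ι i) ℂ)
    (hπ : Function.Bijective π) :
    rankVec π '' K0.scale A = {x | ∀ i, 0 ≤ x i ∧ x i ≤ (Fintype.card (ι i) : ℤ)} := by
  classical
  ext x
  constructor
  · rintro ⟨_, ⟨p, hp, rfl⟩, rfl⟩ i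
    have h := rankVec_cls_cast π p hp i
    have hpi : IsStarProjection (π p i) := by
      refine ⟨?_, ?_⟩
      · have := congrFun (congrArg π hp.isIdempotentElem) i
        rwa [map_mul] at this
      · have := congrFun (congrArg π hp.isSelfAdjoint) i
        rwa [map_star] at this
    rw [trace_eq_rank_of_isStarProjection hpi] at h
    have h' : rankVec π (K0.cls p hp) i = ((π p i).rank : ℤ) := by exact_mod_cast h
    rw [h']
    exact ⟨by positivity, by exact_mod_cast Matrix.rank_le_card_height _⟩
  · intro hx
    let d : ∀ i, Matrix (ι i) (ι i) ℂ := fun i =>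
      Matrix.diagonal fun s => if ((Fintype.equivFin (ι i) s : ℕ) < (x i).toNat) then 1 else 0
    obtain ⟨p, hp⟩ := hπ.2 d
    have h := fun i => isStarProjection_diagonal_ite
      fun s => (Fintype.equivFin (ι i) s : ℕ) < (x i).toNat
    have hp' : IsStarProjection p := by
      refine ⟨hπ.1 ?_, hπ.1 ?_⟩
      · rw [map_mul, hp]
        exact funext fun i => (h i).isIdempotentElem
      · rw [map_star, hp]
        exact funext fun i => (h i).isSelfAdjoint
    refine ⟨_, ⟨p, hp', rfl⟩, funext fun i => ?_⟩
    have h1 := rankVec_cls_cast π p hp' i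
    have h2 : (π p i).trace = ((x i).toNat : ℂ) := by
      rw [hp, Matrix.trace_diagonal]
      rw [Equiv.sum_comp (Fintype.equivFin (ι i)) fun a =>
        if (a : ℕ) < (x i).toNat then (1 : ℂ) else 0, sum_fin_ite_lt]
      have := (hx i).2
      omega
    rw [h2] at h1
    have h3 : rankVec π (K0.cls p hp') i = ((x i).toNat : ℤ) := by exact_mod_cast h1
    rw [h3, Int.toNat_of_nonneg (hx i).1]

/-- Naturality: a homomorphism that preserves the block traces preserves the ranks. -/
theorem rankVec_map [Fintype I] {A' : Type*} [NonUnitalRing A'] [StarRing A'] [Module ℂ A']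
    [IsScalarTower ℂ A' A'] [SMulCommClass ℂ A' A'] [StarModule ℂ A'] {ι' : I → Type}
    [∀ i, Fintype (ι' i)] [∀ i, DecidableEq (ι' i)]
    (π : A →⋆ₙₐ[ℂ] ∀ i, Matrix (ι i) (ι i) ℂ) (hπ : Function.Bijective π)
    (π' : A' →⋆ₙₐ[ℂ] ∀ i, Matrix (ι' i) (ι' i) ℂ) (g : A →⋆ₙₐ[ℂ] A')
    (hg : ∀ a i, (π' (g a) i).trace = (π a i).trace) (x : K0 A) :
    rankVec π' (K0.map g x) = rankVec π x := by
  -- classes of projections generate `K₀(A)`, so it suffices to treat them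
  have key : ∀ p : Proj A, rankVec π' (K0.map g (K0.mk p)) = rankVec π (K0.mk p) := by
    intro p
    have h : K0.map g (K0.mk p) = K0.mk (p.map (g : A →⋆ₙ+* A')) := by
      refine Subtype.ext ?_
      change K00.map (unitizationMap g) (K00.mk (p.map (inclUnitization A))) = K00.mk _
      rw [K00.map_mk]
      congr 1
      simp only [Proj.map, Matrix.map_map]
      congr 1
      refine Matrix.ext fun a b => ?_
      change Unitization.starMap g (Unitization.inr (p.mat a b)) = Unitization.inr (g (p.mat a b))
      simp
    funext i
    have h1 := rankVec_mk_cast π' (p.map (g : A →⋆ₙ+* A')) i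
    have h2 := rankVec_mk_cast π p i
    have h3 : ((rankVec π' (K0.mk (p.map (g : A →⋆ₙ+* A'))) i : ℤ) : ℂ)
        = (rankVec π (K0.mk p) i : ℤ) := by
      rw [h1, h2]
      exact Finset.sum_congr rfl fun a _ => hg _ _
    rw [h]
    exact_mod_cast h3
  obtain ⟨p, hp⟩ := exists_proj_rankVec π hπ fun i => (rankVec π x i).toNat
  obtain ⟨q, hq⟩ := exists_proj_rankVec π hπ fun i => (-rankVec π x i).toNat
  have hx : x = K0.mk p - K0.mk q := by
    refine rankVec_injective π hπ (funext fun i => ?_)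
    rw [map_sub, Pi.sub_apply, hp, hq]
    exact (Int.toNat_sub_toNat_neg _).symm
  rw [hx, map_sub, map_sub, map_sub, key, key]

end Standard

end K0Multimatrix

/-! ### Ternary homomorphisms of products of matrix spaces into a star algebra -/

section Ternary

variable {I : Type} [Fintype I] [DecidableEq I] {n m : I → Type} [∀ i, Fintype (n i)]
  [∀ i, DecidableEq (n i)] [∀ i, Fintype (m i)] [∀ i, DecidableEq (m i)]
  {B : Type*} [Ring B] [StarRing B] [Algebra ℂ B] [StarModule ℂ B]

/-- A finite product of spaces of rectangular matrices. -/
abbrev Rect (n m : I → Type) : Type := ∀ i, Matrix (n i) (m i) ℂ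

/-- A linear map into a star algebra that respects the ternary product `x y* z`. -/
def IsTernary (x : Rect n m →ₗ[ℂ] B) : Prop :=
  ∀ X Y Z : Rect n m, x (fun i => X i * (Y i)ᴴ * Z i) = x X * star (x Y) * x Z

/-- The element of `B` by which a left multiplication operator `A` of the rectangular matrices
acts; `e` is a family of matrices with `∑ e e* = 1`. -/
def lam (x : Rect n m →ₗ[ℂ] B) {J : Type} [Fintype J] (e : J → Rect n m) : Rect n n →ₗ[ℂ] B where
  toFun A := ∑ j, x (fun i => A i * e j i) * star (x (e j))
  map_add' A A' := by
    rw [← Finset.sum_add_distrib]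
    refine Finset.sum_congr rfl fun j _ => ?_
    rw [← add_mul, ← map_add]
    congr 2
    ext i : 1
    exact Matrix.add_mul _ _ _
  map_smul' c A := by
    rw [RingHom.id_apply, Finset.smul_sum]
    refine Finset.sum_congr rfl fun j _ => ?_
    rw [← smul_mul_assoc, ← map_smul]
    congr 2
    ext i : 1
    exact Matrix.smul_mul c (A i) (e j i)

variable {x : Rect n m →ₗ[ℂ] B} {J : Type} [Fintype J] {e : J → Rect n m}

theorem sum_apply_mul (he : ∀ i, ∑ j, e j i * (e j i)ᴴ = 1) (A : Rect n n) (X : Rect n m) :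
    ∑ j, x (fun i => A i * e j i * (e j i)ᴴ * X i) = x (fun i => A i * X i) := by
  rw [← map_sum]
  congr 1
  ext i : 1
  simp only [Finset.sum_apply]
  rw [← Matrix.sum_mul]
  simp_rw [Matrix.mul_assoc (A i)]
  rw [← Matrix.mul_sum, he, Matrix.mul_one]

theorem lam_mul_apply (hx : IsTernary x) (he : ∀ i, ∑ j, e j i * (e j i)ᴴ = 1) (A : Rect n n)
    (X : Rect n m) : lam x e A * x X = x fun i => A i * X i := by
  change (∑ j, _) * _ = _
  rw [Finset.sum_mul, ← sum_apply_mul he]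
  exact Finset.sum_congr rfl fun j _ => (hx _ _ _).symm

/-- The left action commutes with the involution. The element `e e* x` recovers `x`, which lets the
ternary identity move `A` from one factor to the other. -/
theorem star_lam (hx : IsTernary x) (he : ∀ i, ∑ j, e j i * (e j i)ᴴ = 1) (A : Rect n n) :
    star (lam x e A) = lam x e fun i => (A i)ᴴ := by
  change star (∑ j, _) = ∑ j, _
  have h1 : ∀ X : Rect n m, x X = ∑ k, x (e k) * star (x (e k)) * x X := by
    intro X
    have := lam_mul_apply hx he (fun i => 1) X
    simp only [Matrix.one_mul] at this
    conv_lhs => rw [← this]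
    change (∑ j, _) * _ = _
    rw [Finset.sum_mul]
    simp
  have h2 : ∀ j, x (fun i => (A i)ᴴ * e j i) * star (x (e j)) =
      ∑ k, x (e k) * star (x fun i => e j i * (e j i)ᴴ * (A i * e k i)) := by
    intro j
    rw [h1, Finset.sum_mul]
    refine Finset.sum_congr rfl fun k _ => ?_
    rw [mul_assoc, mul_assoc]
    congr 1
    have := hx (e j) (fun i => (A i)ᴴ * e j i) (e k)
    have h3 : (fun i => e j i * (e j i)ᴴ * (A i * e k i)) =
        fun i => e j i * ((A i)ᴴ * e j i)ᴴ * e k i := by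
      ext i : 1
      simp [Matrix.mul_assoc]
    rw [h3, this]
    simp [mul_assoc]
  simp_rw [h2]
  rw [Finset.sum_comm, star_sum]
  refine Finset.sum_congr rfl fun k _ => ?_
  rw [← Finset.mul_sum, ← star_sum, star_mul, star_star]
  congr 2
  have := sum_apply_mul (x := x) he (fun i => 1) (fun i => A i * e k i)
  simp only [Matrix.one_mul] at this
  exact this.symm

theorem lam_mul_lam (hx : IsTernary x) (he : ∀ i, ∑ j, e j i * (e j i)ᴴ = 1) (A A' : Rect n n) :
    lam x e A * lam x e A' = lam x e fun i => A i * A' i := by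
  change _ * (∑ j, _) = ∑ j, _
  rw [Finset.mul_sum]
  refine Finset.sum_congr rfl fun j _ => ?_
  rw [← mul_assoc, lam_mul_apply hx he]
  simp only [Matrix.mul_assoc]

/-- The product `x(X) x(Y)*` depends on the matrix `X Y*` only. -/
theorem apply_mul_star_apply (hx : IsTernary x) (he : ∀ i, ∑ j, e j i * (e j i)ᴴ = 1)
    (X Y : Rect n m) : x X * star (x Y) = lam x e fun i => X i * (Y i)ᴴ := by
  have h := star_lam hx he fun i => Y i * (X i)ᴴ
  simp only [Matrix.conjTranspose_mul, Matrix.conjTranspose_conjTranspose] at h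
  rw [← h]
  change _ = star (∑ j, _)
  have h1 : ∀ j, x (fun i => Y i * (X i)ᴴ * e j i) = x Y * star (x X) * x (e j) :=
    fun j => hx _ _ _
  simp_rw [h1]
  rw [star_sum]
  have h2 := lam_mul_apply hx he (fun i => 1) X
  simp only [Matrix.one_mul] at h2
  conv_lhs => rw [← h2]
  change (∑ j, _) * _ * _ = _
  rw [Finset.sum_mul, Finset.sum_mul]
  refine Finset.sum_congr rfl fun j _ => ?_
  simp [mul_assoc]

/-- Matrix units `e` in a fixed column of each block satisfy `∑ e e* = 1`. -/
theorem exists_family (n m : I → Type) [∀ i, Fintype (n i)]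
    [∀ i, DecidableEq (n i)] [∀ i, Fintype (m i)] [∀ i, DecidableEq (m i)] [∀ i, Nonempty (m i)] :
    ∃ (J : Type) (_ : Fintype J) (e : J → Rect n m), ∀ i, ∑ j, e j i * (e j i)ᴴ = 1 := by
  refine ⟨Σ i, n i, inferInstance, fun j => Pi.single j.1
    (Matrix.single j.2 (Classical.arbitrary (m j.1)) 1), fun i => ?_⟩
  rw [Fintype.sum_sigma, Finset.sum_eq_single i]
  · simp [Matrix.single_mul_single_same, Matrix.conjTranspose_single, ← Matrix.diagonal_one,
      ← Matrix.sum_single_eq_diagonal]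
  · intro k _ hk
    simp [Pi.single_eq_of_ne (Ne.symm hk)]
  · simp

/-- The adjoint of a ternary map. -/
def adj (x : Rect n m →ₗ[ℂ] B) : Rect m n →ₗ[ℂ] B where
  toFun X := star (x fun i => (X i)ᴴ)
  map_add' X Y := by
    rw [← star_add, ← map_add]
    congr 2
    ext i : 1
    exact Matrix.conjTranspose_add _ _
  map_smul' c X := by
    have : (fun i => ((c • X) i)ᴴ) = star c • fun i => (X i)ᴴ := by
      ext i : 1
      exact Matrix.conjTranspose_smul c (X i)
    rw [this, map_smul, star_smul, star_star, RingHom.id_apply]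

theorem isTernary_adj (hx : IsTernary x) : IsTernary (adj x) := by
  intro X Y Z
  have := hx (fun i => (Z i)ᴴ) (fun i => (Y i)ᴴ) (fun i => (X i)ᴴ)
  change star (x _) = star (x _) * star (star (x _)) * star (x _)
  rw [← star_mul, ← star_mul, ← mul_assoc, ← this]
  congr 2
  ext i : 1
  simp [Matrix.mul_assoc]

/-- A ternary map `x` with `x(X) x(Y) = 0` is the upper right corner of a homomorphism of the
square block matrices. -/
theorem exists_linkingHom [∀ i, Nonempty (n i)] [∀ i, Nonempty (m i)] (hx : IsTernary x)
    (h0 : ∀ X Y, x X * x Y = 0) :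
    ∃ Ψ : (∀ i, Matrix (n i ⊕ m i) (n i ⊕ m i) ℂ) →⋆ₙₐ[ℂ] B,
      (∀ X : Rect n m, Ψ (fun i => Matrix.fromBlocks 0 (X i) 0 0) = x X) := by
  obtain ⟨J, _, e, he⟩ := exists_family n m
  obtain ⟨J', _, e', he'⟩ := exists_family m n
  have hy := isTernary_adj hx
  have a1 := lam_mul_apply hx he
  have a2 := star_lam hx he
  have a3 := lam_mul_lam hx he
  have a4 := apply_mul_star_apply hx he
  have b1 := lam_mul_apply hy he'
  have b2 := star_lam hy he'
  have b3 := lam_mul_lam hy he'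
  have b4 := apply_mul_star_apply hy he'
  have hy' : ∀ X, star (x X) = adj x fun i => (X i)ᴴ := by
    intro X
    change _ = star (x _)
    simp
  have hx' : ∀ X, star (adj x X) = x fun i => (X i)ᴴ := fun X => star_star _
  have c1 : ∀ X Y, adj x X * adj x Y = 0 := by
    intro X Y
    change star _ * star _ = 0
    rw [← star_mul, h0, star_zero]
  have c2 : ∀ A X, lam x e A * adj x X = 0 := by
    intro A X
    change (∑ j, _) * _ = 0
    simp only [hy', Finset.sum_mul, mul_assoc, c1, mul_zero, Finset.sum_const_zero]
  have c3 : ∀ A X, x X * lam x e A = 0 := by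
    intro A X
    change _ * (∑ j, _) = 0
    simp only [Finset.mul_sum, ← mul_assoc, h0, zero_mul, Finset.sum_const_zero]
  have c4 : ∀ A X, lam (adj x) e' A * x X = 0 := by
    intro A X
    change (∑ j, _) * _ = 0
    simp only [hx', Finset.sum_mul, mul_assoc, h0, mul_zero, Finset.sum_const_zero]
  have c5 : ∀ A X, adj x X * lam (adj x) e' A = 0 := by
    intro A X
    change _ * (∑ j, _) = 0
    simp only [Finset.mul_sum, ← mul_assoc, c1, zero_mul, Finset.sum_const_zero]
  have c6 : ∀ A A', lam x e A * lam (adj x) e' A' = 0 := by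
    intro A A'
    change _ * (∑ j, _) = 0
    simp only [Finset.mul_sum, ← mul_assoc, c2, zero_mul, Finset.sum_const_zero]
  have c7 : ∀ A A', lam (adj x) e' A * lam x e A' = 0 := by
    intro A A'
    change _ * (∑ j, _) = 0
    simp only [Finset.mul_sum, ← mul_assoc, c4, zero_mul, Finset.sum_const_zero]
  have d1 : ∀ A X, x X * lam (adj x) e' A = x fun i => X i * A i := by
    intro A X
    rw [← star_star (_ * _), star_mul, b2, hy', b1, hx']
    simp
  have d2 : ∀ A X, adj x X * lam x e A = adj x fun i => X i * A i := by
    intro A X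
    rw [← star_star (_ * _), star_mul, a2, hx', a1, hy']
    simp
  have d3 : ∀ X Y, x X * adj x Y = lam x e fun i => X i * Y i := by
    intro X Y
    have := a4 X fun i => (Y i)ᴴ
    rw [hy'] at this
    simpa using this
  have d4 : ∀ X Y, adj x Y * x X = lam (adj x) e' fun i => Y i * X i := by
    intro X Y
    have := b4 Y fun i => (X i)ᴴ
    rw [hx'] at this
    simpa using this
  let Ψ : (∀ i, Matrix (n i ⊕ m i) (n i ⊕ m i) ℂ) →⋆ₙₐ[ℂ] B :=
    { toFun := fun M => lam x e (fun i => (M i).toBlocks₁₁) + x (fun i => (M i).toBlocks₁₂)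
        + (adj x (fun i => (M i).toBlocks₂₁) + lam (adj x) e' (fun i => (M i).toBlocks₂₂))
      map_smul' := by
        intro c M
        simp only [MonoidHom.id_apply, smul_add, ← map_smul]
        rfl
      map_zero' := by
        have h1 : (fun i => ((0 : ∀ i, Matrix (n i ⊕ m i) (n i ⊕ m i) ℂ) i).toBlocks₁₁) = 0 := rfl
        have h2 : (fun i => ((0 : ∀ i, Matrix (n i ⊕ m i) (n i ⊕ m i) ℂ) i).toBlocks₁₂) = 0 := rfl
        have h3 : (fun i => ((0 : ∀ i, Matrix (n i ⊕ m i) (n i ⊕ m i) ℂ) i).toBlocks₂₁) = 0 := rfl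
        have h4 : (fun i => ((0 : ∀ i, Matrix (n i ⊕ m i) (n i ⊕ m i) ℂ) i).toBlocks₂₂) = 0 := rfl
        rw [h1, h2, h3, h4]
        simp
      map_add' := by
        intro M M'
        have h1 : (fun i => ((M + M') i).toBlocks₁₁)
          = (fun i => (M i).toBlocks₁₁) + fun i => (M' i).toBlocks₁₁ := rfl
        have h2 : (fun i => ((M + M') i).toBlocks₁₂)
          = (fun i => (M i).toBlocks₁₂) + fun i => (M' i).toBlocks₁₂ := rfl
        have h3 : (fun i => ((M + M') i).toBlocks₂₁)
          = (fun i => (M i).toBlocks₂₁) + fun i => (M' i).toBlocks₂₁ := rfl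
        have h4 : (fun i => ((M + M') i).toBlocks₂₂)
          = (fun i => (M i).toBlocks₂₂) + fun i => (M' i).toBlocks₂₂ := rfl
        rw [h1, h2, h3, h4]
        simp only [map_add]
        abel
      map_mul' := by
        intro M M'
        have hM : ∀ i, M i * M' i = Matrix.fromBlocks
            ((M i).toBlocks₁₁ * (M' i).toBlocks₁₁ + (M i).toBlocks₁₂ * (M' i).toBlocks₂₁)
            ((M i).toBlocks₁₁ * (M' i).toBlocks₁₂ + (M i).toBlocks₁₂ * (M' i).toBlocks₂₂)
            ((M i).toBlocks₂₁ * (M' i).toBlocks₁₁ + (M i).toBlocks₂₂ * (M' i).toBlocks₂₁)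
            ((M i).toBlocks₂₁ * (M' i).toBlocks₁₂ + (M i).toBlocks₂₂ * (M' i).toBlocks₂₂) := by
          intro i
          rw [← Matrix.fromBlocks_multiply, Matrix.fromBlocks_toBlocks, Matrix.fromBlocks_toBlocks]
        simp only [Pi.mul_apply, hM, Matrix.toBlocks_fromBlocks₁₁, Matrix.toBlocks_fromBlocks₁₂,
          Matrix.toBlocks_fromBlocks₂₁, Matrix.toBlocks_fromBlocks₂₂, mul_add, add_mul,
          a1, a3, b1, b3, h0, c1, c2, c3, c4, c5, c6, c7, d1, d2, d3, d4, add_zero, zero_add]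
        have hs : ∀ {p q : I → Type} (f g : Rect p q), (fun i => f i + g i) = f + g :=
          fun _ _ => rfl
        simp only [hs, map_add]
        abel
      map_star' := by
        intro M
        have hM : ∀ i, star (M i) = Matrix.fromBlocks (M i).toBlocks₁₁ᴴ (M i).toBlocks₂₁ᴴ
            (M i).toBlocks₁₂ᴴ (M i).toBlocks₂₂ᴴ := by
          intro i
          rw [← Matrix.fromBlocks_conjTranspose, Matrix.fromBlocks_toBlocks]
          rfl
        simp only [Pi.star_apply, hM, Matrix.toBlocks_fromBlocks₁₁, Matrix.toBlocks_fromBlocks₁₂,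
          Matrix.toBlocks_fromBlocks₂₁, Matrix.toBlocks_fromBlocks₂₂, star_add, a2, b2, hy', hx']
        abel }
  refine ⟨Ψ, fun X => ?_⟩
  change lam x e _ + x _ + (adj x _ + lam (adj x) e' _) = _
  simp only [Matrix.toBlocks_fromBlocks₁₁, Matrix.toBlocks_fromBlocks₁₂,
          Matrix.toBlocks_fromBlocks₂₁, Matrix.toBlocks_fromBlocks₂₂]
  have h1 : ∀ {p q : I → Type}, (fun i => (0 : Matrix (p i) (q i) ℂ)) = (0 : Rect p q) := rfl
  simp [h1]

/-- Injectivity of the homomorphism of block matrices can be tested in the upper right corner. -/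
theorem linkingHom_injective [∀ i, Nonempty (n i)] [∀ i, Nonempty (m i)]
    (hinj : Function.Injective x)
    {Ψ : (∀ i, Matrix (n i ⊕ m i) (n i ⊕ m i) ℂ) →⋆ₙₐ[ℂ] B}
    (hΨ : ∀ X : Rect n m, Ψ (fun i => Matrix.fromBlocks 0 (X i) 0 0) = x X) :
    Function.Injective Ψ := by
  rw [injective_iff_map_eq_zero]
  intro M hM
  ext i s t
  -- move the entry `M i s t` into the upper right corner
  let a0 : n i := Classical.arbitrary _
  let b0 : m i := Classical.arbitrary _
  let P : ∀ i, Matrix (n i ⊕ m i) (n i ⊕ m i) ℂ := Pi.single i (Matrix.single (.inl a0) s 1)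
  let Q : ∀ i, Matrix (n i ⊕ m i) (n i ⊕ m i) ℂ := Pi.single i (Matrix.single t (.inr b0) 1)
  have h1 : Ψ (P * M * Q) = 0 := by rw [map_mul, map_mul, hM, mul_zero, zero_mul]
  have h2 : P * M * Q = fun k => Matrix.fromBlocks 0
      ((Pi.single i (Matrix.single a0 b0 (M i s t)) : Rect n m) k) 0 0 := by
    ext k : 1
    by_cases hk : k = i
    · subst hk
      ext (a | a) (b | b) <;>
        simp [P, Q, Matrix.single_mul_mul_single, Matrix.single_apply]
    · simp [P, Q, Pi.single_eq_of_ne hk]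
  rw [h2, hΨ] at h1
  have h3 := congrFun (congrFun (congrFun (hinj (h1.trans (map_zero x).symm)) i) a0) b0
  simpa using h3

end Ternary

/-! ### The algebras of a finite dimensional ternary ring of operators -/

section Blocks

variable {I : Type} [Fintype I] [DecidableEq I] {n m : I → Type} [∀ i, Fintype (n i)]
  [∀ i, DecidableEq (n i)] [∀ i, Fintype (m i)] [∀ i, DecidableEq (m i)]

variable (n m) in
/-- The upper left corner of the block matrices. -/
def upperLeft : (∀ i, Matrix (n i) (n i) ℂ) →⋆ₙₐ[ℂ] ∀ i, Matrix (n i ⊕ m i) (n i ⊕ m i) ℂ where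
  toFun A i := Matrix.fromBlocks (A i) 0 0 0
  map_smul' c A := by ext i : 1; simp [Matrix.fromBlocks_smul]
  map_zero' := by ext i : 1; simp
  map_add' A A' := by ext i : 1; simp [Matrix.fromBlocks_add]
  map_mul' A A' := by ext i : 1; simp [Matrix.fromBlocks_multiply]
  map_star' A := by
    ext i : 1
    simp [Matrix.star_eq_conjTranspose, Matrix.fromBlocks_conjTranspose]

variable (n m) in
/-- The lower right corner of the block matrices. -/
def lowerRight : (∀ i, Matrix (m i) (m i) ℂ) →⋆ₙₐ[ℂ] ∀ i, Matrix (n i ⊕ m i) (n i ⊕ m i) ℂ where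
  toFun A i := Matrix.fromBlocks 0 0 0 (A i)
  map_smul' c A := by ext i : 1; simp [Matrix.fromBlocks_smul]
  map_zero' := by ext i : 1; simp
  map_add' A A' := by ext i : 1; simp [Matrix.fromBlocks_add]
  map_mul' A A' := by ext i : 1; simp [Matrix.fromBlocks_multiply]
  map_star' A := by
    ext i : 1
    simp [Matrix.star_eq_conjTranspose, Matrix.fromBlocks_conjTranspose]

/-- The upper right corner of the block matrices. -/
def upperRight (X : Rect n m) : ∀ i, Matrix (n i ⊕ m i) (n i ⊕ m i) ℂ :=
  fun i => Matrix.fromBlocks 0 (X i) 0 0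

theorem upperRight_mul_star (X Y : Rect n m) :
    upperRight X * star (upperRight Y) = upperLeft n m fun i => X i * (Y i)ᴴ := by
  ext i : 1
  simp [upperRight, upperLeft, Matrix.star_eq_conjTranspose, Matrix.fromBlocks_conjTranspose,
    Matrix.fromBlocks_multiply]

theorem star_upperRight_mul (X Y : Rect n m) :
    star (upperRight X) * upperRight Y = lowerRight n m fun i => (X i)ᴴ * Y i := by
  ext i : 1
  simp [upperRight, lowerRight, Matrix.star_eq_conjTranspose, Matrix.fromBlocks_conjTranspose,
    Matrix.fromBlocks_multiply]

theorem injective_upperLeft : Function.Injective (upperLeft n m) := fun A A' h => by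
  ext i : 1
  exact (Matrix.fromBlocks_inj.1 (congrFun h i)).1

theorem injective_lowerRight : Function.Injective (lowerRight n m) := fun A A' h => by
  ext i : 1
  exact (Matrix.fromBlocks_inj.1 (congrFun h i)).2.2.2

theorem exists_sum_upperLeft [∀ i, Nonempty (m i)] (A : ∀ i, Matrix (n i) (n i) ℂ) :
    ∃ (J : Type) (_ : Fintype J) (X Y : J → Rect n m),
      A = ∑ j, fun i => X j i * (Y j i)ᴴ := by
  obtain ⟨J, hJ, e, he⟩ := exists_family n m
  refine ⟨J, hJ, fun j i => A i * e j i, e, ?_⟩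
  ext i : 1
  simp only [Finset.sum_apply, Matrix.mul_assoc]
  rw [← Matrix.mul_sum, he, Matrix.mul_one]

theorem exists_sum_lowerRight [∀ i, Nonempty (n i)] (A : ∀ i, Matrix (m i) (m i) ℂ) :
    ∃ (J : Type) (_ : Fintype J) (X Y : J → Rect n m),
      A = ∑ j, fun i => (X j i)ᴴ * Y j i := by
  obtain ⟨J, hJ, X, Y, h⟩ := exists_sum_upperLeft (n := m) (m := n) A
  exact ⟨J, hJ, fun j i => (X j i)ᴴ, fun j i => (Y j i)ᴴ, by simpa using h⟩

/-- The block matrices are generated by their upper right corner. -/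
theorem mem_of_upperRight [∀ i, Nonempty (n i)] [∀ i, Nonempty (m i)]
    (S : NonUnitalStarSubalgebra ℂ (∀ i, Matrix (n i ⊕ m i) (n i ⊕ m i) ℂ))
    (h : ∀ X : Rect n m, upperRight X ∈ S) (M : ∀ i, Matrix (n i ⊕ m i) (n i ⊕ m i) ℂ) :
    M ∈ S := by
  have h1 : ∀ A, upperLeft n m A ∈ S := by
    intro A
    obtain ⟨J, _, X, Y, rfl⟩ := exists_sum_upperLeft (m := m) A
    rw [map_sum]
    refine sum_mem fun j _ => ?_
    rw [← upperRight_mul_star]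
    exact mul_mem (h _) (star_mem (h _))
  have h2 : ∀ A, lowerRight n m A ∈ S := by
    intro A
    obtain ⟨J, _, X, Y, rfl⟩ := exists_sum_lowerRight (n := n) A
    rw [map_sum]
    refine sum_mem fun j _ => ?_
    rw [← star_upperRight_mul]
    exact mul_mem (star_mem (h _)) (h _)
  have h3 : M = upperLeft n m (fun i => (M i).toBlocks₁₁)
      + upperRight (fun i => (M i).toBlocks₁₂) + star (upperRight fun i => (M i).toBlocks₂₁ᴴ)
      + lowerRight n m fun i => (M i).toBlocks₂₂ := by
    ext i : 1
    simp [upperLeft, upperRight, lowerRight, Matrix.star_eq_conjTranspose,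
      Matrix.fromBlocks_conjTranspose, Matrix.fromBlocks_add, Matrix.fromBlocks_toBlocks]
  rw [h3]
  exact add_mem (add_mem (add_mem (h1 _) (h _)) (star_mem (h _))) (h2 _)

end Blocks

/-- Two injective homomorphisms with the same range differ by an isomorphism. -/
theorem exists_rep {A M B : Type*} [NonUnitalRing A] [StarRing A] [Module ℂ A]
    [NonUnitalRing M] [StarRing M] [Module ℂ M]
    [NonUnitalRing B] [StarRing B] [Module ℂ B]
    (j : A →⋆ₙₐ[ℂ] B) (hj : Function.Injective j) (Λ : M →⋆ₙₐ[ℂ] B) (hΛ : Function.Injective Λ)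
    (h1 : ∀ a, ∃ x, Λ x = j a) (h2 : ∀ x, ∃ a, j a = Λ x) :
    ∃ π : A →⋆ₙₐ[ℂ] M, Function.Bijective π ∧ ∀ a, Λ (π a) = j a := by
  choose f hf using h1
  refine ⟨{
    toFun := f
    map_smul' := ?_
    map_zero' := ?_
    map_add' := ?_
    map_mul' := ?_
    map_star' := ?_ }, ⟨fun a b hab => hj ?_, fun x => ?_⟩, hf⟩
  · intro c a
    apply hΛ
    rw [hf, MonoidHom.id_apply, map_smul, map_smul, hf]
  · apply hΛ
    rw [hf, map_zero, map_zero]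
  · intro a b
    apply hΛ
    rw [hf, map_add, map_add, hf, hf]
  · intro a b
    apply hΛ
    rw [hf, map_mul, map_mul, hf, hf]
  · intro a
    apply hΛ
    rw [hf, map_star, map_star, hf]
  · rw [← hf, ← hf]
    exact congrArg Λ hab
  · obtain ⟨a, ha⟩ := h2 x
    refine ⟨a, hΛ ?_⟩
    rw [← ha]
    exact hf a

/-- A finite dimensional range is closed. -/
theorem mem_range_of_mem_closure {M B : Type*} [NonUnitalRing M] [StarRing M] [Module ℂ M]
    [FiniteDimensional ℂ M] [NormedRing B] [StarRing B] [CStarRing B] [NormedAlgebra ℂ B] [StarModule ℂ B]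
    (Λ : M →⋆ₙₐ[ℂ] B) {b : B}
    (hb : b ∈ (NonUnitalStarAlgHom.range Λ).topologicalClosure) : ∃ x, Λ x = b := by
  let L : M →ₗ[ℂ] B := { toFun := Λ, map_add' := map_add Λ, map_smul' := map_smul Λ }
  have h : IsClosed (Set.range Λ) := (LinearMap.range L).closed_of_finiteDimensional
  have hb' : b ∈ closure (Set.range Λ) := hb
  rwa [h.closure_eq] at hb'

namespace TRO

variable (T : TRO.{v})

theorem adjoint_inH_comp_inK :
    ContinuousLinearMap.adjoint T.inH.toContinuousLinearMap ∘L T.inK.toContinuousLinearMap = 0 := by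
  ext z
  refine ext_inner_left ℂ fun y => ?_
  rw [ContinuousLinearMap.comp_apply, ContinuousLinearMap.adjoint_inner_right]
  simp [inH, inK, WithLp.prod_inner_apply]

theorem adjoint_inK_comp_inK :
    ContinuousLinearMap.adjoint T.inK.toContinuousLinearMap ∘L T.inK.toContinuousLinearMap =
      ContinuousLinearMap.id ℂ T.K := adjoint_comp_isometry T.inK

theorem adjoint_inH_comp_inH :
    ContinuousLinearMap.adjoint T.inH.toContinuousLinearMap ∘L T.inH.toContinuousLinearMap =
      ContinuousLinearMap.id ℂ T.H := adjoint_comp_isometry T.inH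

/-- Corner operators have square zero: the copies of `H` and `K` in `K ⊕ H` are orthogonal. -/
theorem cornerOp_mul_cornerOp (x y : T.H →L[ℂ] T.K) : T.cornerOp x * T.cornerOp y = 0 := by
  ext1 z
  have := DFunLike.congr_fun T.adjoint_inH_comp_inK
    (y (ContinuousLinearMap.adjoint T.inH.toContinuousLinearMap z))
  have h := congrArg (fun k => T.inK (x k)) this
  refine h.trans ?_
  simp

theorem cornerOp_mul_star (x y : T.H →L[ℂ] T.K) :
    T.cornerOp x * star (T.cornerOp y) = corner T.inK (x ∘L ContinuousLinearMap.adjoint y) := by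
  rw [star_cornerOp]
  ext1 z
  have := DFunLike.congr_fun T.adjoint_inH_comp_inH
    (ContinuousLinearMap.adjoint y (ContinuousLinearMap.adjoint T.inK.toContinuousLinearMap z))
  exact congrArg (fun k => T.inK (x k)) this

theorem star_cornerOp_mul (x y : T.H →L[ℂ] T.K) :
    star (T.cornerOp x) * T.cornerOp y = corner T.inH (ContinuousLinearMap.adjoint x ∘L y) := by
  rw [star_cornerOp]
  ext1 z
  have := DFunLike.congr_fun T.adjoint_inK_comp_inK
    (y (ContinuousLinearMap.adjoint T.inH.toContinuousLinearMap z))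
  exact congrArg (fun k => T.inH (ContinuousLinearMap.adjoint x k)) this

/-- The corner map turns the ternary product of `T` into the product `x y* z` of operators on
`K ⊕ H`. -/
theorem cornerOp_tern (x y z : T.H →L[ℂ] T.K) :
    T.cornerOp x * star (T.cornerOp y) * T.cornerOp z =
      T.cornerOp (x ∘L ContinuousLinearMap.adjoint y ∘L z) := by
  rw [cornerOp_mul_star]
  ext1 t
  have := DFunLike.congr_fun T.adjoint_inK_comp_inK
    (z (ContinuousLinearMap.adjoint T.inH.toContinuousLinearMap t))
  exact congrArg (fun k => T.inK (x (ContinuousLinearMap.adjoint y k))) this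

/-- Compression of an operator on `K ⊕ H` to its upper right corner. -/
def compress : (T.E →L[ℂ] T.E) →ₗ[ℂ] (T.H →L[ℂ] T.K) where
  toFun a := ContinuousLinearMap.adjoint T.inK.toContinuousLinearMap ∘L a ∘L
    T.inH.toContinuousLinearMap
  map_add' a b := by ext; simp
  map_smul' c a := by ext; simp

theorem compress_cornerOp (x : T.H →L[ℂ] T.K) : T.compress (T.cornerOp x) = x := by
  ext1 z
  have h1 := DFunLike.congr_fun T.adjoint_inH_comp_inH z
  have h2 := DFunLike.congr_fun T.adjoint_inK_comp_inK (x z)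
  refine Eq.trans ?_ h2
  exact congrArg (fun k => ContinuousLinearMap.adjoint T.inK.toContinuousLinearMap (T.inK (x k))) h1

/-- `cornerOp` as a linear map. -/
def cornerMap : (T.H →L[ℂ] T.K) →ₗ[ℂ] (T.E →L[ℂ] T.E) where
  toFun := T.cornerOp
  map_add' a b := by ext1; simp [cornerOp]
  map_smul' c a := by ext1; simp [cornerOp]

theorem corner_injective {F G : Type*} [NormedAddCommGroup F] [InnerProductSpace ℂ F]
    [CompleteSpace F] [NormedAddCommGroup G] [InnerProductSpace ℂ G] [CompleteSpace G]
    (j : F →ₗᵢ[ℂ] G) : Function.Injective (corner j) := by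
  intro a b hab
  ext1 z
  have h := DFunLike.congr_fun (adjoint_comp_isometry j) z
  have h1 := DFunLike.congr_fun hab (j z)
  change j (a (ContinuousLinearMap.adjoint j.toContinuousLinearMap (j z))) =
    j (b (ContinuousLinearMap.adjoint j.toContinuousLinearMap (j z))) at h1
  change ContinuousLinearMap.adjoint j.toContinuousLinearMap (j z) = z at h
  rw [h] at h1
  exact j.injective h1

variable {T}
variable {I : Type} [Fintype I] [DecidableEq I] {n m : I → Type} [∀ i, Fintype (n i)]
  [∀ i, DecidableEq (n i)] [∀ i, Fintype (m i)] [∀ i, DecidableEq (m i)]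
  [∀ i, Nonempty (n i)] [∀ i, Nonempty (m i)]

set_option synthInstance.maxHeartbeats 200000 in
set_option maxHeartbeats 1600000 in
/-- An isomorphism from a product of spaces of matrices onto `T` identifies `L(T)`, `R(T)` and the
linking algebra with the corresponding products of matrix algebras. -/
theorem exists_block_reps (θ : Rect n m →ₗ[ℂ] T.carrier) (hθ : Function.Bijective θ)
    (hθt : ∀ X Y Z : Rect n m, θ (fun i => X i * (Y i)ᴴ * Z i) = T.tern (θ X) (θ Y) (θ Z)) :
    ∃ (πL : T.left →⋆ₙₐ[ℂ] ∀ i, Matrix (n i) (n i) ℂ)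
      (πR : T.right →⋆ₙₐ[ℂ] ∀ i, Matrix (m i) (m i) ℂ)
      (πE : T.linking →⋆ₙₐ[ℂ] ∀ i, Matrix (n i ⊕ m i) (n i ⊕ m i) ℂ),
      Function.Bijective πL ∧ Function.Bijective πR ∧ Function.Bijective πE ∧
      (∀ a, πE (T.leftEmb a) = upperLeft n m (πL a)) ∧
      (∀ a, πE (T.rightEmb a) = lowerRight n m (πR a)) ∧
      ∀ (X : Rect n m) (a : T.left), (a : T.K →L[ℂ] T.K) = (θ X : T.H →L[ℂ] T.K) ∘L
        ContinuousLinearMap.adjoint (θ X : T.H →L[ℂ] T.K) → πL a = fun i => X i * (X i)ᴴ := by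
  let x : Rect n m →ₗ[ℂ] (T.E →L[ℂ] T.E) := T.cornerMap ∘ₗ T.carrier.subtype ∘ₗ θ
  have hxdef : ∀ X, x X = T.cornerOp (θ X : T.H →L[ℂ] T.K) := fun X => rfl
  have hx : IsTernary x := by
    intro X Y Z
    rw [hxdef, hxdef, hxdef, hxdef, hθt, cornerOp_tern]
    rfl
  have hxinj : Function.Injective x := by
    intro X Y h
    rw [hxdef, hxdef] at h
    have := congrArg T.compress h
    rw [compress_cornerOp, compress_cornerOp] at this
    exact hθ.1 (Subtype.ext this)
  obtain ⟨Ψ, hΨ⟩ := exists_linkingHom hx fun X Y => T.cornerOp_mul_cornerOp _ _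
  have hΨinj := linkingHom_injective hxinj hΨ
  change ∀ X, Ψ (upperRight X) = x X at hΨ
  have hL : ∀ X Y : Rect n m, Ψ (upperLeft n m fun i => X i * (Y i)ᴴ) =
      corner T.inK ((θ X : T.H →L[ℂ] T.K) ∘L
        ContinuousLinearMap.adjoint (θ Y : T.H →L[ℂ] T.K)) := by
    intro X Y
    rw [← upperRight_mul_star, map_mul, map_star, hΨ, hΨ, hxdef, hxdef, cornerOp_mul_star]
  have hR : ∀ X Y : Rect n m, Ψ (lowerRight n m fun i => (X i)ᴴ * Y i) =
      corner T.inH (ContinuousLinearMap.adjoint (θ X : T.H →L[ℂ] T.K) ∘L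
        (θ Y : T.H →L[ℂ] T.K)) := by
    intro X Y
    rw [← star_upperRight_mul, map_mul, map_star, hΨ, hΨ, hxdef, hxdef, star_cornerOp_mul]
  obtain ⟨πE, hE1, hE2⟩ := exists_rep (A := T.linking) (NonUnitalStarSubalgebraClass.subtype T.linking)
    Subtype.val_injective Ψ hΨinj (by
      rintro ⟨a, ha⟩
      refine mem_range_of_mem_closure Ψ ?_
      refine closure_mono (s := _) (t := _) ?_ ha
      refine NonUnitalStarAlgebra.adjoin_le (S := NonUnitalStarAlgHom.range Ψ) ?_
      rintro _ ⟨y, hy, rfl⟩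
      obtain ⟨X, hX⟩ := hθ.2 ⟨y, hy⟩
      refine ⟨upperRight X, (hΨ X).trans ?_⟩
      rw [hxdef, hX]) (by
      intro M
      have : M ∈ T.linking.comap Ψ := by
        refine mem_of_upperRight _ (fun X => ?_) M
        change Ψ _ ∈ T.linking
        rw [hΨ, hxdef]
        exact subset_closure (NonUnitalStarAlgebra.subset_adjoin ℂ _ ⟨_, (θ X).2, rfl⟩)
      exact ⟨⟨Ψ M, this⟩, rfl⟩)
  obtain ⟨πL, hL1, hL2⟩ := exists_rep
    ((corner T.inK).comp (NonUnitalStarSubalgebraClass.subtype T.left))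
    ((corner_injective T.inK).comp Subtype.val_injective) (Ψ.comp (upperLeft n m))
    (hΨinj.comp injective_upperLeft) (by
      rintro ⟨a, ha⟩
      refine mem_range_of_mem_closure _ ?_
      refine corner_mem_closure T.inK ?_ ha
      rintro _ ⟨y, hy, z, hz, rfl⟩
      obtain ⟨X, hX⟩ := hθ.2 ⟨y, hy⟩
      obtain ⟨Y, hY⟩ := hθ.2 ⟨z, hz⟩
      refine ⟨fun i => X i * (Y i)ᴴ, ?_⟩
      refine (hL X Y).trans ?_
      rw [hX, hY]) (by
      intro A
      obtain ⟨J, _, X, Y, rfl⟩ := exists_sum_upperLeft (m := m) A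
      refine ⟨∑ j, ⟨(θ (X j) : T.H →L[ℂ] T.K) ∘L
        ContinuousLinearMap.adjoint (θ (Y j) : T.H →L[ℂ] T.K), subset_closure
          (NonUnitalStarAlgebra.subset_adjoin ℂ _ ⟨_, (θ (X j)).2, _, (θ (Y j)).2, rfl⟩)⟩, ?_⟩
      rw [map_sum, map_sum]
      exact Finset.sum_congr rfl fun j _ => (hL _ _).symm)
  obtain ⟨πR, hR1, hR2⟩ := exists_rep
    ((corner T.inH).comp (NonUnitalStarSubalgebraClass.subtype T.right))
    ((corner_injective T.inH).comp Subtype.val_injective) (Ψ.comp (lowerRight n m))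
    (hΨinj.comp injective_lowerRight) (by
      rintro ⟨a, ha⟩
      refine mem_range_of_mem_closure _ ?_
      refine corner_mem_closure T.inH ?_ ha
      rintro _ ⟨y, hy, z, hz, rfl⟩
      obtain ⟨X, hX⟩ := hθ.2 ⟨y, hy⟩
      obtain ⟨Y, hY⟩ := hθ.2 ⟨z, hz⟩
      refine ⟨fun i => (X i)ᴴ * Y i, ?_⟩
      refine (hR X Y).trans ?_
      rw [hX, hY]) (by
      intro A
      obtain ⟨J, _, X, Y, rfl⟩ := exists_sum_lowerRight (n := n) A
      refine ⟨∑ j, ⟨ContinuousLinearMap.adjoint (θ (X j) : T.H →L[ℂ] T.K) ∘L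
        (θ (Y j) : T.H →L[ℂ] T.K), subset_closure
          (NonUnitalStarAlgebra.subset_adjoin ℂ _ ⟨_, (θ (X j)).2, _, (θ (Y j)).2, rfl⟩)⟩, ?_⟩
      rw [map_sum, map_sum]
      exact Finset.sum_congr rfl fun j _ => (hR _ _).symm)
  refine ⟨πL, πR, πE, hL1, hR1, hE1, fun a => hΨinj ?_, fun a => hΨinj ?_, fun X a ha => ?_⟩
  · rw [hE2]
    exact (hL2 a).symm
  · rw [hE2]
    exact (hR2 a).symm
  · refine (hΨinj.comp injective_upperLeft) ((hL2 a).trans ?_)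
    refine Eq.trans ?_ (hL X X).symm
    rw [← ha]
    rfl

end TRO

/-! ### Reduction to ternary homomorphisms of products of matrix spaces -/

section Model

variable {I : Type} [Fintype I] [DecidableEq I] {n m : I → Type} [∀ i, Fintype (n i)]
  [∀ i, DecidableEq (n i)] [∀ i, Fintype (m i)] [∀ i, DecidableEq (m i)]

/-- A family of matrices as a block diagonal operator between Hilbert spaces in any universe. -/
def toOp (n m : I → Type) [∀ i, Fintype (n i)]
    [∀ i, DecidableEq (n i)] [∀ i, Fintype (m i)] [∀ i, DecidableEq (m i)] :
    Rect n m →ₗ[ℂ] (EuclideanSpace ℂ (ULift.{v} (Σ i, m i)) →L[ℂ]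
      EuclideanSpace ℂ (ULift.{v} (Σ i, n i))) where
  toFun X := (Matrix.toEuclideanLin
    ((Matrix.blockDiagonal' X).submatrix ULift.down ULift.down)).toContinuousLinearMap
  map_add' X Y := by
    rw [Matrix.blockDiagonal'_add, ← map_add, ← map_add]
    rfl
  map_smul' c X := by
    rw [Matrix.blockDiagonal'_smul, RingHom.id_apply, ← map_smul, ← map_smul]
    rfl

theorem toOp_injective : Function.Injective (toOp.{v} n m) := by
  intro X Y h
  have h1 := Matrix.toEuclideanLin.injective (LinearMap.toContinuousLinearMap.injective h)
  ext i s t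
  have h2 := congrFun (congrFun h1 ⟨⟨i, s⟩⟩) ⟨⟨i, t⟩⟩
  simpa using h2

theorem toOp_comp {l : I → Type} [∀ i, Fintype (l i)] [∀ i, DecidableEq (l i)]
    (X : Rect n m) (Y : Rect m l) :
    toOp.{v} n m X ∘L toOp m l Y = toOp n l fun i => X i * Y i := by
  have : (Matrix.blockDiagonal' fun i => X i * Y i).submatrix
      (ULift.down : ULift.{v} (Σ i, n i) → _) (ULift.down : ULift.{v} (Σ i, l i) → _) =
      (Matrix.blockDiagonal' X).submatrix ULift.down (ULift.down : ULift.{v} (Σ i, m i) → _) *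
      (Matrix.blockDiagonal' Y).submatrix ULift.down ULift.down := by
    rw [Matrix.blockDiagonal'_mul]
    exact (Matrix.submatrix_mul_equiv _ _ _ Equiv.ulift _).symm
  ext1 z
  change _ = Matrix.toEuclideanLin (𝕜 := ℂ) ((Matrix.blockDiagonal' fun i => X i * Y i).submatrix
      (ULift.down : ULift.{v} (Σ i, n i) → _) (ULift.down : ULift.{v} (Σ i, l i) → _)) z
  rw [this]
  simp [toOp, Matrix.toLpLin_apply, Matrix.mulVec_mulVec]

theorem adjoint_toOp (X : Rect n m) :
    ContinuousLinearMap.adjoint (toOp.{v} n m X) = toOp m n fun i => (X i)ᴴ := by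
  symm
  rw [ContinuousLinearMap.eq_adjoint_iff]
  intro y z
  have : (Matrix.blockDiagonal' fun i => (X i)ᴴ).submatrix
      (ULift.down : ULift.{v} (Σ i, m i) → _) (ULift.down : ULift.{v} (Σ i, n i) → _) =
      ((Matrix.blockDiagonal' X).submatrix ULift.down ULift.down)ᴴ := by
    rw [← Matrix.blockDiagonal'_conjTranspose]
    rfl
  change inner ℂ (Matrix.toEuclideanLin _ y) z = inner ℂ y (Matrix.toEuclideanLin _ z)
  rw [this, Matrix.toEuclideanLin_conjTranspose_eq_adjoint, LinearMap.adjoint_inner_left]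

/-- A finite product of spaces of matrices as a ternary ring of operators. -/
def modelTRO (n m : I → Type) [∀ i, Fintype (n i)]
    [∀ i, DecidableEq (n i)] [∀ i, Fintype (m i)] [∀ i, DecidableEq (m i)] : TRO.{v} where
  H := EuclideanSpace ℂ (ULift.{v} (Σ i, m i))
  K := EuclideanSpace ℂ (ULift.{v} (Σ i, n i))
  carrier := LinearMap.range (toOp n m)
  isClosed_carrier := Submodule.closed_of_finiteDimensional _
  ternary_mem := by
    rintro _ ⟨X, rfl⟩ _ ⟨Y, rfl⟩ _ ⟨Z, rfl⟩
    rw [adjoint_toOp, toOp_comp, toOp_comp]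
    exact ⟨_, rfl⟩

/-- The isomorphism of a product of spaces of matrices with its model as a TRO. -/
def modelEquiv (n m : I → Type) [∀ i, Fintype (n i)]
    [∀ i, DecidableEq (n i)] [∀ i, Fintype (m i)] [∀ i, DecidableEq (m i)] :
    Rect n m ≃ₗ[ℂ] (modelTRO.{v} n m).carrier :=
  LinearEquiv.ofInjective (toOp n m) toOp_injective

theorem modelEquiv_tern (X Y Z : Rect n m) : modelEquiv.{v} n m (fun i => X i * (Y i)ᴴ * Z i) =
    (modelTRO n m).tern (modelEquiv n m X) (modelEquiv n m Y) (modelEquiv n m Z) := by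
  refine Subtype.ext ?_
  change toOp n m _ = toOp n m X ∘L ContinuousLinearMap.adjoint (toOp n m Y) ∘L toOp n m Z
  rw [adjoint_toOp, toOp_comp, toOp_comp]
  simp only [Matrix.mul_assoc]

variable {Z : Type u} [NormedAddCommGroup Z] [NormedSpace ℂ Z] [CompleteSpace Z] [JBStarTriple Z]

/-- A homomorphism of a `JB*`-triple into a star algebra with the triple product
`(x y* z + z y* x) / 2`. -/
def IsTripleMap {B : Type*} [Ring B] [StarRing B] [Algebra ℂ B] (φ : Z →ₗ[ℂ] B) : Prop :=
  ∀ x y z, φ (tri x y z) = (1 / 2 : ℂ) • (φ x * star (φ y) * φ z + φ z * star (φ y) * φ x)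

/-- A homomorphism of `Z` into a product of spaces of matrices whose image generates. -/
structure IsModel (ρ : Z →ₗ[ℂ] Rect n m) : Prop where
  triple : ∀ x y z i, ρ (tri x y z) i =
    (1 / 2 : ℂ) • (ρ x i * (ρ y i)ᴴ * ρ z i + ρ z i * (ρ y i)ᴴ * ρ x i)
  generates : ∀ S : Submodule ℂ (Rect n m),
    (∀ X ∈ S, ∀ Y ∈ S, ∀ W ∈ S, (fun i => X i * (Y i)ᴴ * W i) ∈ S) → (∀ z, ρ z ∈ S) → S = ⊤

/-- Each homomorphism of `Z` into the operators on a Hilbert space extends along `ρ` to a ternary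
map. -/
def HasLift (ρ : Z →ₗ[ℂ] Rect n m) : Prop :=
  ∀ (E : Type w) [NormedAddCommGroup E] [InnerProductSpace ℂ E] [CompleteSpace E]
    (φ : Z →ₗ[ℂ] (E →L[ℂ] E)), IsTripleMap φ →
      ∃ f : Rect n m →ₗ[ℂ] (E →L[ℂ] E), IsTernary f ∧ ∀ z, f (ρ z) = φ z

variable {ρ : Z →ₗ[ℂ] Rect n m}

/-- Lifts into operators on one Hilbert space suffice for lifts into a TRO `W`: embed `W` as a corner
of the operators on `K ⊕ H`; the lift stays in the corner because the image of `Z` generates. -/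
theorem IsModel.exists_lift (h : IsModel ρ) (hl : HasLift.{u, w} ρ) (W : TRO.{w})
    (φ : Z →ₗ[ℂ] W.carrier) (hφ : IsTripleHom W φ) :
    ∃ f : Rect n m →ₗ[ℂ] W.carrier,
      (∀ X Y V : Rect n m, f (fun i => X i * (Y i)ᴴ * V i) = W.tern (f X) (f Y) (f V)) ∧
      ∀ z, f (ρ z) = φ z := by
  obtain ⟨g, hg1, hg2⟩ := hl W.E (W.cornerMap ∘ₗ W.carrier.subtype ∘ₗ φ) (by
    intro x y z
    change W.cornerMap (φ (tri x y z) : W.H →L[ℂ] W.K) = (1 / 2 : ℂ) •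
      (W.cornerOp (φ x) * star (W.cornerOp (φ y)) * W.cornerOp (φ z) +
        W.cornerOp (φ z) * star (W.cornerOp (φ y)) * W.cornerOp (φ x))
    rw [TRO.cornerOp_tern, TRO.cornerOp_tern, hφ]
    change W.cornerMap ((1 / 2 : ℂ) • (_ + _)) = (1 / 2 : ℂ) • (W.cornerMap _ + W.cornerMap _)
    rw [map_smul, map_add]
    rfl)
  have hmem : ∀ X, g X ∈ W.carrier.map W.cornerMap := by
    intro X
    have : (W.carrier.map W.cornerMap).comap g = ⊤ := by
      refine h.generates _ ?_ ?_
      · rintro X ⟨a, ha, hX⟩ Y ⟨b, hb, hY⟩ V ⟨c, hc, hV⟩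
        rw [Submodule.mem_comap, hg1, ← hX, ← hY, ← hV]
        refine ⟨_, W.ternary_mem a ha b hb c hc, (W.cornerOp_tern a b c).symm⟩
      · intro z
        rw [Submodule.mem_comap, hg2]
        exact ⟨_, (φ z).2, rfl⟩
    rw [← Submodule.mem_comap, this]
    trivial
  have hmem' : ∀ X, W.compress (g X) ∈ W.carrier := by
    intro X
    obtain ⟨a, ha, hX⟩ := hmem X
    rw [← hX]
    change W.compress (W.cornerOp a) ∈ _
    rwa [W.compress_cornerOp]
  have hc : ∀ X, W.cornerOp (W.compress (g X)) = g X := by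
    intro X
    obtain ⟨a, ha, hX⟩ := hmem X
    rw [← hX]
    change W.cornerOp (W.compress (W.cornerOp a)) = W.cornerOp a
    rw [W.compress_cornerOp]
  refine ⟨(W.compress ∘ₗ g).codRestrict W.carrier hmem', fun X Y V => Subtype.ext ?_,
    fun z => Subtype.ext ?_⟩
  · change W.compress (g _) = W.compress (g X) ∘L ContinuousLinearMap.adjoint (W.compress (g Y)) ∘L
      W.compress (g V)
    rw [hg1, ← hc X, ← hc Y, ← hc V, W.cornerOp_tern, W.compress_cornerOp, W.compress_cornerOp,
      W.compress_cornerOp, W.compress_cornerOp]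
  · change W.compress (g (ρ z)) = φ z
    rw [hg2]
    exact W.compress_cornerOp _

/-- The image of `Z` in the model. -/
def modelMap (ρ : Z →ₗ[ℂ] Rect n m) : Z →ₗ[ℂ] (modelTRO.{v} n m).carrier :=
  (modelEquiv n m).toLinearMap ∘ₗ ρ

theorem IsModel.isTripleHom (h : IsModel ρ) : IsTripleHom (modelTRO.{v} n m) (modelMap ρ) := by
  intro x y z
  change modelEquiv n m (ρ (tri x y z)) = _
  have : ρ (tri x y z) = (1 / 2 : ℂ) • ((fun i => ρ x i * (ρ y i)ᴴ * ρ z i) +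
      fun i => ρ z i * (ρ y i)ᴴ * ρ x i) := funext fun i => h.triple x y z i
  rw [this, map_smul, map_add, modelEquiv_tern, modelEquiv_tern]
  rfl

/-- A ternary map on the matrices is determined by its values on the image of `Z`. -/
theorem IsModel.eq_of_ternary (h : IsModel ρ) (W : TRO.{w}) {f g : Rect n m →ₗ[ℂ] W.carrier}
    (hf : ∀ X Y V : Rect n m, f (fun i => X i * (Y i)ᴴ * V i) = W.tern (f X) (f Y) (f V))
    (hg : ∀ X Y V : Rect n m, g (fun i => X i * (Y i)ᴴ * V i) = W.tern (g X) (g Y) (g V))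
    (hfg : ∀ z, f (ρ z) = g (ρ z)) : f = g := by
  have : LinearMap.eqLocus f g = ⊤ := by
    refine h.generates _ (fun X hX Y hY V hV => ?_) hfg
    rw [LinearMap.mem_eqLocus] at *
    rw [hf, hg, hX, hY, hV]
  exact LinearMap.eqLocus_eq_top.1 this

/-- A model along which homomorphisms lift is the universal enveloping TRO. -/
theorem IsModel.isUniversalTRO (h : IsModel ρ) (hl : HasLift.{u, w} ρ) :
    IsUniversalTRO.{u, v, w} (modelTRO.{v} n m) (modelMap ρ) where
  isTripleHom := h.isTripleHom
  generates S _ hS hρ := by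
    have : S.comap (modelEquiv n m).toLinearMap = ⊤ := by
      refine h.generates _ (fun X hX Y hY V hV => ?_) hρ
      rw [Submodule.mem_comap] at *
      change modelEquiv n m _ ∈ S
      rw [modelEquiv_tern]
      exact hS _ hX _ hY _ hV
    refine eq_top_iff.2 fun a _ => ?_
    have h1 : (modelEquiv n m).symm a ∈ S.comap (modelEquiv n m).toLinearMap := by
      rw [this]
      trivial
    simpa using h1
  exists_unique_lift W φ hφ := by
    obtain ⟨f, hf1, hf2⟩ := h.exists_lift hl W φ hφ
    refine ⟨f ∘ₗ (modelEquiv n m).symm.toLinearMap, ⟨?_, ?_⟩, ?_⟩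
    · intro a b c
      obtain ⟨X, rfl⟩ := (modelEquiv n m).surjective a
      obtain ⟨Y, rfl⟩ := (modelEquiv n m).surjective b
      obtain ⟨V, rfl⟩ := (modelEquiv n m).surjective c
      rw [← modelEquiv_tern]
      simp [hf1]
    · ext1 z
      simp [modelMap, hf2]
    · rintro g ⟨hg1, hg2⟩
      have : g ∘ₗ (modelEquiv n m).toLinearMap = f := by
        refine h.eq_of_ternary W (fun X Y V => ?_) hf1 fun z => ?_
        · change g (modelEquiv n m _) = _
          rw [modelEquiv_tern, hg1]
          rfl
        · rw [hf2]
          exact DFunLike.congr_fun hg2 z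
      rw [← this]
      ext1 a
      simp

/-- Each universal enveloping TRO of `Z` is isomorphic to the model. The isomorphism is the lift of
`σ`; its inverse comes from the universal property applied to the model. -/
theorem IsModel.exists_iso (h : IsModel ρ) (hv : HasLift.{u, v} ρ) (T : TRO.{v})
    (σ : Z →ₗ[ℂ] T.carrier) (hT : IsUniversalTRO.{u, v, w} T σ) :
    ∃ θ : Rect n m →ₗ[ℂ] T.carrier, Function.Bijective θ ∧
      (∀ X Y V : Rect n m, θ (fun i => X i * (Y i)ᴴ * V i) = T.tern (θ X) (θ Y) (θ V)) ∧
      ∀ z, θ (ρ z) = σ z := by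
  obtain ⟨θ, h1, h2⟩ := h.exists_lift hv T σ hT.isTripleHom
  obtain ⟨g, ⟨hg1, hg2⟩, -⟩ := hT.exists_unique_lift (modelTRO.{w} n m) (modelMap ρ) h.isTripleHom
  have hinj : g ∘ₗ θ = (modelEquiv.{w} n m).toLinearMap := by
    refine h.eq_of_ternary _ (fun X Y V => ?_) modelEquiv_tern fun z => ?_
    · change g (θ _) = _
      rw [h1, hg1]
      rfl
    · change g (θ _) = _
      rw [h2]
      exact DFunLike.congr_fun hg2 z
  refine ⟨θ, ⟨?_, ?_⟩, h1, h2⟩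
  · refine Function.Injective.of_comp (f := g) ?_
    have : (g ∘ θ : Rect n m → _) = modelEquiv.{w} n m := congrArg DFunLike.coe hinj
    rw [this]
    exact (modelEquiv n m).injective
  · rw [← LinearMap.range_eq_top]
    refine hT.generates _ (Submodule.closed_of_finiteDimensional _) ?_ fun z => ⟨_, h2 z⟩
    rintro _ ⟨X, rfl⟩ _ ⟨Y, rfl⟩ _ ⟨V, rfl⟩
    exact ⟨_, h1 X Y V⟩

theorem rankEquiv_image_pos {A : Type*} [NonUnitalRing A] [StarRing A]
    [Module ℂ A] [IsScalarTower ℂ A A] [SMulCommClass ℂ A A] [StarModule ℂ A]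
    [∀ i, Nonempty (n i)] (πL : A →⋆ₙₐ[ℂ] ∀ i, Matrix (n i) (n i) ℂ)
    (hL : Function.Bijective πL) : rankEquiv πL hL '' K0.pos A = {x | ∀ i, 0 ≤ x i} :=
  rankVec_image_pos πL hL

theorem rankEquiv_image_scale {A : Type*} [NonUnitalRing A] [StarRing A]
    [Module ℂ A] [IsScalarTower ℂ A A] [SMulCommClass ℂ A A] [StarModule ℂ A]
    [∀ i, Nonempty (n i)] (πL : A →⋆ₙₐ[ℂ] ∀ i, Matrix (n i) (n i) ℂ)
    (hL : Function.Bijective πL) :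
    rankEquiv πL hL '' K0.scale A = {x | ∀ i, 0 ≤ x i ∧ x i ≤ (Fintype.card (n i) : ℤ)} :=
  rankVec_image_scale πL hL

/-- The scale of one corner of the linking algebra, carried to `K₀` of the other corner. -/
theorem rankEquiv_image_transported_scale {A R E : Type*} [NonUnitalRing A] [StarRing A]
    [Module ℂ A] [IsScalarTower ℂ A A] [SMulCommClass ℂ A A] [StarModule ℂ A] [NonUnitalRing R]
    [StarRing R] [Module ℂ R] [IsScalarTower ℂ R R] [SMulCommClass ℂ R R] [StarModule ℂ R]
    [NonUnitalRing E] [StarRing E] [Module ℂ E] [IsScalarTower ℂ E E] [SMulCommClass ℂ E E]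
    [StarModule ℂ E] [∀ i, Nonempty (n i)] [∀ i, Nonempty (m i)] (jL : A →⋆ₙₐ[ℂ] E)
    (jR : R →⋆ₙₐ[ℂ] E) (πL : A →⋆ₙₐ[ℂ] ∀ i, Matrix (n i) (n i) ℂ)
    (πR : R →⋆ₙₐ[ℂ] ∀ i, Matrix (m i) (m i) ℂ)
    (πE : E →⋆ₙₐ[ℂ] ∀ i, Matrix (n i ⊕ m i) (n i ⊕ m i) ℂ) (hL : Function.Bijective πL)
    (hR : Function.Bijective πR) (hE : Function.Bijective πE)
    (hEL : ∀ a, πE (jL a) = upperLeft n m (πL a))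
    (hER : ∀ a, πE (jR a) = lowerRight n m (πR a)) :
    rankEquiv πL hL '' {x | ∃ y ∈ K0.scale R, K0.map jL x = K0.map jR y} =
      {x | ∀ i, 0 ≤ x i ∧ x i ≤ (Fintype.card (m i) : ℤ)} := by
  have hmapL : ∀ x, rankVec πE (K0.map jL x) = rankVec πL x :=
    rankVec_map πL hL πE jL fun a i => by
      rw [hEL]
      simp [upperLeft, Matrix.trace]
  have hmapR : ∀ x, rankVec πE (K0.map jR x) = rankVec πR x :=
    rankVec_map πR hR πE jR fun a i => by
      rw [hER]
      simp [lowerRight, Matrix.trace]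
  rw [← rankVec_image_scale πR hR]
  ext y
  constructor
  · rintro ⟨x, ⟨z, hz, hxz⟩, rfl⟩
    refine ⟨z, hz, ?_⟩
    rw [← hmapR, ← hxz, hmapL]
    rfl
  · rintro ⟨z, hz, rfl⟩
    obtain ⟨x, hx⟩ := rankVec_surjective πL hL (rankVec πR z)
    refine ⟨x, ⟨z, hz, rankVec_injective πE hE ?_⟩, hx⟩
    rw [hmapL, hmapR, hx]

/-- The classes of a set of projections with known block images. -/
theorem rankEquiv_image_classes {A B : Type*} [NonUnitalRing A] [StarRing A]
    [Module ℂ A] [IsScalarTower ℂ A A] [SMulCommClass ℂ A A] [StarModule ℂ A]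
    [∀ i, Nonempty (n i)] (πL : A →⋆ₙₐ[ℂ] ∀ i, Matrix (n i) (n i) ℂ)
    (hL : Function.Bijective πL) (ι : A → B) (σ : Z → B) (ρ : Z → Rect n m) (S : Set Z)
    (h1 : ∀ g ∈ S, ∃ p, ι p = σ g)
    (h2 : ∀ g ∈ S, ∀ p, ι p = σ g → πL p = fun i => ρ g i * (ρ g i)ᴴ)
    (h3 : ∀ g ∈ S, ∀ i, ρ g i * (ρ g i)ᴴ * ρ g i = ρ g i) :
    rankEquiv πL hL '' {x | ∃ g ∈ S, ∃ (p : A) (hp : IsStarProjection p),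
      ι p = σ g ∧ x = K0.cls p hp} =
        {x | ∃ g ∈ S, ∀ i, ((x i : ℤ) : ℂ) = (ρ g i * (ρ g i)ᴴ).trace} := by
  ext y
  constructor
  · rintro ⟨_, ⟨g, hg, p, hp, hpg, rfl⟩, rfl⟩
    refine ⟨g, hg, fun i => ?_⟩
    refine (rankVec_cls_cast πL p hp i).trans ?_
    rw [h2 g hg p hpg]
  · rintro ⟨g, hg, hy⟩
    obtain ⟨p, hpg⟩ := h1 g hg
    have hπp := h2 g hg p hpg
    have hp : IsStarProjection p := by
      refine ⟨hL.1 ?_, hL.1 ?_⟩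
      · rw [map_mul, hπp]
        ext i : 1
        rw [Pi.mul_apply, ← Matrix.mul_assoc, h3 g hg]
      · rw [map_star, hπp]
        ext i : 1
        simp [Matrix.star_eq_conjTranspose]
    refine ⟨K0.cls p hp, ⟨g, hg, p, hp, hpg, rfl⟩, funext fun i => ?_⟩
    have h4 := rankVec_cls_cast πL p hp i
    rw [hπp, ← hy] at h4
    exact_mod_cast h4

/-- Tripotents become partial isometries in each block. -/
theorem IsModel.tripotent (h : IsModel ρ) {g : Z} (hg : tri g g g = g) (i : I) :
    ρ g i * (ρ g i)ᴴ * ρ g i = ρ g i := by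
  have := h.triple g g g i
  rw [hg, ← two_smul ℂ, smul_smul] at this
  simpa using this.symm

set_option synthInstance.maxHeartbeats 200000 in
set_option maxHeartbeats 1600000 in
/-- The invariants of a triple with a model: `K₀` is free on the blocks, the scales are the boxes
given by the sizes of the blocks, and the class of a tripotent is given by block traces. -/
theorem IsModel.exists_rankEquiv [∀ i, Nonempty (n i)] [∀ i, Nonempty (m i)] (h : IsModel ρ)
    (hv : HasLift.{u, v} ρ) (T : TRO.{v})
    (σ : Z →ₗ[ℂ] T.carrier) (hT : IsUniversalTRO.{u, v, w} T σ) :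
    ∃ e : T.K0 ≃+ (I → ℤ), e '' T.pos = {x | ∀ i, 0 ≤ x i} ∧
      e '' T.leftScale = {x | ∀ i, 0 ≤ x i ∧ x i ≤ (Fintype.card (n i) : ℤ)} ∧
      e '' T.rightScale = {x | ∀ i, 0 ≤ x i ∧ x i ≤ (Fintype.card (m i) : ℤ)} ∧
      ∀ S ⊆ Tri Z, e '' classes T σ S =
        {x | ∃ g ∈ S, ∀ i, ((x i : ℤ) : ℂ) = (ρ g i * (ρ g i)ᴴ).trace} := by
  obtain ⟨θ, hθ1, hθ2, hθ3⟩ := h.exists_iso hv T σ hT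
  obtain ⟨πL, πR, πE, hL, hR, hE, hEL, hER, hcls⟩ := TRO.exists_block_reps θ hθ1 hθ2
  have h1 := rankEquiv_image_pos (A := T.left) πL hL
  have h2 := rankEquiv_image_scale (A := T.left) πL hL
  have h3 := rankEquiv_image_transported_scale (A := T.left) (R := T.right) (E := T.linking)
    T.leftEmb T.rightEmb πL πR πE hL hR hE hEL hER
  refine ⟨rankEquiv (A := T.left) πL hL, h1, h2, h3, fun S hS => ?_⟩
  have h4 := rankEquiv_image_classes (A := T.left) (B := T.K →L[ℂ] T.K) πL hL Subtype.val
    (fun g => (σ g : T.H →L[ℂ] T.K) ∘L ContinuousLinearMap.adjoint (σ g : T.H →L[ℂ] T.K)) ρ S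
    (fun g _ => ⟨⟨_, subset_closure
      (NonUnitalStarAlgebra.subset_adjoin ℂ _ ⟨_, (σ g).2, _, (σ g).2, rfl⟩)⟩, rfl⟩)
    (fun g _ p hp => hcls (ρ g) p (by rw [hθ3]; exact hp))
    (fun g hg => h.tripotent (hS hg).2)
  exact h4

end Model

/-! ### From models to invariants -/

section Invariant

variable {I : Type} [Fintype I] [DecidableEq I] {n m : I → Type} [∀ i, Fintype (n i)]
  [∀ i, DecidableEq (n i)] [∀ i, Fintype (m i)] [∀ i, DecidableEq (m i)]
  [∀ i, Nonempty (n i)] [∀ i, Nonempty (m i)]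
  {Z : Type u} [NormedAddCommGroup Z] [NormedSpace ℂ Z] [CompleteSpace Z] [JBStarTriple Z]
  {ρ : Z →ₗ[ℂ] Rect n m}

/-- The block traces of the projections `ρ(g) ρ(g)*`, `g ∈ S`. -/
def traceClasses (ρ : Z →ₗ[ℂ] Rect n m) (S : Set Z) : Set (I → ℤ) :=
  {x | ∃ g ∈ S, ∀ i, ((x i : ℤ) : ℂ) = (ρ g i * (ρ g i)ᴴ).trace}

/-- The K-JB* invariant is read off a model along which homomorphisms lift. Lifts in two universes
are needed: for the universal property, and for the comparison with an arbitrary universal TRO. -/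
theorem IsModel.hasInvariant (h : IsModel ρ) (hv : HasLift.{u, v} ρ) (hw : HasLift.{u, w} ρ)
    {G : Type} [AddCommGroup G] (ε : (I → ℤ) ≃+ G) {P L R D : Set G}
    (hP : ε '' {x | ∀ i, 0 ≤ x i} = P)
    (hL : ε '' {x | ∀ i, 0 ≤ x i ∧ x i ≤ (Fintype.card (n i) : ℤ)} = L)
    (hR : ε '' {x | ∀ i, 0 ≤ x i ∧ x i ≤ (Fintype.card (m i) : ℤ)} = R)
    (hD : ε '' traceClasses ρ (Tri Z) = D) : HasInvariant.{u, v, w} Z P L R D := by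
  refine ⟨⟨_, _, h.isUniversalTRO hw⟩, fun T σ hT => ?_⟩
  obtain ⟨e, h1, h2, h3, h4⟩ := h.exists_rankEquiv hv T σ hT
  have h5 : ∀ s : Set T.K0, (e.trans ε) '' s = ε '' (e '' s) := fun s => by
    rw [← Set.image_comp]
    rfl
  refine ⟨e.trans ε, ⟨?_, ?_, ?_, ?_⟩⟩
  · rw [h5, h1, hP]
  · rw [h5, h2, hL]
  · rw [h5, h3, hR]
  · rw [h5, Delta, h4 _ subset_rfl]
    exact hD

/-- The variant of `IsModel.hasInvariant` with the classes of minimal and of maximal tripotents. -/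
theorem IsModel.hasInvariantMinMax (h : IsModel ρ) (hv : HasLift.{u, v} ρ)
    (hw : HasLift.{u, w} ρ) {G : Type} [AddCommGroup G] (ε : (I → ℤ) ≃+ G) {P L R : Set G}
    {a b : G} (hab : a ≠ b) (hP : ε '' {x | ∀ i, 0 ≤ x i} = P)
    (hL : ε '' {x | ∀ i, 0 ≤ x i ∧ x i ≤ (Fintype.card (n i) : ℤ)} = L)
    (hR : ε '' {x | ∀ i, 0 ≤ x i ∧ x i ≤ (Fintype.card (m i) : ℤ)} = R)
    (hD : ε '' traceClasses ρ (Tri Z) = {a, b})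
    (hmin : ε '' traceClasses ρ (minTri Z) = {a})
    (hmax : ε '' traceClasses ρ (maxTri Z) = {b}) :
    HasInvariantMinMax.{u, v, w} Z P L R a b := by
  refine ⟨⟨_, _, h.isUniversalTRO hw⟩, fun T σ hT => ?_⟩
  obtain ⟨e, h1, h2, h3, h4⟩ := h.exists_rankEquiv hv T σ hT
  have h5 : ∀ s : Set T.K0, (e.trans ε) '' s = ε '' (e '' s) := fun s => by
    rw [← Set.image_comp]
    rfl
  have h6 : (e.trans ε) '' Delta T σ = {a, b} := by
    rw [h5, Delta, h4 _ subset_rfl]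
    exact hD
  refine ⟨?_, e.trans ε, ⟨?_, ?_, ?_, h6⟩, ?_, ?_⟩
  · rw [← Set.ncard_image_of_injective _ (e.trans ε).injective, h6, Set.ncard_pair hab]
  · rw [h5, h1, hP]
  · rw [h5, h2, hL]
  · rw [h5, h3, hR]
  · rw [h5, h4 _ fun g hg => hg.1]
    exact hmin
  · rw [h5, h4 _ fun g hg => hg.1]
    exact hmax

open scoped ComplexOrder in
/-- The final projection of a partial isometry has integral trace, its rank. -/
theorem exists_nat_trace {α β : Type*} [Fintype α] [DecidableEq α] [Fintype β]
    {X : Matrix α β ℂ} (h : X * Xᴴ * X = X) :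
    ∃ r : ℕ, (X * Xᴴ).trace = r ∧ r ≤ Fintype.card α ∧ r ≤ Fintype.card β ∧ (r = 0 → X = 0) := by
  have hp : IsStarProjection (X * Xᴴ) := by
    refine ⟨?_, ?_⟩
    · rw [IsIdempotentElem, ← Matrix.mul_assoc, h]
    · rw [IsSelfAdjoint, Matrix.star_eq_conjTranspose]
      simp
  refine ⟨_, trace_eq_rank_of_isStarProjection hp, Matrix.rank_le_card_height _, ?_, fun h0 => ?_⟩
  · rw [Matrix.rank_self_mul_conjTranspose]
    exact Matrix.rank_le_card_width _
  · have h1 := trace_eq_rank_of_isStarProjection hp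
    rw [h0, Nat.cast_zero, Matrix.trace_mul_conjTranspose_self_eq_zero_iff] at h1
    exact h1

/-- Integer vectors indexed by a point. -/
def unitEquiv : (Unit → ℤ) ≃+ ℤ :=
  { Equiv.funUnique Unit ℤ with map_add' := fun _ _ => rfl }

theorem unitEquiv_image {S : Set (Unit → ℤ)} {T : Set ℤ} (h : ∀ y, (fun _ => y) ∈ S ↔ y ∈ T) :
    unitEquiv '' S = T := by
  ext y
  rw [← h]
  constructor
  · rintro ⟨x, hx, rfl⟩
    exact hx
  · intro hy
    exact ⟨_, hy, rfl⟩

/-- Integer vectors indexed by two points. -/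
def boolEquiv : (Bool → ℤ) ≃+ ℤ × ℤ where
  toFun x := (x false, x true)
  invFun y b := cond b y.2 y.1
  left_inv x := by ext (_ | _) <;> rfl
  right_inv y := rfl
  map_add' _ _ := rfl

theorem boolEquiv_image {S : Set (Bool → ℤ)} {T : Set (ℤ × ℤ)}
    (h : ∀ y : ℤ × ℤ, (fun b => cond b y.2 y.1) ∈ S ↔ y ∈ T) : boolEquiv '' S = T := by
  ext y
  rw [← h]
  constructor
  · rintro ⟨x, hx, rfl⟩
    convert hx using 1
    ext (_ | _) <;> rfl
  · intro hy
    exact ⟨_, hy, rfl⟩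

end Invariant

/-! ### Matrix units -/

section Units

variable {α β : Type} [Fintype α] [DecidableEq α] [Fintype β] [DecidableEq β]
  {B : Type*} [Ring B] [StarRing B] [Algebra ℂ B] [StarModule ℂ B]

/-- The linear map on matrices with prescribed values on the matrix units. -/
def unitsMap (E : α → β → B) : Matrix α β ℂ →ₗ[ℂ] B where
  toFun X := ∑ a, ∑ b, X a b • E a b
  map_add' X Y := by simp [add_smul, Finset.sum_add_distrib]
  map_smul' c X := by simp [mul_smul, Finset.smul_sum]

theorem unitsMap_apply (E : α → β → B) (X : Matrix α β ℂ) :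
    unitsMap E X = ∑ a, ∑ b, X a b • E a b := rfl

/-- Rectangular matrix units in a star algebra. -/
def IsUnits (E : α → β → B) : Prop :=
  ∀ a b c d k l, E a b * star (E c d) * E k l = if b = d ∧ c = k then E a l else 0

/-- Matrix units define a ternary map on all matrices. -/
theorem IsUnits.ternary {E : α → β → B} (h : IsUnits E) (X Y V : Matrix α β ℂ) :
    unitsMap E (X * Yᴴ * V) = unitsMap E X * star (unitsMap E Y) * unitsMap E V := by
  have h1 : ∀ a b k l, E a b * star (unitsMap E Y) * E k l = star (Y k b) • E a l := by
    intro a b k l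
    simp only [unitsMap_apply, star_sum, star_smul, Finset.mul_sum, Finset.sum_mul,
      mul_smul_comm, smul_mul_assoc, h _ _ _ _ _ _]
    rw [Finset.sum_eq_single k, Finset.sum_eq_single b]
    · simp
    · intro d _ hd
      simp [Ne.symm hd]
    · simp
    · intro c _ hc
      simp [hc]
    · simp
  have h2 : ∀ a l, (X * Yᴴ * V) a l = ∑ b, ∑ k, X a b * V k l * star (Y k b) := by
    intro a l
    simp only [Matrix.mul_apply, Matrix.conjTranspose_apply, Finset.sum_mul]
    rw [Finset.sum_comm]
    exact Finset.sum_congr rfl fun b _ => Finset.sum_congr rfl fun k _ => by ring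
  rw [unitsMap_apply E X, unitsMap_apply E V, unitsMap_apply E (_ * _)]
  simp only [Finset.sum_mul]
  refine Finset.sum_congr rfl fun a _ => ?_
  have h3 : ∀ b, X a b • E a b * star (unitsMap E Y) * ∑ k, ∑ l, V k l • E k l =
      ∑ l, ∑ k, (X a b * V k l * star (Y k b)) • E a l := by
    intro b
    rw [Finset.sum_comm]
    simp only [Finset.mul_sum, smul_mul_assoc, mul_smul_comm, h1, smul_smul]
    exact Finset.sum_congr rfl fun l _ => Finset.sum_congr rfl fun k _ => by
      congr 1
      ring
  simp only [h3, h2, Finset.sum_smul]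
  exact Finset.sum_comm

/-- A subspace of matrices that contains the matrix units is everything. -/
theorem eq_top_of_single_mem {I : Type} [Fintype I] [DecidableEq I] {n m : I → Type}
    [∀ i, Fintype (n i)] [∀ i, DecidableEq (n i)] [∀ i, Fintype (m i)] [∀ i, DecidableEq (m i)]
    (S : Submodule ℂ (Rect n m))
    (h : ∀ i a b, (Pi.single i (Matrix.single a b 1) : Rect n m) ∈ S) : S = ⊤ := by
  refine eq_top_iff.2 fun X _ => ?_
  have : X = ∑ i, ∑ a, ∑ b, X i a b • (Pi.single i (Matrix.single a b 1) : Rect n m) := by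
    ext i a b
    simp only [Finset.sum_apply, Matrix.sum_apply, Pi.smul_apply, Matrix.smul_apply]
    rw [Finset.sum_eq_single i]
    · rw [Finset.sum_eq_single a, Finset.sum_eq_single b]
      · simp
      · intro d _ hd
        simp [hd]
      · simp
      · intro d _ hd
        simp [hd]
      · simp
    · intro j _ hj
      simp [Pi.single_eq_of_ne (Ne.symm hj)]
    · simp
  rw [this]
  exact sum_mem fun i _ => sum_mem fun a _ => sum_mem fun b _ => S.smul_mem _ (h i a b)

end Units

/-! ### Triple maps on spaces of matrices -/

section Extension

variable {Z : Type u} [NormedAddCommGroup Z] [NormedSpace ℂ Z] [CompleteSpace Z] [JBStarTriple Z]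
  {B : Type*} [Ring B] [StarRing B] [Algebra ℂ B] [StarModule ℂ B]
  {α β : Type} [Fintype α] [Fintype β]

/-- A linear map from matrices to a star algebra is a triple map on the subspace `S`. -/
def IsTripleOn (S : Submodule ℂ (Matrix α β ℂ)) (Ψ : Matrix α β ℂ →ₗ[ℂ] B) : Prop :=
  ∀ X ∈ S, ∀ Y ∈ S, ∀ V ∈ S,
    Ψ (X * Yᴴ * V + V * Yᴴ * X) = Ψ X * star (Ψ Y) * Ψ V + Ψ V * star (Ψ Y) * Ψ X

/-- A triple map on a triple of matrices, extended linearly to all matrices. -/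
theorem exists_tripleOn {S : Submodule ℂ (Matrix α β ℂ)} (e : Z ≃ₗ[ℂ] S)
    (he : ∀ x y z, (e (tri x y z) : Matrix α β ℂ) =
      (1 / 2 : ℂ) • ((e x : Matrix α β ℂ) * (e y : Matrix α β ℂ)ᴴ * (e z : Matrix α β ℂ)
        + (e z : Matrix α β ℂ) * (e y : Matrix α β ℂ)ᴴ * (e x : Matrix α β ℂ)))
    (φ : Z →ₗ[ℂ] B) (hφ : IsTripleMap φ) :
    ∃ Ψ : Matrix α β ℂ →ₗ[ℂ] B, (∀ z, Ψ (e z : Matrix α β ℂ) = φ z) ∧ IsTripleOn S Ψ := by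
  obtain ⟨p, hp⟩ := S.subtype.exists_leftInverse_of_injective (by simp)
  have hp' : ∀ x : S, p (x : Matrix α β ℂ) = x := fun x => DFunLike.congr_fun hp x
  have h1 : ∀ z, (φ ∘ₗ e.symm.toLinearMap ∘ₗ p) (e z : Matrix α β ℂ) = φ z := by
    intro z
    simp [hp']
  refine ⟨φ ∘ₗ e.symm.toLinearMap ∘ₗ p, h1, ?_⟩
  intro X hX Y hY V hV
  obtain ⟨x, hx⟩ := e.surjective ⟨X, hX⟩
  obtain ⟨y, hy⟩ := e.surjective ⟨Y, hY⟩
  obtain ⟨z, hz⟩ := e.surjective ⟨V, hV⟩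
  obtain rfl : (e x : Matrix α β ℂ) = X := congrArg Subtype.val hx
  obtain rfl : (e y : Matrix α β ℂ) = Y := congrArg Subtype.val hy
  obtain rfl : (e z : Matrix α β ℂ) = V := congrArg Subtype.val hz
  have h2 : (e x : Matrix α β ℂ) * (e y : Matrix α β ℂ)ᴴ * (e z : Matrix α β ℂ)
        + (e z : Matrix α β ℂ) * (e y : Matrix α β ℂ)ᴴ * (e x : Matrix α β ℂ)
      = (e ((2 : ℂ) • tri x y z) : Matrix α β ℂ) := by
    rw [map_smul, Submodule.coe_smul, he, smul_smul]
    norm_num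
  rw [h2, h1, h1, h1, h1, map_smul, hφ, smul_smul]
  norm_num

theorem add_self_cancel {M : Type*} [AddCommGroup M] [Module ℂ M] {a b : M} (h : a + a = b + b) :
    a = b := by
  rw [← two_smul ℂ, ← two_smul ℂ b] at h
  exact smul_right_injective M (two_ne_zero (α := ℂ)) h

theorem eq_zero_of_add_self {M : Type*} [AddCommGroup M] [Module ℂ M] {a : M} (h : a + a = 0) :
    a = 0 := add_self_cancel (by rw [h, add_zero])

end Extension

/-! ### Symmetric matrices -/

section Symmetric

variable {B : Type*} [Ring B] [StarRing B] [Algebra ℂ B] [StarModule ℂ B] {k : ℕ}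

theorem mem_C3 {X : Matrix (Fin k) (Fin k) ℂ} : X ∈ C3 k ↔ Xᵀ = X := Iff.rfl

theorem conjTranspose_mem_C3 {X : Matrix (Fin k) (Fin k) ℂ} (h : X ∈ C3 k) : Xᴴ ∈ C3 k := by
  rw [mem_C3] at *
  rw [Matrix.conjTranspose, ← Matrix.transpose_map, h, h]

/-- Triple maps on the symmetric matrices extend to all matrices: with `u = Ψ(1)` and
`J(x) = Ψ(x) u*`, a Jordan homomorphism, and with the symmetric matrix `o` all of whose entries
are `1`, the elements `J(eᵢᵢ) J(o) J(eⱼⱼ)` are matrix units, because `o eⱼⱼ o = o`. -/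
theorem exists_ternary_of_symmetric (Ψ : Matrix (Fin k) (Fin k) ℂ →ₗ[ℂ] B)
    (hΨ : IsTripleOn (C3 k) Ψ) :
    ∃ f : Matrix (Fin k) (Fin k) ℂ →ₗ[ℂ] B,
      (∀ X Y V, f (X * Yᴴ * V) = f X * star (f Y) * f V) ∧ ∀ X ∈ C3 k, f X = Ψ X := by
  set u := Ψ 1 with hu
  -- `u` is a partial isometry that carries the whole range of `Ψ` on both sides
  have m1 : (1 : Matrix (Fin k) (Fin k) ℂ) ∈ C3 k := by simp [mem_C3]
  have F1 : ∀ x ∈ C3 k, u * star (Ψ x) * u = Ψ xᴴ := by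
    intro x hx
    have := hΨ 1 m1 x hx 1 m1
    rw [Matrix.one_mul, Matrix.mul_one, map_add] at this
    exact (add_self_cancel this).symm
  have F2 : u * star u * u = u := by
    have := F1 1 m1
    rwa [Matrix.conjTranspose_one] at this
  have F3 : ∀ x ∈ C3 k, u * star u * Ψ x = Ψ x := by
    intro x hx
    have := F1 xᴴ (conjTranspose_mem_C3 hx)
    rw [Matrix.conjTranspose_conjTranspose] at this
    rw [← this]
    simp only [← mul_assoc, F2]
  have F3' : ∀ x ∈ C3 k, Ψ x * star u * u = Ψ x := by
    intro x hx
    have := F1 xᴴ (conjTranspose_mem_C3 hx)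
    rw [Matrix.conjTranspose_conjTranspose] at this
    rw [← this, mul_assoc _ (star u), mul_assoc _ u, ← mul_assoc u, F2]
  -- the self-adjoint Jordan homomorphism `J(x) = Ψ(x) u*`
  let J : Matrix (Fin k) (Fin k) ℂ →ₗ[ℂ] B := LinearMap.mulRight ℂ (star u) ∘ₗ Ψ
  have hJ : ∀ x, J x = Ψ x * star u := fun x => rfl
  have Js : ∀ x ∈ C3 k, star (J x) = J xᴴ := by
    intro x hx
    have h1 : star (Ψ x) * (u * star u) = star (Ψ x) := by
      have := congrArg star (F3 x hx)
      simpa [mul_assoc] using this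
    rw [hJ, hJ, star_mul, star_star, ← F1 x hx, mul_assoc _ u, mul_assoc, h1]
  have J3 : ∀ x ∈ C3 k, ∀ y ∈ C3 k, ∀ z ∈ C3 k,
      J x * J y * J z + J z * J y * J x = J (x * y * z + z * y * x) := by
    intro x hx y hy z hz
    have h1 : star u * Ψ y * star u = star (Ψ yᴴ) := by
      rw [← F1 y hy]
      simp [mul_assoc]
    have := hΨ x hx yᴴ (conjTranspose_mem_C3 hy) z hz
    rw [Matrix.conjTranspose_conjTranspose] at this
    rw [hJ (_ + _), this, ← h1]
    simp only [hJ]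
    noncomm_ring
  have J2 : ∀ x ∈ C3 k, ∀ y ∈ C3 k, J x * J y + J y * J x = J (x * y + y * x) := by
    intro x hx y hy
    have := hΨ x hx 1 m1 y hy
    rw [Matrix.conjTranspose_one, Matrix.mul_one, Matrix.mul_one] at this
    rw [hJ (_ + _), this]
    simp only [hJ]
    noncomm_ring
  have J3' : ∀ x ∈ C3 k, ∀ y ∈ C3 k, J x * J y * J x = J (x * y * x) := by
    intro x hx y hy
    have := J3 x hx y hy x hx
    rw [map_add] at this
    exact add_self_cancel this
  -- the diagonal matrix units and the matrix with all entries equal to one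
  let d : Fin k → Matrix (Fin k) (Fin k) ℂ := fun i => Matrix.single i i 1
  let o : Matrix (Fin k) (Fin k) ℂ := Matrix.of fun _ _ => 1
  have md : ∀ i, d i ∈ C3 k := fun i => by simp [mem_C3, d]
  have mo : o ∈ C3 k := rfl
  have hdd : ∀ i, d i * d i = d i := fun i => by simp [d]
  have hdd' : ∀ i j, i ≠ j → d i * d j = 0 := fun i j hij => by
    simp [d, hij]
  have hdX : ∀ (X : Matrix (Fin k) (Fin k) ℂ) i j, d i * X * d j = Matrix.single i j (X i j) := by
    intro X i j
    simp [d, Matrix.single_mul_mul_single]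
  have hodo : ∀ i, o * d i * o = o := by
    intro i
    ext a b
    simp [o, d, Matrix.mul_apply, Matrix.single_apply, Finset.sum_ite_eq, ite_and]
  have Jdd : ∀ i, J (d i) * J (d i) = J (d i) := by
    intro i
    have := J2 _ (md i) _ (md i)
    rw [hdd, map_add] at this
    exact add_self_cancel this
  have Jdd' : ∀ i j, i ≠ j → J (d i) * J (d j) = 0 := by
    intro i j hij
    have h1 := J2 _ (md i) _ (md j)
    have h2 := J3' _ (md i) _ (md j)
    rw [hdd' i j hij, hdd' j i hij.symm, add_zero, map_zero] at h1
    rw [hdd' i j hij, Matrix.zero_mul, map_zero] at h2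
    have h3 := congrArg (J (d i) * ·) h1
    simp only [mul_add, ← mul_assoc, Jdd, h2, add_zero, mul_zero] at h3
    exact h3
  let E : Fin k → Fin k → B := fun i j => J (d i) * J o * J (d j)
  have EE : ∀ i j l m, E i j * E l m = if j = l then E i m else 0 := by
    intro i j l m
    have h1 : E i j * E l m = J (d i) * J o * (J (d j) * J (d l)) * J o * J (d m) := by
      simp only [E, mul_assoc]
    rw [h1]
    split_ifs with h
    · subst h
      rw [Jdd, mul_assoc (J (d i)), mul_assoc (J (d i)), J3' _ mo _ (md j), hodo]
    · rw [Jdd' j l h]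
      simp
  have Es : ∀ i j, star (E i j) = E j i := by
    intro i j
    simp only [E, star_mul, Js _ (md _), Js _ mo]
    have h1 : oᴴ = o := by
      ext
      simp [o]
    have h2 : ∀ i, (d i)ᴴ = d i := fun i => by simp [d]
    rw [h1, h2, h2, mul_assoc]
  have Ju : ∀ x, J x * (u * star u) = J x := by
    intro x
    have := congrArg star F2
    simp only [star_mul, star_star] at this
    rw [hJ, mul_assoc, this]
  have Eu : ∀ i j, E i j * (u * star u) = E i j := fun i j => by
    simp only [E]
    rw [mul_assoc, Ju]
  refine ⟨unitsMap fun i j => E i j * u, IsUnits.ternary ?_, fun X hX => ?_⟩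
  · intro a b c d' l m
    have h1 : E a b * u * star (E c d' * u) * (E l m * u)
        = E a b * (u * star u) * E d' c * E l m * u := by
      rw [star_mul, Es]
      simp only [mul_assoc]
    rw [h1, Eu, EE]
    by_cases h : b = d' <;> by_cases h' : c = l <;> simp [h, h', EE]
  · have hsum : ∑ i, d i = 1 := by
      simp only [d]
      rw [Matrix.sum_single_eq_diagonal, Matrix.diagonal_one]
    have h1 : ∀ i j, J (d i) * J X * J (d j) = X i j • E i j := by
      intro i j
      by_cases hij : i = j
      · subst hij
        have h2 := J3' _ (md i) _ mo
        have h3 := J3' _ (md i) _ hX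
        rw [hdX] at h2 h3
        simp only [E]
        rw [h2, h3, ← map_smul]
        simp [o]
      · -- only the symmetrization `eᵢᵢ Y eⱼⱼ + eⱼⱼ Y eᵢᵢ` is available to `J`; the second
        -- summand does not contribute because `J(eᵢᵢ) J(eⱼⱼ) = 0`
        have key : ∀ Y ∈ C3 k, J (d i) * J Y * J (d j) =
            J (d i) * J (d i * Y * d j + d j * Y * d i) * J (d j) := by
          intro Y hY
          rw [← J3 _ (md i) _ hY _ (md j)]
          have e1 : J (d i) * (J (d i) * J Y * J (d j)) * J (d j) =
              (J (d i) * J (d i)) * J Y * (J (d j) * J (d j)) := by simp only [mul_assoc]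
          have e2 : J (d i) * (J (d j) * J Y * J (d i)) * J (d j) =
              (J (d i) * J (d j)) * J Y * (J (d i) * J (d j)) := by simp only [mul_assoc]
          rw [mul_add, add_mul, e1, e2, Jdd, Jdd, Jdd' i j hij, zero_mul, zero_mul, add_zero]
        have hX' : X j i = X i j := congrFun (congrFun hX i) j
        simp only [E]
        rw [key X hX, key o mo, ← smul_mul_assoc, ← mul_smul_comm, ← map_smul, hdX, hdX, hdX, hdX,
          hX']
        simp [o]
    have h2 : J X = ∑ i, ∑ j, X i j • E i j := by
      have h4 : J X = (∑ i, J (d i)) * J X * ∑ j, J (d j) := by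
        rw [← map_sum, hsum, J3' 1 m1 X hX, Matrix.one_mul, Matrix.mul_one]
      rw [h4]
      simp only [← h1, Finset.sum_mul, Finset.mul_sum]
      exact Finset.sum_comm
    rw [unitsMap_apply, ← F3' X hX, ← hJ, h2]
    simp only [Finset.sum_mul, smul_mul_assoc]

variable {Z : Type u} [NormedAddCommGroup Z] [NormedSpace ℂ Z] [CompleteSpace Z] [JBStarTriple Z]

/-- A triple of square matrices as a map into a product with one block. -/
def oneBlock {S : Submodule ℂ (Matrix (Fin k) (Fin k) ℂ)} (e : Z ≃ₗ[ℂ] S) :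
    Z →ₗ[ℂ] Rect (fun _ : Unit => Fin k) (fun _ : Unit => Fin k) :=
  LinearMap.pi fun _ => S.subtype ∘ₗ e.toLinearMap

theorem oneBlock_apply {S : Submodule ℂ (Matrix (Fin k) (Fin k) ℂ)} (e : Z ≃ₗ[ℂ] S) (z : Z)
    (i : Unit) : oneBlock e z i = (e z : Matrix (Fin k) (Fin k) ℂ) := rfl

/-- For a triple of matrices in one block, lifts are extensions from the triple to all matrices. -/
theorem hasLift_oneBlock {S : Submodule ℂ (Matrix (Fin k) (Fin k) ℂ)} (e : Z ≃ₗ[ℂ] S)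
    (he : ∀ x y z, (e (tri x y z) : Matrix (Fin k) (Fin k) ℂ) =
      (1 / 2 : ℂ) • ((e x : Matrix (Fin k) (Fin k) ℂ) * (e y : Matrix (Fin k) (Fin k) ℂ)ᴴ * (e z : Matrix (Fin k) (Fin k) ℂ)
        + (e z : Matrix (Fin k) (Fin k) ℂ) * (e y : Matrix (Fin k) (Fin k) ℂ)ᴴ * (e x : Matrix (Fin k) (Fin k) ℂ)))
    (h : ∀ (E : Type w) [NormedAddCommGroup E] [InnerProductSpace ℂ E] [CompleteSpace E]
      (Ψ : Matrix (Fin k) (Fin k) ℂ →ₗ[ℂ] (E →L[ℂ] E)), IsTripleOn S Ψ →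
      ∃ f : Matrix (Fin k) (Fin k) ℂ →ₗ[ℂ] (E →L[ℂ] E),
      (∀ X Y V, f (X * Yᴴ * V) = f X * star (f Y) * f V) ∧ ∀ X ∈ S, f X = Ψ X) :
    HasLift.{u, w} (oneBlock e) := by
  intro E _ _ _ φ hφ
  obtain ⟨Ψ, h1, h2⟩ := exists_tripleOn e he φ hφ
  obtain ⟨f, h3, h4⟩ := h E Ψ h2
  exact ⟨f ∘ₗ LinearMap.proj (), fun X Y V => h3 _ _ _,
    fun z => (h4 _ (e z).2).trans (h1 z)⟩

/-- The symmetric matrices generate all matrices, as `eᵢⱼ = eᵢᵢ o* eⱼⱼ` for the matrix `o` with all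
entries `1`. -/
theorem isModel_C3 (e : Z ≃ₗ[ℂ] C3 k)
    (he : ∀ x y z, (e (tri x y z) : Matrix (Fin k) (Fin k) ℂ) =
      (1 / 2 : ℂ) • ((e x : Matrix (Fin k) (Fin k) ℂ) * (e y : Matrix (Fin k) (Fin k) ℂ)ᴴ * (e z : Matrix (Fin k) (Fin k) ℂ)
        + (e z : Matrix (Fin k) (Fin k) ℂ) * (e y : Matrix (Fin k) (Fin k) ℂ)ᴴ * (e x : Matrix (Fin k) (Fin k) ℂ))) :
    IsModel (oneBlock e) where
  triple x y z _ := he x y z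
  generates S hS hρ := by
    have hmem : ∀ X ∈ C3 k, (fun _ => X) ∈ S := by
      intro X hX
      have := hρ (e.symm ⟨X, hX⟩)
      have h : oneBlock e (e.symm ⟨X, hX⟩) = fun _ => X := by
        ext i : 1
        simp [oneBlock_apply]
      rwa [h] at this
    refine eq_top_of_single_mem S fun _ a b => ?_
    let o : Matrix (Fin k) (Fin k) ℂ := Matrix.of fun _ _ => 1
    have := hS _ (hmem (Matrix.single a a 1) (by simp [mem_C3])) _ (hmem o rfl)
      _ (hmem (Matrix.single b b 1) (by simp [mem_C3]))
    convert this using 1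
    ext _ i j
    simp [o, Matrix.single_mul_mul_single]

/-- Symmetric matrices: the tripotents are the symmetric partial isometries, and every rank from `1`
to `k` occurs. -/
theorem hasInvariant_C3 (hk : 2 ≤ k) (hZ : IsoToMatrices Z (C3 k)) :
    HasInvariant.{u, v, w} Z (Set.Ici (0 : ℤ)) (Set.Icc (0 : ℤ) k) (Set.Icc (0 : ℤ) k)
      (Set.Icc (1 : ℤ) k) := by
  obtain ⟨e, he⟩ := hZ
  have : Nonempty (Fin k) := ⟨⟨0, by omega⟩⟩
  have hm := isModel_C3 e he
  refine hm.hasInvariant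
    (hasLift_oneBlock e he fun E _ _ _ Ψ hΨ => exists_ternary_of_symmetric Ψ hΨ)
    (hasLift_oneBlock e he fun E _ _ _ Ψ hΨ => exists_ternary_of_symmetric Ψ hΨ)
    unitEquiv (unitEquiv_image fun y => ?_) (unitEquiv_image fun y => ?_)
    (unitEquiv_image fun y => ?_) (unitEquiv_image fun y => ?_)
  · simp
  · simp
  · simp
  · constructor
    · rintro ⟨g, hg, hy⟩
      obtain ⟨r, h1, h2, -, h3⟩ := exists_nat_trace (hm.tripotent hg.2 ())
      have hyr : y = r := by
        have := (hy ()).trans h1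
        exact_mod_cast this
      have hr : r ≠ 0 := by
        intro h0
        refine hg.1 (e.injective (Subtype.ext ?_))
        rw [map_zero]
        exact h3 h0
      rw [Fintype.card_fin] at h2
      rw [hyr, Set.mem_Icc]
      omega
    · rintro ⟨h1, h2⟩
      let X : Matrix (Fin k) (Fin k) ℂ :=
        Matrix.diagonal fun i => if (i : ℕ) < y.toNat then 1 else 0
      have hX : X ∈ C3 k := Matrix.diagonal_transpose _
      have hs : Xᴴ = X := (isStarProjection_diagonal_ite fun i : Fin k => (i : ℕ) < y.toNat).2
      have hXX : X * X = X := (isStarProjection_diagonal_ite fun i : Fin k => (i : ℕ) < y.toNat).1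
      have htr : X.trace = (y.toNat : ℂ) := by
        rw [Matrix.trace_diagonal]
        exact sum_fin_ite_lt (by omega)
      have heX : (e (e.symm ⟨X, hX⟩) : Matrix (Fin k) (Fin k) ℂ) = X := by simp
      refine ⟨e.symm ⟨X, hX⟩, ⟨fun h0 => ?_, e.injective (Subtype.ext ?_)⟩, fun i => ?_⟩
      · rw [h0, map_zero] at heX
        rw [← heX] at htr
        have : (y.toNat : ℂ) = 0 := by rw [← htr]; simp
        have h3 : y.toNat = 0 := by exact_mod_cast this
        omega
      · rw [he, heX, hs, hXX, hXX, ← two_smul ℂ, smul_smul]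
        norm_num
      · rw [oneBlock_apply, heX, hs, hXX, htr]
        have h3 : y = (y.toNat : ℤ) := by omega
        conv_lhs => rw [h3]
        exact Int.cast_natCast _

end Symmetric

/-! ### Rectangular matrices -/

section PartialIsometries

variable {B : Type*} [Ring B] [StarRing B] [Algebra ℂ B]

/-- Orthogonal tripotents: `{e, e, f} = 0` implies `e* f = 0`. -/
theorem star_mul_eq_zero_of_tri {e f : B} (he : e * star e * e = e)
    (h : e * star e * f + f * star e * e = 0) : star e * f = 0 := by
  have he' : star e * e * star e = star e := by
    have := congrArg star he
    simpa [mul_assoc] using this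
  have h1 := congrArg (star e * ·) h
  have h2 := congrArg (fun x => star e * x * (star e * e)) h
  have h3 : star e * (e * star e * f + f * star e * e) =
      star e * f + star e * f * (star e * e) := by
    have : star e * (e * star e * f + f * star e * e) =
      star e * e * star e * f + star e * f * (star e * e) := by noncomm_ring
    rw [this, he']
  have h4 : star e * (e * star e * f + f * star e * e) * (star e * e) =
      star e * f * (star e * e) + star e * f * (star e * e) := by
    have : star e * (e * star e * f + f * star e * e) * (star e * e) =
      star e * e * star e * f * (star e * e) + star e * f * (star e * e * star e) * e := by
      noncomm_ring
    rw [this, he']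
    simp only [mul_assoc]
  have h5 : star e * f * (star e * e) = 0 := by
    refine eq_zero_of_add_self ?_
    rw [← h4]
    simpa using h2
  have h6 := h3.symm.trans h1
  simpa [h5] using h6

/-- Collinear tripotents: `{e, e, f} = f / 2` implies that `e e*` and `f f*` commute. -/
theorem commute_of_tri {e f : B} (he : e * star e * e = e)
    (h : e * star e * f + f * star e * e = f) : Commute (e * star e) (f * star f) := by
  set p := e * star e with hp
  set q := star e * e with hq
  have hpp : p * p = p := by rw [hp, ← mul_assoc, he]
  have hps : star p = p := by simp [hp]
  have hqs : star q = q := by simp [hq]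
  rw [mul_assoc f] at h
  change p * f + f * q = f at h
  have h1 : p * f * q = 0 := by
    have := congrArg (p * ·) h
    simp only [mul_add, ← mul_assoc, hpp] at this
    simpa using this
  have h2 : p * (f * star f) = p * (f * star f) * p := by
    have h3 : star f = star f * p + q * star f := by
      have := congrArg star h
      simpa [hps, hqs] using this.symm
    have h4 : p * (f * (star f * p + q * star f)) = p * (f * star f) * p + p * f * q * star f := by
      noncomm_ring
    rw [← h3, h1, zero_mul, add_zero] at h4
    exact h4
  have h5 := congrArg star h2
  simp only [star_mul, star_star, hps] at h5
  rw [Commute, SemiconjBy, h2, h5, mul_assoc]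

/-- In a quadrangle of tripotents the products of opposite sides agree. -/
theorem mul_star_eq_of_quadrangle {e f g h : B} (hf : f * star f * f = f) (hh : h * star h * h = h)
    (hfh : f * star f * h + h * star f * f = h) (hg : e * star f * h + h * star f * e = g)
    (he : g * star h * f + f * star h * g = e) (heh : e * star h = 0) (hgf : g * star f = 0) :
    e * star f = g * star h := by
  have h1 : g * star h = e * star f * (h * star h) := by
    have := congrArg (· * star h) hg
    simp only [add_mul] at this
    rw [mul_assoc (h * _), heh, mul_zero, add_zero] at this
    rw [← this, mul_assoc]
  have h2 : e * star f = g * star h * (f * star f) := by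
    have := congrArg (· * star f) he
    simp only [add_mul] at this
    rw [mul_assoc (f * _), hgf, mul_zero, add_zero] at this
    rw [← this, mul_assoc]
  have hc : Commute (f * star f) (h * star h) := commute_of_tri hf hfh
  have hpp : h * star h * (h * star h) = h * star h := by rw [← mul_assoc, hh]
  have h3 : e * star f = e * star f * (h * star h) * (f * star f) := by rw [← h1, ← h2]
  rw [mul_assoc, ← hc.eq] at h3
  have h4 : ∀ a p r : B, r * r = r → a = a * (p * r) → a * r = a := by
    intro a p r hr ha
    calc a * r = a * (p * r) * r := by rw [← ha]
      _ = a * (p * (r * r)) := by simp only [mul_assoc]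
      _ = a := by rw [hr, ← ha]
  rw [h1, h4 _ _ _ hpp h3]

end PartialIsometries

section RectRel

variable {B : Type*} [Ring B] [StarRing B] [Algebra ℂ B]
  {α β : Type} [DecidableEq α] [DecidableEq β]

/-- The triple relations between rectangular matrix units. -/
def RectRel (u : α → β → B) : Prop := ∀ i j k l p q,
  u i j * star (u k l) * u p q + u p q * star (u k l) * u i j =
    (if j = l ∧ k = p then u i q else 0) + (if q = l ∧ k = i then u p j else 0)

variable {u : α → β → B}

theorem RectRel.transpose (h : RectRel u) : RectRel fun j i => u i j := by
  intro j i l k q p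
  rw [h, add_comm]
  congr 1 <;> congr 1 <;> rw [and_comm] <;> simp [eq_comm]

theorem RectRel.star (h : RectRel u) : RectRel fun j i => star (u i j) := by
  intro j i l k q p
  have := congrArg Star.star (h p q k l i j)
  simp only [star_add, star_mul, star_star, ← mul_assoc, apply_ite Star.star, star_zero] at this
  simp only [star_star]
  rw [this]
  congr 1 <;> congr 1 <;> rw [and_comm] <;> simp [eq_comm]

theorem RectRel.self (h : RectRel u) (i : α) (j : β) : u i j * Star.star (u i j) * u i j = u i j := by
  have := h i j i j i j
  simp only [and_self, if_true] at this
  exact add_self_cancel this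

theorem RectRel.star_mul_eq_zero (h : RectRel u) {i k : α} {j l : β} (hik : i ≠ k) (hjl : j ≠ l) :
    Star.star (u i j) * u k l = 0 := by
  refine star_mul_eq_zero_of_tri (h.self i j) ?_
  rw [h]
  simp [hik, hjl.symm]

theorem RectRel.mul_star_eq_zero (h : RectRel u) {i k : α} {j l : β} (hik : i ≠ k) (hjl : j ≠ l) :
    u i j * Star.star (u k l) = 0 := by
  have := h.star.star_mul_eq_zero hjl hik
  simpa using this

theorem RectRel.sandwich (h : RectRel u) {i : α} {j l : β} (hjl : j ≠ l) :
    Star.star (u i j) * u i l * Star.star (u i j) = 0 := by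
  have := h i j i l i j
  simp only [hjl, false_and, if_false, add_zero] at this
  have := congrArg Star.star (eq_zero_of_add_self this)
  simpa [mul_assoc] using this

theorem RectRel.collinear (h : RectRel u) {i k : α} (hik : i ≠ k) (j : β) :
    u i j * Star.star (u i j) * u k j + u k j * Star.star (u i j) * u i j = u k j := by
  rw [h]
  simp [hik]

theorem RectRel.quadrangle (h : RectRel u) {i k : α} {j l : β} (hik : i ≠ k) (hjl : j ≠ l) :
    u i l * Star.star (u k l) * u k j + u k j * Star.star (u k l) * u i l = u i j := by
  rw [h]
  simp [hik.symm, hjl]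

/-- The product `uᵢₗ uₖₗ*` does not depend on the column. -/
theorem RectRel.mul_star_eq (h : RectRel u) {i k : α} (hik : i ≠ k) (l j : β) :
    u i l * Star.star (u k l) = u i j * Star.star (u k j) := by
  by_cases hjl : j = l
  · rw [hjl]
  exact mul_star_eq_of_quadrangle (h.self k l) (h.self k j) (by rw [h]; simp [hjl])
    (h.quadrangle hik hjl) (h.quadrangle hik (Ne.symm hjl)) (h.mul_star_eq_zero hik (Ne.symm hjl))
    (h.mul_star_eq_zero hik hjl)

variable [Nontrivial β]

/-- Transition products `uᵢᵣ uₖᵣ*` compose within words; the defect of the composition vanishes by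
orthogonality after moving to a common column. -/
theorem RectRel.mul_mul_eq (h : RectRel u) {i k l : α} (hik : i ≠ k) (hkl : k ≠ l) (j r s : β) :
    u i r * Star.star (u k r) * (u k s * Star.star (u l s) * u l j) =
      u i r * Star.star (u k r) * u k j := by
  obtain ⟨t, ht⟩ := exists_ne j
  rw [h.mul_star_eq hkl s t, h.mul_star_eq hik r t,
    eq_sub_of_add_eq (h.quadrangle hkl ht.symm), mul_sub, sub_eq_self]
  simp only [mul_assoc]
  rw [← mul_assoc _ (u l j), h.star_mul_eq_zero hkl ht]
  simp

/-- The word `uᵢᵣ uₖᵣ* uₖⱼ` depends on `i` and `j` only. -/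
theorem RectRel.word_eq (h : RectRel u) {i k l : α} (hik : i ≠ k) (hil : i ≠ l) (j r s : β) :
    u i r * Star.star (u k r) * u k j = u i s * Star.star (u l s) * u l j := by
  by_cases hkl : k = l
  · rw [hkl, h.mul_star_eq hil r s]
  obtain ⟨t, ht⟩ := exists_ne j
  rw [← h.mul_mul_eq hik hkl j r t, ← mul_assoc]
  congr 1
  obtain ⟨t', ht'⟩ := exists_ne t
  rw [h.mul_star_eq hik r t', ← mul_assoc]
  have := congrArg (· * Star.star (u l t)) (h.quadrangle hik ht'.symm)
  simp only [add_mul] at this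
  rw [mul_assoc (u k t * _), h.mul_star_eq_zero hil ht', mul_zero, add_zero] at this
  rw [this, h.mul_star_eq hil]

theorem RectRel.mul_star_mul (h : RectRel u) {i k : α} (hik : i ≠ k) (j : β) :
    u i j * Star.star (u k j) * (u k j * Star.star (u i j)) * (u i j * Star.star (u k j)) =
      u i j * Star.star (u k j) := by
  have hc : Commute (Star.star (u k j) * u k j) (Star.star (u i j) * u i j) := by
    have := commute_of_tri (h.star.self j k) (f := Star.star (u i j)) (by
      rw [h.star]; simp [hik])
    simpa using this
  have h1 : u i j * Star.star (u k j) * (u k j * Star.star (u i j)) * (u i j * Star.star (u k j)) =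
      u i j * (Star.star (u k j) * u k j * (Star.star (u i j) * u i j)) * Star.star (u k j) := by
    simp only [mul_assoc]
  have h2 : u i j * (Star.star (u i j) * u i j * (Star.star (u k j) * u k j)) * Star.star (u k j)
      = (u i j * Star.star (u i j) * u i j) * Star.star (u k j * Star.star (u k j) * u k j) := by
    simp only [mul_assoc, star_mul, star_star]
  rw [h1, hc.eq, h2, h.self, h.self]

variable [Nontrivial α]

/-- An index different from a given one. -/
def other {α : Type} [Nontrivial α] (i : α) : α := (exists_ne i).choose

theorem other_ne {α : Type} [Nontrivial α] (i : α) : other i ≠ i := (exists_ne i).choose_spec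

/-- The part of a rectangular grid of tripotents that consists of matrix units. -/
def unitPart (u : α → β → B) (i : α) (j : β) : B :=
  u i (other j) * Star.star (u (other i) (other j)) * u (other i) j

theorem RectRel.unitPart_eq (h : RectRel u) {i k : α} (hk : k ≠ i) (j l : β) :
    unitPart u i j = u i l * Star.star (u k l) * u k j :=
  h.word_eq (other_ne i).symm hk.symm j _ _

/-- The quadrangle relation splits a grid into the matrix units that it and its transpose define. -/
theorem RectRel.unitPart_add (h : RectRel u) (i : α) (j : β) :
    unitPart u i j + unitPart (fun j i => u i j) j i = u i j :=
  h.quadrangle (other_ne i).symm (other_ne j).symm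

theorem unitPart_star (u : α → β → B) (i : α) (j : β) :
    unitPart (fun j i => Star.star (u i j)) j i = Star.star (unitPart u i j) := by
  simp [unitPart, mul_assoc]

/-- The words `uᵢᵣ uₖᵣ* uₖⱼ` are rectangular matrix units. -/
theorem RectRel.unitPart_isUnits (h : RectRel u) : IsUnits (unitPart u) := by
  have hA : ∀ i k {j l}, j ≠ l → unitPart u i j * Star.star (unitPart u k l) = 0 := by
    intro i k j l hjl
    by_cases hik : i = k
    · subst hik
      rw [h.unitPart_eq (other_ne i) j l, h.unitPart_eq (other_ne i) l l]
      simp only [star_mul, star_star]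
      rw [mul_assoc (u i l), mul_assoc (u i l), ← mul_assoc _ (Star.star (u (other i) l)),
        h.sandwich hjl.symm]
      simp
    · rw [h.unitPart_eq (Ne.symm hik) j l, h.unitPart_eq hik l l]
      simp only [star_mul]
      rw [mul_assoc, ← mul_assoc (u k j), h.mul_star_eq_zero (Ne.symm hik) hjl]
      simp
  have hB : ∀ {c k} d l, c ≠ k → Star.star (unitPart u c d) * unitPart u k l = 0 := by
    intro c k d l hck
    rw [h.unitPart_eq (other_ne c) d (other d), h.unitPart_eq (other_ne k) l d]
    simp only [star_mul, star_star, mul_assoc]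
    rw [← mul_assoc _ (u k d), h.star_mul_eq_zero hck (other_ne d)]
    simp
  have hC : ∀ a c b l, unitPart u a b * Star.star (unitPart u c b) * unitPart u c l =
      unitPart u a l := by
    intro a c b l
    by_cases hac : a = c
    · subst hac
      have h1 : unitPart u a b * Star.star (unitPart u a b) =
          u a b * Star.star (u (other a) b) * (u (other a) b * Star.star (u a b)) := by
        rw [h.unitPart_eq (other_ne a) b b]
        have h2 : u a b * Star.star (u (other a) b) * u (other a) b *
            Star.star (u a b * Star.star (u (other a) b) * u (other a) b) =
            u a b * Star.star (u (other a) b * Star.star (u (other a) b) * u (other a) b) *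
              (u (other a) b * Star.star (u a b)) := by
          simp [mul_assoc]
        rw [h2, h.self]
      rw [h1, h.unitPart_eq (other_ne a) l b, ← mul_assoc, h.mul_star_mul (other_ne a).symm]
    · have h1 : unitPart u a b * Star.star (unitPart u c b) =
          u a b * Star.star (u c b) := by
        rw [h.unitPart_eq (Ne.symm hac) b b, h.unitPart_eq hac b b]
        refine Eq.trans ?_ (h.mul_star_mul hac b)
        simp [mul_assoc]
      rw [h1, h.unitPart_eq hac l b, h.unitPart_eq (Ne.symm hac) l b,
        h.mul_mul_eq hac (Ne.symm hac)]
  intro a b c d k l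
  by_cases hbd : b = d
  · subst hbd
    by_cases hck : c = k
    · subst hck
      simp [hC]
    · rw [mul_assoc, hB _ _ hck]
      simp [hck]
  · rw [hA _ _ hbd]
    simp [hbd]

/-- The two parts of a rectangular grid are orthogonal. -/
theorem RectRel.unitPart_mul_star (h : RectRel u) (i s : α) (j t : β) :
    unitPart u i j * Star.star (unitPart (fun j i => u i j) t s) = 0 := by
  have e2 : ∀ {r} (_ : r ≠ t) k', unitPart (fun j i => u i j) t s =
      u k' t * Star.star (u k' r) * u s r := fun hr k' => h.transpose.unitPart_eq hr s k'
  have e1 : ∀ {k} (_ : k ≠ i) l, unitPart u i j = u i l * Star.star (u k l) * u k j :=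
    fun hk l => h.unitPart_eq hk j l
  by_cases his : i = s
  · subst his
    by_cases hjt : j = t
    · subst hjt
      rw [e1 (other_ne i) j, e2 (other_ne j) i]
      simp only [star_mul, mul_assoc]
      rw [← mul_assoc (u (other i) j), h.mul_star_eq_zero (other_ne i) (other_ne j).symm]
      simp
    · rw [e1 (other_ne i) t, e2 hjt i]
      simp only [star_mul, star_star, mul_assoc]
      have h1 := h.collinear (other_ne i).symm j
      rw [mul_assoc (u (other i) j)] at h1
      rw [← mul_assoc _ (u i j), ← mul_assoc (u (other i) j),
        eq_sub_of_add_eq' h1, sub_mul, h.mul_star_eq_zero (other_ne i) hjt, mul_sub]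
      simp only [mul_assoc]
      rw [← mul_assoc _ (u i j), h.star_mul_eq_zero (other_ne i) (Ne.symm hjt)]
      simp
  · by_cases hjt : j = t
    · subst hjt
      rw [e1 (Ne.symm his) (other j), e2 (other_ne j) i]
      simp only [star_mul, mul_assoc]
      rw [← mul_assoc (u s j), ← mul_assoc _ (u s j * _), ← mul_assoc _ (u s j),
        h.sandwich (other_ne j)]
      simp
    · rw [e1 (Ne.symm his) t, e2 hjt i]
      simp only [star_mul, star_star, mul_assoc]
      have h1 := h.collinear (Ne.symm his) j
      have h2 : u s j * (Star.star (u s j) * (u i j * Star.star (u i t))) =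
        u i j * Star.star (u i t) - u i j * Star.star (u s j) * u s j * Star.star (u i t) := by
        rw [← sub_mul, ← eq_sub_of_add_eq h1]
        simp only [mul_assoc]
      have h3 : ∀ x, Star.star (u s t) * (u i j * x) = 0 := fun x => by
        rw [← mul_assoc, h.star_mul_eq_zero (Ne.symm his) (Ne.symm hjt), zero_mul]
      rw [h2]
      simp [mul_sub, mul_assoc, h3]

theorem RectRel.star_mul_unitPart (h : RectRel u) (i s : α) (j t : β) :
    Star.star (unitPart u i j) * unitPart (fun j i => u i j) t s = 0 := by
  have h1 := h.star.unitPart_mul_star j t i s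
  have h2 := unitPart_star (fun j i => u i j) t s
  rw [unitPart_star] at h1
  rw [h2] at h1
  simpa using h1

variable [Fintype α] [Fintype β] [StarModule ℂ B]

/-- Elements that satisfy the triple relations of rectangular matrix units come from a ternary
map on two blocks. -/
theorem RectRel.ternary (h : RectRel u) (X Y V : Matrix α β ℂ) (X' Y' V' : Matrix β α ℂ) :
    unitsMap (unitPart u) (X * Yᴴ * V) + unitsMap (unitPart fun j i => u i j) (X' * Y'ᴴ * V') =
      (unitsMap (unitPart u) X + unitsMap (unitPart fun j i => u i j) X') *
      Star.star (unitsMap (unitPart u) Y + unitsMap (unitPart fun j i => u i j) Y') *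
      (unitsMap (unitPart u) V + unitsMap (unitPart fun j i => u i j) V') := by
  have h1 : ∀ (X : Matrix α β ℂ) (Y : Matrix β α ℂ), unitsMap (unitPart u) X *
      Star.star (unitsMap (unitPart fun j i => u i j) Y) = 0 := by
    intro X Y
    simp only [unitsMap_apply, star_sum, star_smul, Finset.mul_sum, Finset.sum_mul,
      mul_smul_comm, smul_mul_assoc, h.unitPart_mul_star, smul_zero, Finset.sum_const_zero]
  have h2 : ∀ (X : Matrix α β ℂ) (Y : Matrix β α ℂ), Star.star (unitsMap (unitPart u) X) *
      unitsMap (unitPart fun j i => u i j) Y = 0 := by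
    intro X Y
    simp only [unitsMap_apply, star_sum, star_smul, Finset.mul_sum, Finset.sum_mul,
      mul_smul_comm, smul_mul_assoc, h.star_mul_unitPart, smul_zero, Finset.sum_const_zero]
  have h3 : ∀ (X : Matrix α β ℂ) (Y : Matrix β α ℂ),
      unitsMap (unitPart fun j i => u i j) Y * Star.star (unitsMap (unitPart u) X) = 0 := by
    intro X Y
    simpa using congrArg Star.star (h1 X Y)
  have h4 : ∀ (X : Matrix α β ℂ) (Y : Matrix β α ℂ),
      Star.star (unitsMap (unitPart fun j i => u i j) Y) * unitsMap (unitPart u) X = 0 := by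
    intro X Y
    simpa using congrArg Star.star (h2 X Y)
  rw [h.unitPart_isUnits.ternary, h.transpose.unitPart_isUnits.ternary]
  have h5 : ∀ (W : B) (X : Matrix α β ℂ) (Y : Matrix β α ℂ), W * Star.star (unitsMap (unitPart u) X) *
      unitsMap (unitPart fun j i => u i j) Y = 0 := fun W X Y => by rw [mul_assoc, h2, mul_zero]
  have h6 : ∀ (W : B) (X : Matrix α β ℂ) (Y : Matrix β α ℂ),
      W * Star.star (unitsMap (unitPart fun j i => u i j) Y) * unitsMap (unitPart u) X = 0 :=
    fun W X Y => by rw [mul_assoc, h4, mul_zero]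
  simp only [star_add, mul_add, add_mul, h1, h3, h5, h6, add_zero, zero_add]

end RectRel

section Rectangular

variable {Z : Type u} [NormedAddCommGroup Z] [NormedSpace ℂ Z] [CompleteSpace Z] [JBStarTriple Z]
  {n m : ℕ}

/-- The triple relations of the images of the matrix units under a triple map. -/
theorem rectRel_of_tripleOn {B : Type*} [Ring B] [StarRing B] [Algebra ℂ B]
    (Ψ : Matrix (Fin n) (Fin m) ℂ →ₗ[ℂ] B) (hΨ : IsTripleOn (C1 n m) Ψ) :
    RectRel fun i j => Ψ (Matrix.single i j 1) := by
  intro i j k l p q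
  have h := hΨ (Matrix.single i j 1) trivial (Matrix.single k l 1) trivial
    (Matrix.single p q 1) trivial
  rw [← h, map_add]
  congr 1
  · by_cases h1 : j = l
    · by_cases h2 : k = p
      · simp [h1, h2]
      · simp [h1, h2]
    · simp [h1]
  · by_cases h1 : q = l
    · by_cases h2 : k = i
      · simp [h1, h2]
      · simp [h1, h2]
    · simp [h1]

/-- Rectangular matrices together with their transposes. -/
def twoBlocks (e : Z ≃ₗ[ℂ] C1 n m) :
    Z →ₗ[ℂ] Rect (fun b : Bool => Fin (cond b m n)) (fun b : Bool => Fin (cond b n m)) :=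
  LinearMap.pi fun b => match b with
    | false => (C1 n m).subtype ∘ₗ e.toLinearMap
    | true => (Matrix.transposeLinearEquiv (Fin n) (Fin m) ℂ ℂ).toLinearMap ∘ₗ
        (C1 n m).subtype ∘ₗ e.toLinearMap

theorem twoBlocks_false (e : Z ≃ₗ[ℂ] C1 n m) (z : Z) :
    twoBlocks e z false = (e z : Matrix (Fin n) (Fin m) ℂ) := rfl

theorem twoBlocks_true (e : Z ≃ₗ[ℂ] C1 n m) (z : Z) :
    twoBlocks e z true = (e z : Matrix (Fin n) (Fin m) ℂ)ᵀ := rfl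

/-- A triple map on rectangular matrices is the sum of a ternary map and of a ternary map of the
transposes, with orthogonal ranges. -/
theorem hasLift_twoBlocks (hn : 2 ≤ n) (hm : 2 ≤ m) (e : Z ≃ₗ[ℂ] C1 n m)
    (he : ∀ x y z, (e (tri x y z) : Matrix (Fin n) (Fin m) ℂ) =
      (1 / 2 : ℂ) • ((e x : Matrix (Fin n) (Fin m) ℂ) * (e y : Matrix (Fin n) (Fin m) ℂ)ᴴ *
          (e z : Matrix (Fin n) (Fin m) ℂ)
        + (e z : Matrix (Fin n) (Fin m) ℂ) * (e y : Matrix (Fin n) (Fin m) ℂ)ᴴ *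
          (e x : Matrix (Fin n) (Fin m) ℂ))) :
    HasLift.{u, w} (twoBlocks e) := by
  intro E _ _ _ φ hφ
  obtain ⟨Ψ, h1, h2⟩ := exists_tripleOn e he φ hφ
  have : Nontrivial (Fin n) := Fin.nontrivial_iff_two_le.2 hn
  have : Nontrivial (Fin m) := Fin.nontrivial_iff_two_le.2 hm
  have h := rectRel_of_tripleOn Ψ h2
  let v := unitPart fun (i : Fin n) (j : Fin m) => Ψ (Matrix.single i j 1)
  let v' := unitPart fun (j : Fin m) (i : Fin n) => Ψ (Matrix.single i j 1)
  refine ⟨unitsMap v ∘ₗ LinearMap.proj (φ := fun b : Bool =>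
      Matrix (Fin (cond b m n)) (Fin (cond b n m)) ℂ) false + unitsMap v' ∘ₗ LinearMap.proj
      (φ := fun b : Bool => Matrix (Fin (cond b m n)) (Fin (cond b n m)) ℂ) true,
    fun X Y V => h.ternary _ _ _ _ _ _, fun z => ?_⟩
  rw [← h1]
  change unitsMap v (e z : Matrix (Fin n) (Fin m) ℂ) + unitsMap v' (e z : Matrix (Fin n) (Fin m) ℂ)ᵀ = _
  conv_rhs => rw [Matrix.matrix_eq_sum_single (e z : Matrix (Fin n) (Fin m) ℂ)]
  rw [unitsMap_apply, unitsMap_apply, Finset.sum_comm (γ := Fin m), ← Finset.sum_add_distrib,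
    map_sum]
  refine Finset.sum_congr rfl fun i _ => ?_
  rw [← Finset.sum_add_distrib, map_sum]
  refine Finset.sum_congr rfl fun j _ => ?_
  rw [Matrix.transpose_apply, ← smul_add, h.unitPart_add, ← map_smul, Matrix.smul_single,
    smul_eq_mul, mul_one]

/-- Products of matrix units in which the middle factor shares a row with one neighbour and a
column with the other survive in one of the two blocks only, so the two blocks are separated. -/
theorem isModel_twoBlocks (hn : 2 ≤ n) (hm : 2 ≤ m) (e : Z ≃ₗ[ℂ] C1 n m)
    (he : ∀ x y z, (e (tri x y z) : Matrix (Fin n) (Fin m) ℂ) =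
      (1 / 2 : ℂ) • ((e x : Matrix (Fin n) (Fin m) ℂ) * (e y : Matrix (Fin n) (Fin m) ℂ)ᴴ *
          (e z : Matrix (Fin n) (Fin m) ℂ)
        + (e z : Matrix (Fin n) (Fin m) ℂ) * (e y : Matrix (Fin n) (Fin m) ℂ)ᴴ *
          (e x : Matrix (Fin n) (Fin m) ℂ))) :
    IsModel (twoBlocks e) where
  triple x y z b := by
    cases b
    · exact he x y z
    · change (e (tri x y z) : Matrix (Fin n) (Fin m) ℂ)ᵀ = (1 / 2 : ℂ) •
        ((e x : Matrix (Fin n) (Fin m) ℂ)ᵀ * (e y : Matrix (Fin n) (Fin m) ℂ)ᵀᴴ *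
          (e z : Matrix (Fin n) (Fin m) ℂ)ᵀ
        + (e z : Matrix (Fin n) (Fin m) ℂ)ᵀ * (e y : Matrix (Fin n) (Fin m) ℂ)ᵀᴴ *
          (e x : Matrix (Fin n) (Fin m) ℂ)ᵀ)
      rw [he, Matrix.transpose_smul, Matrix.transpose_add, add_comm]
      simp only [Matrix.transpose_mul, Matrix.mul_assoc]
      rfl
  generates S hS hρ := by
    have : Nontrivial (Fin n) := Fin.nontrivial_iff_two_le.2 hn
    have : Nontrivial (Fin m) := Fin.nontrivial_iff_two_le.2 hm
    let U : Fin n → Fin m → Rect (fun b : Bool => Fin (cond b m n))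
      (fun b : Bool => Fin (cond b n m)) := fun i j b => match b with
        | false => Matrix.single i j 1
        | true => Matrix.single j i 1
    have hU : ∀ i j, U i j ∈ S := by
      intro i j
      have := hρ (e.symm ⟨Matrix.single i j 1, trivial⟩)
      have h : twoBlocks e (e.symm ⟨Matrix.single i j 1, trivial⟩) = U i j := by
        funext b
        cases b
        · simp [twoBlocks_false, U]
        · rw [twoBlocks_true]
          simp [U, Matrix.transpose_single]
      rwa [h] at this
    refine eq_top_of_single_mem S fun b => ?_
    cases b
    · intro (i : Fin n) (j : Fin m)
      have := hS _ (hU i (other j)) _ (hU (other i) (other j)) _ (hU (other i) j)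
      convert this using 1
      funext b
      cases b
      · rw [Pi.single_eq_same]
        change (Matrix.single i j 1 : Matrix (Fin n) (Fin m) ℂ) = (Matrix.single i (other j) 1 : Matrix (Fin n) (Fin m) ℂ) *
          (Matrix.single (other i) (other j) 1 : Matrix (Fin n) (Fin m) ℂ)ᴴ * (Matrix.single (other i) j 1 : Matrix (Fin n) (Fin m) ℂ)
        simp
      · rw [Pi.single_eq_of_ne (by simp)]
        change (0 : Matrix (Fin m) (Fin n) ℂ) = (Matrix.single (other j) i 1 : Matrix (Fin m) (Fin n) ℂ) *
          (Matrix.single (other j) (other i) 1 : Matrix (Fin m) (Fin n) ℂ)ᴴ * (Matrix.single j (other i) 1 : Matrix (Fin m) (Fin n) ℂ)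
        simp [(other_ne i).symm]
    · intro (j : Fin m) (i : Fin n)
      have := hS _ (hU (other i) j) _ (hU (other i) (other j)) _ (hU i (other j))
      convert this using 1
      funext b
      cases b
      · rw [Pi.single_eq_of_ne (by simp)]
        change (0 : Matrix (Fin n) (Fin m) ℂ) = (Matrix.single (other i) j 1 : Matrix (Fin n) (Fin m) ℂ) *
          (Matrix.single (other i) (other j) 1 : Matrix (Fin n) (Fin m) ℂ)ᴴ * (Matrix.single i (other j) 1 : Matrix (Fin n) (Fin m) ℂ)
        simp [(other_ne j).symm]
      · rw [Pi.single_eq_same]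
        change (Matrix.single j i 1 : Matrix (Fin m) (Fin n) ℂ) = (Matrix.single j (other i) 1 : Matrix (Fin m) (Fin n) ℂ) *
          (Matrix.single (other j) (other i) 1 : Matrix (Fin m) (Fin n) ℂ)ᴴ * (Matrix.single (other j) i 1 : Matrix (Fin m) (Fin n) ℂ)
        simp

/-- Rectangular matrices with at least two rows and columns: a tripotent and its transpose have the
same rank, so the classes of tripotents lie on the diagonal. -/
theorem hasInvariant_C1 (hn : 2 ≤ n) (hm : 2 ≤ m) (hZ : IsoToMatrices Z (C1 n m)) :
    HasInvariant.{u, v, w} Z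
        {x : ℤ × ℤ | 0 ≤ x.1 ∧ 0 ≤ x.2}
        (Set.Icc (0 : ℤ) n ×ˢ Set.Icc (0 : ℤ) m)
        (Set.Icc (0 : ℤ) m ×ˢ Set.Icc (0 : ℤ) n)
        {x : ℤ × ℤ | ∃ r : ℕ, 1 ≤ r ∧ r ≤ n ∧ r ≤ m ∧ x = ((r : ℤ), (r : ℤ))} := by
  obtain ⟨e, he⟩ := hZ
  have (b : Bool) : Nonempty (Fin (cond b m n)) := ⟨⟨0, by cases b <;> simp <;> omega⟩⟩
  have (b : Bool) : Nonempty (Fin (cond b n m)) := ⟨⟨0, by cases b <;> simp <;> omega⟩⟩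
  have hmod := isModel_twoBlocks hn hm e he
  have htr : ∀ z, (twoBlocks e z true * (twoBlocks e z true)ᴴ).trace =
      (twoBlocks e z false * (twoBlocks e z false)ᴴ).trace := by
    intro z
    rw [twoBlocks_true, twoBlocks_false, Matrix.trace_mul_comm (_ : Matrix (Fin n) (Fin m) ℂ),
      ← Matrix.trace_transpose (_ * (e z : Matrix (Fin n) (Fin m) ℂ)), Matrix.transpose_mul]
    rfl
  refine hmod.hasInvariant (hasLift_twoBlocks hn hm e he) (hasLift_twoBlocks hn hm e he)
    boolEquiv (boolEquiv_image fun y => ?_) (boolEquiv_image fun y => ?_)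
    (boolEquiv_image fun y => ?_) (boolEquiv_image fun y => ?_)
  · simp [Bool.forall_bool]
  · simp only [Set.mem_ofPred_eq, Bool.forall_bool, Fintype.card_fin, Set.mem_prod, Set.mem_Icc]
    exact Iff.rfl
  · simp only [Set.mem_ofPred_eq, Bool.forall_bool, Fintype.card_fin, Set.mem_prod, Set.mem_Icc]
    exact Iff.rfl
  · constructor
    · rintro ⟨g, hg, hy⟩
      obtain ⟨r, h1, h2, h2', h3⟩ := exists_nat_trace (hmod.tripotent hg.2 false)
      have hy1 : y.1 = r := by
        have := (hy false).trans h1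
        exact_mod_cast this
      have hy2 : y.2 = r := by
        have := (hy true).trans ((htr g).trans h1)
        exact_mod_cast this
      have hr : r ≠ 0 := by
        intro h0
        refine hg.1 (e.injective (Subtype.ext ?_))
        rw [map_zero]
        exact h3 h0
      rw [Fintype.card_fin] at h2 h2'
      exact ⟨r, Nat.one_le_iff_ne_zero.2 hr, h2, h2', Prod.ext hy1 hy2⟩
    · rintro ⟨r, h1, h2, h3, rfl⟩
      let X : Matrix (Fin n) (Fin m) ℂ :=
        Matrix.of fun i j => if (i : ℕ) = j ∧ (i : ℕ) < r then 1 else 0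
      have hXX : X * Xᴴ = Matrix.diagonal fun i : Fin n => if (i : ℕ) < r then 1 else 0 := by
        ext i k
        rw [Matrix.mul_apply, Matrix.diagonal_apply]
        by_cases hi : (i : ℕ) < r
        · rw [Finset.sum_eq_single ⟨i, by omega⟩]
          · by_cases hik : i = k
            · subst hik
              simp [X, hi]
            · have : ¬ (k : ℕ) = i := fun h => hik (Fin.ext h.symm)
              simp [X, hik, this]
          · intro j _ hj
            have : ¬ (i : ℕ) = j := fun h => hj (Fin.ext h.symm)
            simp [X, this]
          · simp
        · simp [X, hi]
      have hX3 : X * Xᴴ * X = X := by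
        rw [hXX]
        ext i j
        rw [Matrix.diagonal_mul]
        by_cases hi : (i : ℕ) < r <;> simp [X, hi]
      have htX : (X * Xᴴ).trace = r := by
        rw [hXX, Matrix.trace_diagonal]
        exact sum_fin_ite_lt h2
      have heX : (e (e.symm ⟨X, trivial⟩) : Matrix (Fin n) (Fin m) ℂ) = X := by simp
      have hf : (twoBlocks e (e.symm ⟨X, trivial⟩) false *
          (twoBlocks e (e.symm ⟨X, trivial⟩) false)ᴴ).trace = r := by
        rw [twoBlocks_false, heX, htX]
      refine ⟨e.symm ⟨X, trivial⟩, ⟨fun h0 => ?_, e.injective (Subtype.ext ?_)⟩, fun b => ?_⟩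
      · rw [h0, map_zero] at heX
        rw [← heX] at htX
        have h4 : (r : ℂ) = 0 := by rw [← htX]; simp
        have h5 : r = 0 := by exact_mod_cast h4
        omega
      · rw [he, heX, hX3, ← two_smul ℂ, smul_smul]
        norm_num
      · cases b
        · rw [hf]
          exact Int.cast_natCast _
        · rw [htr, hf]
          exact Int.cast_natCast _

end Rectangular

/-! ### Skew-symmetric matrices -/

section SkewRel

variable {B : Type*} [Ring B] [StarRing B] [Algebra ℂ B] {n : ℕ}

/-- Triple relations between the skew-symmetric matrix units `eᵢⱼ - eⱼᵢ`. -/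
structure SkewRel (u : Fin n → Fin n → B) : Prop where
  skew : ∀ i j, u j i = -u i j
  self : ∀ {i j}, i ≠ j → u i j * star (u i j) * u i j = u i j
  collinear : ∀ {i j k}, i ≠ j → k ≠ j → i ≠ k →
    u i j * star (u i j) * u k j + u k j * star (u i j) * u i j = u k j
  orthogonal : ∀ {i j k l}, i ≠ j → k ≠ l → i ≠ k → i ≠ l → j ≠ k → j ≠ l →
    u i j * star (u i j) * u k l + u k l * star (u i j) * u i j = 0
  quadrangle : ∀ {i j k l}, i ≠ j → k ≠ l → i ≠ k → i ≠ l → j ≠ k → j ≠ l →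
    u i l * star (u k l) * u k j + u k j * star (u k l) * u i l = u i j

variable {u : Fin n → Fin n → B}

theorem SkewRel.star (h : SkewRel u) : SkewRel fun i j => star (u i j) where
  skew i j := by rw [h.skew i j, star_neg]
  self hij := by simpa [mul_assoc] using congrArg Star.star (h.self hij)
  collinear h1 h2 h3 := (add_comm _ _).trans
    (by simpa [mul_assoc] using congrArg Star.star (h.collinear h1 h2 h3))
  orthogonal h1 h2 h3 h4 h5 h6 := (add_comm _ _).trans
    (by simpa [mul_assoc] using congrArg Star.star (h.orthogonal h1 h2 h3 h4 h5 h6))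
  quadrangle h1 h2 h3 h4 h5 h6 := by
    simpa [mul_assoc, add_comm] using congrArg Star.star (h.quadrangle h1 h2 h3 h4 h5 h6)

theorem SkewRel.star_mul_eq_zero (h : SkewRel u) {i j k l : Fin n} (h1 : i ≠ j) (h2 : k ≠ l)
    (h3 : i ≠ k) (h4 : i ≠ l) (h5 : j ≠ k) (h6 : j ≠ l) : Star.star (u i j) * u k l = 0 :=
  star_mul_eq_zero_of_tri (h.self h1) (h.orthogonal h1 h2 h3 h4 h5 h6)

theorem SkewRel.mul_star_eq_zero (h : SkewRel u) {i j k l : Fin n} (h1 : i ≠ j) (h2 : k ≠ l)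
    (h3 : i ≠ k) (h4 : i ≠ l) (h5 : j ≠ k) (h6 : j ≠ l) : u i j * Star.star (u k l) = 0 := by
  simpa using h.star.star_mul_eq_zero h1 h2 h3 h4 h5 h6

/-- The transition product `uᵢₗ uₖₗ*` does not depend on `l`. -/
theorem SkewRel.mul_star_eq (h : SkewRel u) {i k l j : Fin n} (hik : i ≠ k) (hli : l ≠ i)
    (hlk : l ≠ k) (hji : j ≠ i) (hjk : j ≠ k) :
    u i l * Star.star (u k l) = u i j * Star.star (u k j) := by
  by_cases hjl : j = l
  · rw [hjl]
  have hlj := Ne.symm hjl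
  have hfh := h.collinear hlk hjk hlj
  rw [h.skew k l, h.skew k j] at hfh
  simp only [star_neg, neg_mul, mul_neg, neg_neg, ← neg_add, neg_inj] at hfh
  exact mul_star_eq_of_quadrangle (h.self hlk.symm) (h.self hjk.symm) hfh
    (h.quadrangle hji.symm hlk.symm hik hli.symm hjk hjl)
    (h.quadrangle hli.symm hjk.symm hik hji.symm hlk hlj)
    (h.mul_star_eq_zero hli.symm hjk.symm hik hji.symm hlk hlj)
    (h.mul_star_eq_zero hji.symm hlk.symm hik hli.symm hjk hjl)

theorem exists_ne_four (hn : 5 ≤ n) (a b c d : Fin n) :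
    ∃ k : Fin n, k ≠ a ∧ k ≠ b ∧ k ≠ c ∧ k ≠ d := by
  have h : ({a, b, c, d} : Finset (Fin n)).card < (Finset.univ : Finset (Fin n)).card := by
    rw [Finset.card_univ, Fintype.card_fin]
    exact lt_of_le_of_lt Finset.card_le_four (by omega)
  obtain ⟨k, -, hk⟩ := Finset.exists_mem_notMem_of_card_lt_card h
  simp only [Finset.mem_insert, Finset.mem_singleton, not_or] at hk
  exact ⟨k, hk⟩

/-- Transition products compose; this needs five indices. -/
theorem SkewRel.mul_mul (h : SkewRel u) (hn : 5 ≤ n) {i l m r s t : Fin n} (hil : i ≠ l)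
    (hlm : l ≠ m) (him : i ≠ m) (hri : r ≠ i) (hrl : r ≠ l) (hsl : s ≠ l) (hsm : s ≠ m)
    (hti : t ≠ i) (htm : t ≠ m) :
    u i r * Star.star (u l r) * (u l s * Star.star (u m s)) = u i t * Star.star (u m t) := by
  obtain ⟨k, hki, hkl, hkm, -⟩ := exists_ne_four hn i l m m
  obtain ⟨k', hki', hkl', hkm', hkk⟩ := exists_ne_four hn i l m k
  rw [h.mul_star_eq hil hri hrl hki hkl, h.mul_star_eq hlm hsl hsm hkl' hkm',
    h.mul_star_eq him hti htm hki' hkm', ← mul_assoc,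
    eq_sub_of_add_eq (h.quadrangle hki'.symm hkl.symm hil hki.symm hkl' hkk), sub_mul,
    mul_assoc (u l k' * _), h.mul_star_eq_zero hki.symm hkm'.symm him hki'.symm hkm hkk.symm]
  simp

/-- Transition products compose within words. -/
theorem SkewRel.mul_mul_unit (h : SkewRel u) (hn : 5 ≤ n) {i l m j r s : Fin n} (hil : i ≠ l)
    (hlm : l ≠ m) (hmj : m ≠ j) (hlj : l ≠ j) (hri : r ≠ i) (hrl : r ≠ l) (hsl : s ≠ l)
    (hsm : s ≠ m) :
    u i r * Star.star (u l r) * (u l s * Star.star (u m s) * u m j) =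
      u i r * Star.star (u l r) * u l j := by
  obtain ⟨k, hki, hkl, hkm, hkj⟩ := exists_ne_four hn i l m j
  obtain ⟨k', hkl', hkm', hkj', -⟩ := exists_ne_four hn l m j j
  have h1 : Star.star (u l k) * u m j = 0 :=
    h.star_mul_eq_zero hkl.symm hmj hlm hlj hkm hkj
  rw [h.mul_star_eq hil hri hrl hki hkl, h.mul_star_eq hlm hsl hsm hkl' hkm',
    eq_sub_of_add_eq (h.quadrangle hlj hkm'.symm hlm hkl'.symm hmj.symm hkj'.symm), mul_sub,
    sub_eq_self]
  simp only [mul_assoc]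
  rw [← mul_assoc _ (u m j), h1]
  simp

/-- The word `uᵢₖ uₗₖ* uₗⱼ` depends on `i` and `j` only. -/
theorem SkewRel.word_eq (h : SkewRel u) (hn : 5 ≤ n) {i j l k l' k' : Fin n} (hli : l ≠ i)
    (hlj : l ≠ j) (hki : k ≠ i) (hkl : k ≠ l) (hli' : l' ≠ i) (hlj' : l' ≠ j) (hki' : k' ≠ i)
    (hkl' : k' ≠ l') :
    u i k * Star.star (u l k) * u l j = u i k' * Star.star (u l' k') * u l' j := by
  by_cases hll : l = l'
  · subst hll
    rw [h.mul_star_eq hli.symm hki hkl hki' hkl']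
  · obtain ⟨s, hsl, hsl', -⟩ := exists_ne_four hn l l' l' l'
    rw [← h.mul_mul hn hli.symm hll hli'.symm hki hkl hsl hsl' hki' hkl', mul_assoc _ _ (u l' j),
      h.mul_mul_unit hn hli.symm hll hlj' hlj hki hkl hsl hsl']

theorem SkewRel.exists_word (h : SkewRel u) (hn : 5 ≤ n) (i j : Fin n) :
    ∃ w, ∀ l k, l ≠ i → l ≠ j → k ≠ i → k ≠ l → w = u i k * Star.star (u l k) * u l j := by
  obtain ⟨l, hli, hlj, -⟩ := exists_ne_four hn i j j j
  obtain ⟨k, hki, hkl, -⟩ := exists_ne_four hn i l l l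
  exact ⟨_, fun l' k' h1 h2 h3 h4 => h.word_eq hn hli hlj hki hkl h1 h2 h3 h4⟩

/-- Words with different first indices have orthogonal ranges. -/
theorem SkewRel.star_word_mul_word (h : SkewRel u) (hn : 5 ≤ n) {i j k l : Fin n} (hik : i ≠ k)
    {x y : B}
    (hx : ∀ l k, l ≠ i → l ≠ j → k ≠ i → k ≠ l → x = u i k * Star.star (u l k) * u l j)
    (hy : ∀ p q, p ≠ k → p ≠ l → q ≠ k → q ≠ p → y = u k q * Star.star (u p q) * u p l) :
    Star.star x * y = 0 := by
  obtain ⟨p, hpi, hpj, -⟩ := exists_ne_four hn i j j j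
  obtain ⟨q, hqk, hql, -⟩ := exists_ne_four hn k l l l
  obtain ⟨r, hrp, hri, hrk, -⟩ := exists_ne_four hn p i k k
  obtain ⟨s, hsk, hsq, hsi, hsr⟩ := exists_ne_four hn k q i r
  rw [hx p r hpi hpj hri hrp, hy q s hqk hql hsk hsq]
  simp only [star_mul, star_star, mul_assoc]
  rw [← mul_assoc _ (u k s), h.star_mul_eq_zero hri.symm hsk.symm hik hsi.symm hrk hsr.symm]
  simp

/-- With at least five indices, elements with the triple relations of the skew-symmetric matrix units
are the differences `Eᵢⱼ - Eⱼᵢ` of matrix units, namely of the words `Eᵢⱼ = uᵢₖ uₗₖ* uₗⱼ`. -/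
theorem SkewRel.exists_units (h : SkewRel u) (hn : 5 ≤ n) :
    ∃ E : Fin n → Fin n → B, IsUnits E ∧ ∀ i j, i ≠ j → E i j - E j i = u i j := by
  choose E hE using h.exists_word hn
  choose F hF using h.star.exists_word hn
  -- the adjoints satisfy the same relations, which exchanges left and right in the arguments below
  have hEF : ∀ i j, Star.star (E j i) = -F i j := by
    intro i j
    obtain ⟨l, hli, hlj, -⟩ := exists_ne_four hn i j j j
    obtain ⟨k, hki, hkj, hkl, -⟩ := exists_ne_four hn i j l l
    rw [hE j i l k hlj hli hkj hkl, hF i j k l hki hkj hli hkl.symm]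
    simp only [star_mul, star_star, ← mul_assoc]
    rw [h.skew i l, h.skew k l, h.skew k j]
    simp
  have hB : ∀ {i k} j l, i ≠ k → Star.star (E i j) * E k l = 0 := fun j l hik =>
    h.star_word_mul_word hn hik (hE _ j) (hE _ l)
  have hA : ∀ i k {j l}, j ≠ l → E i j * Star.star (E k l) = 0 := by
    intro i k j l hjl
    have h1 := h.star.star_word_mul_word hn hjl (hF j i) (hF l k)
    have h2 : E i j = -Star.star (F j i) := by
      rw [← star_neg, ← hEF, star_star]
    rw [h2, hEF, neg_mul_neg, h1]
  have hC1 : ∀ {a c} b l, a ≠ c → E a b * Star.star (E c b) * E c l = E a l := by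
    intro a c b l hac
    obtain ⟨p, hpa, hpb, hpc, -⟩ := exists_ne_four hn a b c c
    obtain ⟨q, hqa, hql, hqc, -⟩ := exists_ne_four hn a l c c
    obtain ⟨r, hra, hrp, hrc, hrb⟩ := exists_ne_four hn a p c b
    obtain ⟨t, hta, htc, htq, -⟩ := exists_ne_four hn a c q q
    have h1 : E a b * Star.star (E c b) = u a t * Star.star (u c t) := by
      rw [hE a b p r hpa hpb hra hrp, hE c b p r hpc hpb hrc hrp]
      simp only [star_mul, star_star]
      have h2 : u a r * Star.star (u p r) * u p b * (Star.star (u p b) *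
          (u p r * Star.star (u c r))) = u a r * Star.star (u p r) * (u p r * Star.star (u c r)) := by
        have h3 := h.self hpb
        by_cases hab : a = b
        · have hcb : c ≠ b := fun h' => hac (hab.trans h'.symm)
          rw [h.mul_star_eq hpc hrp hrc hpb.symm hcb.symm]
          conv_rhs => rw [← h3]
          simp only [mul_assoc]
        · have h4 := congrArg Star.star h3
          simp only [star_mul, star_star] at h4
          rw [h.mul_star_eq hpa.symm hra hrp (Ne.symm hab) hpb.symm]
          conv_rhs => rw [← h4]
          simp only [mul_assoc]
      rw [h2, h.mul_mul hn hpa.symm hpc hac hra hrp hrp hrc hta htc]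
    rw [h1, hE c l q t hqc hql htc htq, hE a l q t hqa hql hta htq, ← mul_assoc, ← mul_assoc,
      mul_assoc _ (u c t), h.mul_mul hn hac hqc.symm hqa.symm hta htc htc htq hta htq]
  have hC : ∀ a c b l, E a b * Star.star (E c b) * E c l = E a l := by
    intro a c b l
    by_cases hac : a = c
    · subst hac
      obtain ⟨c, hca, -⟩ := exists_ne_four hn a a a a
      have h1 : E a b * Star.star (E a b) * E a b = E a b := by
        have h2 := hC1 b b hca
        have h3 := hC1 b b hca.symm
        calc E a b * Star.star (E a b) * E a b
            = E a b * Star.star (E c b) * E c b * Star.star (E a b) * E a b := by rw [h3]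
          _ = E a b * Star.star (E c b) * (E c b * Star.star (E a b) * E a b) := by
            simp only [mul_assoc]
          _ = E a b := by rw [h2, h3]
      rw [← hC1 b l hca.symm, ← mul_assoc, ← mul_assoc, h1]
    · exact hC1 b l hac
  refine ⟨E, ?_, fun i j hij => ?_⟩
  · intro a b c d k l
    by_cases hbd : b = d
    · subst hbd
      by_cases hck : c = k
      · subst hck
        simp [hC]
      · rw [mul_assoc, hB _ _ hck]
        simp [hck]
    · rw [hA _ _ hbd]
      simp [hbd]
  · obtain ⟨l, hli, hlj, -⟩ := exists_ne_four hn i j j j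
    obtain ⟨k, hki, hkj, hkl, -⟩ := exists_ne_four hn i j l l
    rw [hE i j l k hli hlj hki hkl, hE j i k l hkj hki hlj hkl.symm,
      ← h.quadrangle hij hkl.symm hli.symm hki.symm hlj.symm hkj.symm, h.skew l j, h.skew l k,
      h.skew i k]
    simp

end SkewRel

section Skew

variable {Z : Type u} [NormedAddCommGroup Z] [NormedSpace ℂ Z] [CompleteSpace Z] [JBStarTriple Z]
  {n : ℕ}

theorem mem_C2 {X : Matrix (Fin n) (Fin n) ℂ} : X ∈ C2 n ↔ Xᵀ = -X := Iff.rfl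

/-- The skew-symmetric matrix units. -/
def skewSingle (i j : Fin n) : Matrix (Fin n) (Fin n) ℂ :=
  Matrix.single i j 1 - Matrix.single j i 1

theorem skewSingle_mem (i j : Fin n) : skewSingle i j ∈ C2 n := by
  simp [mem_C2, skewSingle]

/-- The triple relations of the images of the skew-symmetric matrix units under a triple map. -/
theorem skewRel_of_tripleOn {B : Type*} [Ring B] [StarRing B] [Algebra ℂ B]
    (Ψ : Matrix (Fin n) (Fin n) ℂ →ₗ[ℂ] B) (hΨ : IsTripleOn (C2 n) Ψ) :
    SkewRel fun i j => Ψ (skewSingle i j) where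
  skew i j := by
    rw [← map_neg]
    simp [skewSingle]
  self {i j} h := by
    have := hΨ _ (skewSingle_mem i j) _ (skewSingle_mem i j) _ (skewSingle_mem i j)
    have h1 : skewSingle i j * (skewSingle i j)ᴴ * skewSingle i j = skewSingle i j := by
      simp [skewSingle, sub_mul, mul_sub, add_mul, h, h.symm]
    rw [h1, map_add] at this
    exact (add_self_cancel this).symm
  collinear {i j k} h1 h2 h3 := by
    rw [← hΨ _ (skewSingle_mem i j) _ (skewSingle_mem i j) _ (skewSingle_mem k j)]
    congr 1
    simp [skewSingle, sub_mul, mul_sub, add_mul, h1, h2, h3, h1.symm, h2.symm, h3.symm]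
    abel
  orthogonal {i j k l} h1 h2 h3 h4 h5 h6 := by
    rw [← hΨ _ (skewSingle_mem i j) _ (skewSingle_mem i j) _ (skewSingle_mem k l),
      ← map_zero Ψ]
    congr 1
    simp [skewSingle, sub_mul, mul_sub, add_mul, h1, h2, h3, h4, h5, h6, h1.symm, h2.symm, h3.symm,
      h4.symm, h5.symm, h6.symm]
  quadrangle {i j k l} h1 h2 h3 h4 h5 h6 := by
    rw [← hΨ _ (skewSingle_mem i l) _ (skewSingle_mem k l) _ (skewSingle_mem k j)]
    congr 1
    simp [skewSingle, sub_mul, mul_sub, add_mul, h1, h2, h3, h4, h5, h6, h1.symm, h2.symm, h3.symm,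
      h4.symm, h5.symm, h6.symm]
    abel

/-- Triple maps on the skew-symmetric matrices of size at least five extend to all matrices. -/
theorem exists_ternary_of_skew {B : Type*} [Ring B] [StarRing B] [Algebra ℂ B] [StarModule ℂ B]
    (hn : 5 ≤ n) (Ψ : Matrix (Fin n) (Fin n) ℂ →ₗ[ℂ] B) (hΨ : IsTripleOn (C2 n) Ψ) :
    ∃ f : Matrix (Fin n) (Fin n) ℂ →ₗ[ℂ] B,
      (∀ X Y V, f (X * Yᴴ * V) = f X * star (f Y) * f V) ∧ ∀ X ∈ C2 n, f X = Ψ X := by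
  obtain ⟨E, hE, hEu⟩ := (skewRel_of_tripleOn Ψ hΨ).exists_units hn
  have hEu' : ∀ i j, E i j - E j i = Ψ (skewSingle i j) := by
    intro i j
    by_cases hij : i = j
    · subst hij
      simp [skewSingle]
    · exact hEu i j hij
  refine ⟨unitsMap E, hE.ternary, fun X hX => ?_⟩
  -- summing over all pairs of indices counts each entry twice
  have h1 : X + X = ∑ i, ∑ j, X i j • skewSingle i j := by
    have h2 : X = ∑ i, ∑ j, X j i • Matrix.single j i (1 : ℂ) := by
      rw [Finset.sum_comm]
      conv_lhs => rw [Matrix.matrix_eq_sum_single X]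
      simp
    have h3 : X = ∑ i, ∑ j, X i j • Matrix.single i j (1 : ℂ) := by
      conv_lhs => rw [Matrix.matrix_eq_sum_single X]
      simp
    have h4 : ∀ i j, X i j = -X j i := fun i j => congrFun (congrFun hX j) i
    conv_lhs => rw [h3]
    conv_lhs =>
      rhs
      rw [← h3, h2]
    simp only [← Finset.sum_add_distrib]
    refine Finset.sum_congr rfl fun i _ => Finset.sum_congr rfl fun j _ => ?_
    rw [h4 j i, neg_smul, skewSingle, smul_sub, sub_eq_add_neg]
  have h5 : unitsMap E X = ∑ i, ∑ j, X j i • E j i := by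
    rw [Finset.sum_comm]
    rfl
  have h6 : unitsMap E X + unitsMap E X = Ψ X + Ψ X := by
    conv_lhs =>
      rhs
      rw [h5]
    have h4 : ∀ i j, X i j = -X j i := fun i j => congrFun (congrFun hX j) i
    rw [← map_add Ψ, h1, unitsMap_apply]
    simp only [map_sum, map_smul, ← hEu', ← Finset.sum_add_distrib]
    refine Finset.sum_congr rfl fun i _ => Finset.sum_congr rfl fun j _ => ?_
    rw [h4 j i, neg_smul, smul_sub, sub_eq_add_neg]
  exact add_self_cancel h6

/-- The skew-symmetric matrices generate all matrices, since
`(eᵢₖ - eₖᵢ) (eₗₖ - eₖₗ)* (eₗⱼ - eⱼₗ) = eᵢⱼ` for suitable `k` and `l`. -/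
theorem isModel_C2 (hn : 5 ≤ n) (e : Z ≃ₗ[ℂ] C2 n)
    (he : ∀ x y z, (e (tri x y z) : Matrix (Fin n) (Fin n) ℂ) =
      (1 / 2 : ℂ) • ((e x : Matrix (Fin n) (Fin n) ℂ) * (e y : Matrix (Fin n) (Fin n) ℂ)ᴴ *
          (e z : Matrix (Fin n) (Fin n) ℂ)
        + (e z : Matrix (Fin n) (Fin n) ℂ) * (e y : Matrix (Fin n) (Fin n) ℂ)ᴴ *
          (e x : Matrix (Fin n) (Fin n) ℂ))) :
    IsModel (oneBlock e) where
  triple x y z _ := he x y z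
  generates S hS hρ := by
    have hmem : ∀ X ∈ C2 n, (fun _ => X) ∈ S := by
      intro X hX
      have := hρ (e.symm ⟨X, hX⟩)
      have h : oneBlock e (e.symm ⟨X, hX⟩) = fun _ => X := by
        ext i : 1
        simp [oneBlock_apply]
      rwa [h] at this
    refine eq_top_of_single_mem S fun _ i j => ?_
    obtain ⟨l, hli, hlj, -⟩ := exists_ne_four hn i j j j
    obtain ⟨k, hki, hkl, -⟩ := exists_ne_four hn i l l l
    have := hS _ (hmem _ (skewSingle_mem i k)) _ (hmem _ (skewSingle_mem l k))
      _ (hmem _ (skewSingle_mem l j))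
    convert this using 1
    funext b
    obtain rfl : b = () := rfl
    rw [Pi.single_eq_same]
    simp [skewSingle, sub_mul, mul_sub, add_mul, hli, hlj, hki, hkl, hli.symm, hlj.symm, hki.symm, hkl.symm]

/-- A skew-symmetric matrix is determined by its entries above the diagonal. -/
theorem five_le_of_finrank_C2 (h : 10 ≤ Module.finrank ℂ (C2 n)) : 5 ≤ n := by
  by_contra hn
  let f : C2 n →ₗ[ℂ] ({p : Fin n × Fin n // p.1 < p.2} → ℂ) :=
    LinearMap.pi fun p => Matrix.entryLinearMap ℂ ℂ p.1.1 p.1.2 ∘ₗ (C2 n).subtype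
  have hf : Function.Injective f := by
    rw [← LinearMap.ker_eq_bot, LinearMap.ker_eq_bot']
    rintro ⟨X, hX⟩ h0
    have h1 : ∀ i j, i < j → X i j = 0 := fun i j hij => congrFun h0 ⟨(i, j), hij⟩
    have h4 : ∀ i j, X i j = -X j i := fun i j => congrFun (congrFun hX j) i
    refine Subtype.ext (Matrix.ext fun i j => ?_)
    rcases lt_trichotomy i j with hij | hij | hij
    · exact h1 i j hij
    · subst hij
      exact self_eq_neg.1 (h4 i i)
    · change X i j = 0
      rw [h4, h1 j i hij, neg_zero]
  have h2 := LinearMap.finrank_le_finrank_of_injective hf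
  rw [Module.finrank_fintype_fun_eq_card] at h2
  have h3 : Fintype.card {p : Fin n × Fin n // p.1 < p.2} < 10 := by
    have h4 : n ≤ 4 := by omega
    clear h h2 hf f hn
    interval_cases n <;> decide
  omega

/-- The projections `X X*` of skew-symmetric partial isometries have even rank, since compressing
`X` gives an invertible skew-symmetric matrix. -/
theorem even_of_skew {X : Matrix (Fin n) (Fin n) ℂ} (hX : Xᵀ = -X) (h : X * Xᴴ * X = X) {r : ℕ}
    (hr : (X * Xᴴ).trace = r) : Even r := by
  have hp : IsStarProjection (X * Xᴴ) := by
    refine ⟨?_, ?_⟩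
    · rw [IsIdempotentElem, ← Matrix.mul_assoc, h]
    · rw [IsSelfAdjoint, Matrix.star_eq_conjTranspose]
      simp
  have hrk : (X * Xᴴ).rank = r := by
    have := (trace_eq_rank_of_isStarProjection hp).symm.trans hr
    exact_mod_cast this
  obtain ⟨v, hv1, hv2⟩ := exists_isometry_of_isStarProjection hp
  subst hrk
  -- the compression of `X` by `v`; the transpose keeps it skew-symmetric
  set Y := vᴴ * X * vᴴᵀ with hY
  have hYt : Yᵀ = -Y := by
    rw [hY, Matrix.transpose_mul, Matrix.transpose_mul, hX, Matrix.transpose_transpose]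
    simp [Matrix.mul_assoc]
  have hvv : vᴴᵀ * vᴴᵀᴴ = Xᴴ * X := by
    have h1 : vᴴᵀ * vᴴᵀᴴ = (v * vᴴ)ᵀ := by
      rw [Matrix.transpose_mul]
      congr 1
      ext
      simp
    have h2 : Xᴴᵀ = -Xᴴ := by
      have : Xᴴᵀ = Xᵀᴴ := rfl
      rw [this, hX, Matrix.conjTranspose_neg]
    rw [h1, hv1, Matrix.transpose_mul, h2, hX, neg_mul_neg]
  have hYY : Y * Yᴴ = 1 := by
    have h1 : Y * Yᴴ = vᴴ * X * (vᴴᵀ * vᴴᵀᴴ) * Xᴴ * v := by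
      rw [hY]
      simp only [Matrix.conjTranspose_mul, Matrix.conjTranspose_conjTranspose, Matrix.mul_assoc]
    have h2 : vᴴ * X * (Xᴴ * X) * Xᴴ * v = vᴴ * (X * Xᴴ) * (X * Xᴴ) * v := by
      simp only [Matrix.mul_assoc]
    have h3 : ∀ P, v * vᴴ = P → vᴴ * P * P * v = 1 := by
      rintro _ rfl
      have h4 : vᴴ * (v * vᴴ) * (v * vᴴ) * v = vᴴ * v * (vᴴ * v) * (vᴴ * v) := by
        simp only [Matrix.mul_assoc]
      rw [h4, hv2, Matrix.one_mul, Matrix.one_mul]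
    rw [h1, hvv, h2, h3 _ hv1]
  have hdet : Y.det ≠ 0 := by
    intro h0
    have := congrArg Matrix.det hYY
    rw [Matrix.det_mul, h0, zero_mul, Matrix.det_one] at this
    exact zero_ne_one this
  have h1 : Y.det = (-1) ^ (X * Xᴴ).rank * Y.det := by
    conv_lhs => rw [← Matrix.det_transpose, hYt, Matrix.det_neg, Fintype.card_fin]
  by_contra hodd
  rw [Nat.not_even_iff_odd] at hodd
  rw [hodd.neg_one_pow, neg_one_mul] at h1
  exact hdet (self_eq_neg.1 h1)

/-- The skew-symmetric partial isometry with blocks `(0, 1; -1, 0)` in the first `r` rows. -/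
theorem exists_skew_tripotent {r : ℕ} (hr : Even r) (hrn : r ≤ n) :
    ∃ X : Matrix (Fin n) (Fin n) ℂ, Xᵀ = -X ∧ X * Xᴴ * X = X ∧ (X * Xᴴ).trace = r := by
  let σ : ℕ → ℕ := fun i => if i % 2 = 0 then i + 1 else i - 1
  let s : ℕ → ℂ := fun i => if i % 2 = 0 then 1 else -1
  have hσ : ∀ i, σ (σ i) = i := by
    intro i
    simp only [σ]
    split_ifs <;> omega
  have hσr : ∀ i, i < r → σ i < r := by
    intro i hi
    obtain ⟨t, rfl⟩ := hr
    simp only [σ]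
    split_ifs <;> omega
  have hs : ∀ i, s (σ i) = -s i := by
    intro i
    simp only [σ, s]
    split_ifs <;> first | omega | simp
  have hss : ∀ i, s i * star (s i) = 1 := by
    intro i
    simp only [s]
    split_ifs <;> simp
  let X : Matrix (Fin n) (Fin n) ℂ :=
    Matrix.of fun i j => if (i : ℕ) < r ∧ (j : ℕ) = σ i then s i else 0
  have hXX : X * Xᴴ = Matrix.diagonal fun i : Fin n => if (i : ℕ) < r then 1 else 0 := by
    ext i k
    rw [Matrix.mul_apply, Matrix.diagonal_apply]
    by_cases hi : (i : ℕ) < r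
    · rw [Finset.sum_eq_single ⟨σ i, (hσr i hi).trans_le hrn⟩]
      · by_cases hik : i = k
        · subst hik
          simpa [X, hi] using hss i
        · have : ¬ σ i = σ k := fun h => hik (Fin.ext (by rw [← hσ i, h, hσ]))
          simp [X, hik, this]
      · intro j _ hj
        have : ¬ (j : ℕ) = σ i := fun h => hj (Fin.ext h)
        simp [X, this]
      · simp
    · simp [X, hi]
  refine ⟨X, ?_, ?_, ?_⟩
  · ext i j
    simp only [X, Matrix.transpose_apply, Matrix.neg_apply, Matrix.of_apply]
    by_cases hij : (i : ℕ) = σ j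
    · have hji : (j : ℕ) = σ i := by rw [hij, hσ]
      by_cases hj : (j : ℕ) < r
      · have hi : (i : ℕ) < r := by
          rw [hij]
          exact hσr _ hj
        rw [if_pos ⟨hj, hij⟩, if_pos ⟨hi, hji⟩, hji, hs]
      · have hi : ¬ (i : ℕ) < r := fun h => hj (by
          rw [hji]
          exact hσr _ h)
        simp [hi, hj]
    · have hji : ¬ (j : ℕ) = σ i := fun h => hij (by rw [h, hσ])
      simp [hij, hji]
  · rw [hXX]
    ext i j
    rw [Matrix.diagonal_mul]
    by_cases hi : (i : ℕ) < r <;> simp [X, hi]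
  · rw [hXX, Matrix.trace_diagonal]
    exact sum_fin_ite_lt hrn

/-- Skew-symmetric matrices of size at least five: the tripotents have even rank, and every even rank
occurs. -/
theorem hasInvariant_C2 (hd : 10 ≤ Module.finrank ℂ Z) (hZ : IsoToMatrices Z (C2 n)) :
    HasInvariant.{u, v, w} Z (Set.Ici (0 : ℤ)) (Set.Icc (0 : ℤ) n) (Set.Icc (0 : ℤ) n)
        {x : ℤ | Even x ∧ 2 ≤ x ∧ x ≤ n} := by
  obtain ⟨e, he⟩ := hZ
  have hn : 5 ≤ n := five_le_of_finrank_C2 (by rwa [← e.finrank_eq])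
  have : Nonempty (Fin n) := ⟨⟨0, by omega⟩⟩
  have hm := isModel_C2 hn e he
  refine hm.hasInvariant
    (hasLift_oneBlock e he fun E _ _ _ Ψ hΨ => exists_ternary_of_skew hn Ψ hΨ)
    (hasLift_oneBlock e he fun E _ _ _ Ψ hΨ => exists_ternary_of_skew hn Ψ hΨ)
    unitEquiv (unitEquiv_image fun y => ?_) (unitEquiv_image fun y => ?_)
    (unitEquiv_image fun y => ?_) (unitEquiv_image fun y => ?_)
  · simp
  · simp
  · simp
  · constructor
    · rintro ⟨g, hg, hy⟩
      obtain ⟨r, h1, h2, -, h3⟩ := exists_nat_trace (hm.tripotent hg.2 ())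
      have hyr : y = r := by
        have := (hy ()).trans h1
        exact_mod_cast this
      have hr : r ≠ 0 := by
        intro h0
        refine hg.1 (e.injective (Subtype.ext ?_))
        rw [map_zero]
        exact h3 h0
      have he : Even r := even_of_skew (e g).2 (hm.tripotent hg.2 ()) h1
      rw [Fintype.card_fin] at h2
      obtain ⟨t, rfl⟩ := he
      rw [hyr]
      exact ⟨⟨t, by push_cast; ring⟩, by omega, by omega⟩
    · rintro ⟨⟨t, ht⟩, h1, h2⟩
      obtain ⟨X, hX, hX3, htX⟩ := exists_skew_tripotent (n := n) (r := y.toNat)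
        ⟨t.toNat, by omega⟩ (by omega)
      have heX : (e (e.symm ⟨X, hX⟩) : Matrix (Fin n) (Fin n) ℂ) = X := by simp
      refine ⟨e.symm ⟨X, hX⟩, ⟨fun h0 => ?_, e.injective (Subtype.ext ?_)⟩, fun i => ?_⟩
      · rw [h0, map_zero] at heX
        rw [← heX] at htX
        have h4 : (y.toNat : ℂ) = 0 := by rw [← htX]; simp
        have h5 : y.toNat = 0 := by exact_mod_cast h4
        omega
      · rw [he, heX, hX3, ← two_smul ℂ, smul_smul]
        norm_num
      · rw [oneBlock_apply, heX, htX]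
        have h3 : y = (y.toNat : ℤ) := by omega
        conv_lhs => rw [h3]
        exact Int.cast_natCast _

end Skew

/-! ### Lifts by counting dimensions -/

section Small

variable {I : Type} [Fintype I] [DecidableEq I] {n m : I → Type} [∀ i, Fintype (n i)]
  [∀ i, DecidableEq (n i)] [∀ i, Fintype (m i)] [∀ i, DecidableEq (m i)]
  {Z : Type u} [NormedAddCommGroup Z] [NormedSpace ℂ Z] [CompleteSpace Z] [JBStarTriple Z]

variable (Z) in
/-- The image of a triple map of `Z` into a star algebra always lies in a subspace of dimension at
most `d` that is closed under the ternary product. -/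
def GeneratesSmall (d : ℕ) : Prop :=
  ∀ (A : Type w) [Ring A] [StarRing A] [Algebra ℂ A] [StarModule ℂ A] (ψ : Z →ₗ[ℂ] A),
    IsTripleMap ψ → ∃ W : Submodule ℂ A, FiniteDimensional ℂ W ∧ Module.finrank ℂ W ≤ d ∧
      (∀ x ∈ W, ∀ y ∈ W, ∀ z ∈ W, x * star y * z ∈ W) ∧ ∀ z, ψ z ∈ W

variable (n m) in
/-- A product of spaces of matrices as the upper right corner of a star algebra. -/
def cornerEmb : Rect n m →ₗ[ℂ] ∀ i, Matrix (n i ⊕ m i) (n i ⊕ m i) ℂ where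
  toFun X i := Matrix.fromBlocks 0 (X i) 0 0
  map_add' X Y := by
    funext i
    simp [Matrix.fromBlocks_add]
  map_smul' c X := by
    funext i
    simp [Matrix.fromBlocks_smul]

theorem cornerEmb_ternary (X Y V : Rect n m) : cornerEmb n m (fun i => X i * (Y i)ᴴ * V i) =
    cornerEmb n m X * star (cornerEmb n m Y) * cornerEmb n m V := by
  funext i
  simp [cornerEmb, Matrix.star_eq_conjTranspose, Matrix.fromBlocks_conjTranspose,
    Matrix.fromBlocks_multiply]

theorem cornerEmb_injective : Function.Injective (cornerEmb n m) := by
  intro X Y h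
  funext i
  exact (Matrix.fromBlocks_inj.1 (congrFun h i)).2.1

/-- If all ternary subspaces generated by images of `Z` are at most as large as a model, then
homomorphisms lift to the model: the subspace generated by the graph projects bijectively onto
the model. -/
theorem IsModel.hasLift_of_generatesSmall {ρ : Z →ₗ[ℂ] Rect n m} (h : IsModel ρ)
    (hs : GeneratesSmall.{u, w} Z (Module.finrank ℂ (Rect n m))) : HasLift.{u, w} ρ := by
  intro E _ _ _ φ hφ
  let ψ : Z →ₗ[ℂ] (∀ i, Matrix (n i ⊕ m i) (n i ⊕ m i) ℂ) × (E →L[ℂ] E) :=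
    (cornerEmb n m ∘ₗ ρ).prod φ
  have hψ : IsTripleMap ψ := by
    intro x y z
    refine Prod.ext ?_ (hφ x y z)
    change cornerEmb n m (ρ (tri x y z)) = (1 / 2 : ℂ) •
      (cornerEmb n m (ρ x) * star (cornerEmb n m (ρ y)) * cornerEmb n m (ρ z) +
      cornerEmb n m (ρ z) * star (cornerEmb n m (ρ y)) * cornerEmb n m (ρ x))
    rw [← cornerEmb_ternary, ← cornerEmb_ternary, ← map_add, ← map_smul]
    congr 1
    funext i
    exact h.triple x y z i
  obtain ⟨W, hW1, hW2, hW3, hW4⟩ := hs _ ψ hψ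
  let j : Rect n m × (E →L[ℂ] E) →ₗ[ℂ] (∀ i, Matrix (n i ⊕ m i) (n i ⊕ m i) ℂ) × (E →L[ℂ] E) :=
    (cornerEmb n m).prodMap LinearMap.id
  have hj : Function.Injective j := by
    rintro ⟨X, x⟩ ⟨Y, y⟩ hXY
    obtain ⟨h1, h2⟩ := Prod.ext_iff.1 hXY
    exact Prod.ext (cornerEmb_injective h1) h2
  -- the ternary subspace that the graph of `φ` over `ρ` generates
  let G := W.comap j
  let jG : G →ₗ[ℂ] W := (j ∘ₗ G.subtype).codRestrict W fun x => x.2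
  have hjG : Function.Injective jG := by
    intro x y hxy
    exact Subtype.ext (hj (congrArg Subtype.val hxy))
  have : FiniteDimensional ℂ G := FiniteDimensional.of_injective jG hjG
  have hG : ∀ x ∈ G, ∀ y ∈ G, ∀ z ∈ G,
      ((fun i => x.1 i * (y.1 i)ᴴ * z.1 i, x.2 * star y.2 * z.2) :
        Rect n m × (E →L[ℂ] E)) ∈ G := by
    intro x hx y hy z hz
    have h1 := hW3 _ hx _ hy _ hz
    change j _ ∈ W
    convert h1 using 1
    exact Prod.ext (cornerEmb_ternary _ _ _) rfl
  let f1 : G →ₗ[ℂ] Rect n m := LinearMap.fst ℂ _ _ ∘ₗ G.subtype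
  have hsurj : Function.Surjective f1 := by
    rw [← LinearMap.range_eq_top]
    refine h.generates _ ?_ fun z => ⟨⟨(ρ z, φ z), hW4 z⟩, rfl⟩
    rintro _ ⟨x, rfl⟩ _ ⟨y, rfl⟩ _ ⟨z, rfl⟩
    exact ⟨⟨_, hG x x.2 y y.2 z z.2⟩, rfl⟩
  have hdim : Module.finrank ℂ G = Module.finrank ℂ (Rect n m) :=
    le_antisymm ((LinearMap.finrank_le_finrank_of_injective hjG).trans hW2)
      (LinearMap.finrank_le_finrank_of_surjective hsurj)
  have hinj : Function.Injective f1 :=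
    (LinearMap.injective_iff_surjective_of_finrank_eq_finrank hdim).2 hsurj
  let F := LinearEquiv.ofBijective f1 ⟨hinj, hsurj⟩
  have hF : ∀ x : G, F.symm x.1.1 = x := fun x => F.symm_apply_apply x
  refine ⟨LinearMap.snd ℂ _ _ ∘ₗ G.subtype ∘ₗ F.symm.toLinearMap, fun X Y V => ?_, fun z => ?_⟩
  · obtain ⟨x, rfl⟩ := F.surjective X
    obtain ⟨y, rfl⟩ := F.surjective Y
    obtain ⟨z, rfl⟩ := F.surjective V
    have h1 := hF ⟨_, hG x x.2 y y.2 z z.2⟩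
    have h2 : (fun i => F x i * (F y i)ᴴ * F z i) =
      fun i => (x : Rect n m × (E →L[ℂ] E)).1 i * ((y : Rect n m × (E →L[ℂ] E)).1 i)ᴴ *
        (z : Rect n m × (E →L[ℂ] E)).1 i := rfl
    simp only [LinearMap.comp_apply, LinearEquiv.coe_coe, LinearEquiv.symm_apply_apply, h2]
    exact congrArg (fun g : G => g.1.2) h1
  · exact congrArg (fun g : G => g.1.2) (hF ⟨(ρ z, φ z), hW4 z⟩)

end Small

/-! ### Clifford relations -/

section Clifford

variable {A : Type*} [Ring A] [StarRing A] [Algebra ℂ A] [StarModule ℂ A]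

/-- The span of the ordered monomials in the first `j` generators, with unit `p`. -/
def cliffordSpan (p : A) (c : ℕ → A) : ℕ → Submodule ℂ A
  | 0 => ℂ ∙ p
  | j + 1 => cliffordSpan p c j ⊔ (cliffordSpan p c j).map (LinearMap.mulRight ℂ (c j))

theorem finiteDimensional_cliffordSpan (p : A) (c : ℕ → A) (j : ℕ) :
    FiniteDimensional ℂ (cliffordSpan p c j) := by
  induction j with
  | zero => exact inferInstanceAs (FiniteDimensional ℂ (ℂ ∙ p))
  | succ j ih => exact Submodule.finiteDimensional_sup _ _

/-- There are `2 ^ j` ordered monomials in `j` generators. -/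
theorem finrank_cliffordSpan_le (p : A) (c : ℕ → A) (j : ℕ) :
    Module.finrank ℂ (cliffordSpan p c j) ≤ 2 ^ j := by
  induction j with
  | zero =>
    refine (finrank_span_le_card ({p} : Set A)).trans ?_
    simp
  | succ j ih =>
    have := finiteDimensional_cliffordSpan p c j
    refine (Submodule.finrank_add_le_finrank_add_finrank _ _).trans ?_
    have := Submodule.finrank_map_le (LinearMap.mulRight ℂ (c j)) (cliffordSpan p c j)
    rw [pow_succ]
    omega

theorem cliffordSpan_mono (p : A) (c : ℕ → A) {i j : ℕ} (h : i ≤ j) :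
    cliffordSpan p c i ≤ cliffordSpan p c j := by
  induction j, h using Nat.le_induction with
  | base => exact le_rfl
  | succ j _ ih => exact ih.trans le_sup_left

theorem mem_cliffordSpan_succ {p : A} {c : ℕ → A} {j : ℕ} {x : A} :
    x ∈ cliffordSpan p c (j + 1) ↔
      ∃ y ∈ cliffordSpan p c j, ∃ z ∈ cliffordSpan p c j, y + z * c j = x := by
  rw [cliffordSpan, Submodule.mem_sup]
  constructor
  · rintro ⟨y, hy, _, ⟨z, hz, rfl⟩, rfl⟩
    exact ⟨y, hy, z, hz, rfl⟩
  · rintro ⟨y, hy, z, hz, rfl⟩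
    exact ⟨y, hy, _, ⟨z, hz, rfl⟩, rfl⟩

/-- Self-adjoint generators `c 0, …, c (k - 1)` of a Clifford algebra with unit `p`. -/
structure IsClifford (p : A) (c : ℕ → A) (k : ℕ) : Prop where
  unit_mul_unit : p * p = p
  star_unit : star p = p
  unit_mul : ∀ i < k, p * c i = c i
  mul_unit : ∀ i < k, c i * p = c i
  star_gen : ∀ i < k, star (c i) = c i
  anticomm : ∀ i < k, ∀ j < k, c i * c j + c j * c i = if i = j then (2 : ℂ) • p else 0

variable {p : A} {c : ℕ → A} {k : ℕ}

theorem IsClifford.cliffordSpan_mul_unit (h : IsClifford p c k) {j : ℕ} (hj : j ≤ k) {x : A} (hx : x ∈ cliffordSpan p c j) :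
    x * p = x := by
  induction j generalizing x with
  | zero =>
    obtain ⟨a, rfl⟩ := Submodule.mem_span_singleton.1 hx
    rw [smul_mul_assoc, h.unit_mul_unit]
  | succ j ih =>
    obtain ⟨y, hy, z, hz, rfl⟩ := mem_cliffordSpan_succ.1 hx
    rw [add_mul, ih (by omega) hy, mul_assoc, h.mul_unit j hj]

/-- A generator can be sorted into an ordered monomial from the right. -/
theorem IsClifford.cliffordSpan_mul_gen (h : IsClifford p c k) {j : ℕ} (hj : j ≤ k) {x : A} (hx : x ∈ cliffordSpan p c j) {i : ℕ}
    (hi : i < j) : x * c i ∈ cliffordSpan p c j := by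
  induction j generalizing x i with
  | zero => omega
  | succ j ih =>
    obtain ⟨y, hy, z, hz, rfl⟩ := mem_cliffordSpan_succ.1 hx
    rw [mem_cliffordSpan_succ]
    by_cases hij : i = j
    · subst hij
      have h1 := h.anticomm i hj i hj
      rw [if_pos rfl, ← two_smul ℂ] at h1
      have h2 : c i * c i = p := smul_right_injective A (two_ne_zero (α := ℂ)) h1
      refine ⟨z, hz, y, hy, ?_⟩
      rw [add_mul, mul_assoc, h2, h.cliffordSpan_mul_unit (by omega) hz, add_comm]
    · have h1 := h.anticomm i (by omega) j hj
      rw [if_neg hij] at h1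
      refine ⟨y * c i, ih (by omega) hy (by omega), -(z * c i),
        neg_mem (ih (by omega) hz (by omega)), ?_⟩
      rw [add_mul, mul_assoc z (c j), eq_neg_of_add_eq_zero_right h1]
      noncomm_ring

theorem IsClifford.cliffordSpan_mul_mem (h : IsClifford p c k) {x y : A} (hx : x ∈ cliffordSpan p c k)
    (hy : y ∈ cliffordSpan p c k) : x * y ∈ cliffordSpan p c k := by
  have key : ∀ j ≤ k, ∀ y ∈ cliffordSpan p c j, x * y ∈ cliffordSpan p c k := by
    intro j
    induction j with
    | zero =>
      intro _ y hy
      obtain ⟨a, rfl⟩ := Submodule.mem_span_singleton.1 hy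
      rw [mul_smul_comm, h.cliffordSpan_mul_unit le_rfl hx]
      exact Submodule.smul_mem _ _ hx
    | succ j ih =>
      intro hj y hy
      obtain ⟨y, hy', z, hz, rfl⟩ := mem_cliffordSpan_succ.1 hy
      rw [mul_add, ← mul_assoc]
      exact add_mem (ih (by omega) y hy')
        (h.cliffordSpan_mul_gen le_rfl (ih (by omega) _ hz) hj)
  exact key k le_rfl y hy

theorem unit_mem_cliffordSpan : p ∈ cliffordSpan p c k :=
  cliffordSpan_mono p c (Nat.zero_le k) (Submodule.mem_span_singleton_self p)

theorem IsClifford.gen_mem_cliffordSpan (h : IsClifford p c k) {i : ℕ} (hi : i < k) : c i ∈ cliffordSpan p c k := by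
  rw [← h.unit_mul i hi]
  exact h.cliffordSpan_mul_gen le_rfl unit_mem_cliffordSpan hi

theorem IsClifford.star_mem_cliffordSpan (h : IsClifford p c k) {x : A} (hx : x ∈ cliffordSpan p c k) :
    star x ∈ cliffordSpan p c k := by
  have key : ∀ j ≤ k, ∀ y ∈ cliffordSpan p c j, star y ∈ cliffordSpan p c k := by
    intro j
    induction j with
    | zero =>
      intro _ y hy
      obtain ⟨a, rfl⟩ := Submodule.mem_span_singleton.1 hy
      rw [star_smul, h.star_unit]
      exact Submodule.smul_mem _ _ unit_mem_cliffordSpan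
    | succ j ih =>
      intro hj y hy
      obtain ⟨y, hy', z, hz, rfl⟩ := mem_cliffordSpan_succ.1 hy
      rw [star_add, star_mul, h.star_gen j hj]
      exact add_mem (ih (by omega) y hy') (h.cliffordSpan_mul_mem
        (h.gen_mem_cliffordSpan hj) (ih (by omega) _ hz))
  exact key k le_rfl x hx

end Clifford

/-! ### Spin factors in coordinates -/

section SpinCoord

variable {k : ℕ} {κ : Type} [Fintype κ] [DecidableEq κ]

/-- Coordinates of a spin factor: `(a, b)` stands for `a 1 + ∑ bᵢ sᵢ`. -/
abbrev SpinCoord (k : ℕ) : Type := ℂ × (Fin k → ℂ)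

/-- Self-adjoint anticommuting matrices with square `1`. -/
def IsSpin (t : Fin k → Matrix κ κ ℂ) : Prop :=
  (∀ i, (t i)ᴴ = t i) ∧ ∀ i j, t i * t j + t j * t i = if i = j then 2 else 0

/-- The linear combination of `1` and a spin system with given coordinates. -/
def spinMap (t : Fin k → Matrix κ κ ℂ) : SpinCoord k →ₗ[ℂ] Matrix κ κ ℂ where
  toFun a := a.1 • 1 + ∑ i, a.2 i • t i
  map_add' a b := by
    simp only [Prod.fst_add, Prod.snd_add, Pi.add_apply, add_smul, Finset.sum_add_distrib]
    abel
  map_smul' c a := by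
    simp [mul_smul, Finset.smul_sum]

theorem spinMap_apply (t : Fin k → Matrix κ κ ℂ) (a : SpinCoord k) :
    spinMap t a = a.1 • 1 + ∑ i, a.2 i • t i := rfl

/-- The symmetric bilinear form of a spin factor; `i 1, s₁, …, sₖ` is an orthonormal basis. -/
def spinForm : SpinCoord k →ₗ[ℂ] SpinCoord k →ₗ[ℂ] ℂ :=
  LinearMap.mk₂ ℂ (fun a b => -(a.1 * b.1) + ∑ i, a.2 i * b.2 i)
    (fun a b c => by simp [add_mul, Finset.sum_add_distrib]; ring)
    (fun a b c => by simp [Finset.mul_sum, mul_assoc, mul_add])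
    (fun a b c => by simp [mul_add, Finset.sum_add_distrib]; ring)
    (fun a b c => by simp [Finset.mul_sum, mul_add, mul_left_comm])

theorem spinForm_apply (a b : SpinCoord k) :
    spinForm a b = -(a.1 * b.1) + ∑ i, a.2 i * b.2 i := rfl

theorem spinForm_comm (a b : SpinCoord k) : spinForm a b = spinForm b a := by
  simp [spinForm_apply, mul_comm]

/-- The conjugation of a spin factor with respect to the basis `i 1, s₁, …, sₖ`. -/
def spinConj (a : SpinCoord k) : SpinCoord k := (-star a.1, fun i => star (a.2 i))

theorem spinConj_spinConj (a : SpinCoord k) : spinConj (spinConj a) = a := by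
  simp [spinConj]

theorem spinForm_spinConj (a b : SpinCoord k) :
    spinForm (spinConj a) (spinConj b) = star (spinForm a b) := by
  simp [spinForm_apply, spinConj]

/-- The triple product of a spin factor. -/
def spinTriple (x y z : SpinCoord k) : SpinCoord k :=
  spinForm x (spinConj y) • z + spinForm z (spinConj y) • x - spinForm x z • spinConj y

/-- The grading involution of the coordinates. -/
def spinHat (a : SpinCoord k) : SpinCoord k := (a.1, -a.2)

variable {t : Fin k → Matrix κ κ ℂ}

theorem two_eq_smul_one : (2 : Matrix κ κ ℂ) = (2 : ℂ) • 1 := by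
  rw [two_smul, one_add_one_eq_two]

theorem IsSpin.sum_mul_sum (ht : IsSpin t) (a b : Fin k → ℂ) :
    (∑ i, a i • t i) * (∑ i, b i • t i) + (∑ i, b i • t i) * (∑ i, a i • t i) =
      (2 * ∑ i, a i * b i) • (1 : Matrix κ κ ℂ) := by
  have h1 : (∑ i, b i • t i) * (∑ i, a i • t i) = ∑ i, ∑ j, (a i * b j) • (t j * t i) := by
    rw [Finset.sum_mul_sum, Finset.sum_comm]
    simp only [smul_mul_smul_comm, mul_comm]
  rw [h1, Finset.sum_mul_sum]
  simp only [smul_mul_smul_comm, ← Finset.sum_add_distrib, ← smul_add, ht.2]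
  rw [Finset.mul_sum, Finset.sum_smul]
  refine Finset.sum_congr rfl fun i _ => ?_
  rw [Finset.sum_eq_single i]
  · rw [if_pos rfl, mul_comm 2, mul_smul, two_eq_smul_one, smul_smul, smul_smul, mul_assoc]
  · intro j _ hj
    rw [if_neg (Ne.symm hj), smul_zero]
  · simp

/-- Polarized form of `z ẑ = -⟨z, z⟩ 1`, which replaces the Clifford relations. -/
theorem IsSpin.mul_hat_add (ht : IsSpin t) (a b : SpinCoord k) :
    spinMap t a * spinMap t (spinHat b) + spinMap t b * spinMap t (spinHat a) =
      (-2 * spinForm a b) • (1 : Matrix κ κ ℂ) := by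
  have h1 : ∀ a : SpinCoord k, spinMap t (spinHat a) = a.1 • 1 - ∑ i, a.2 i • t i := by
    intro a
    simp [spinMap_apply, spinHat, sub_eq_add_neg]
  have h2 := ht.sum_mul_sum a.2 b.2
  rw [h1, h1, spinMap_apply, spinMap_apply]
  have h3 : (-2 * spinForm a b) • (1 : Matrix κ κ ℂ) =
      (a.1 * b.1) • 1 + (b.1 * a.1) • 1 - (2 * ∑ i, a.2 i * b.2 i) • 1 := by
    rw [← add_smul, ← sub_smul, spinForm_apply]
    congr 1
    ring
  rw [h3, ← h2]
  simp only [add_mul, mul_sub, smul_add, smul_smul, mul_smul_comm, smul_mul_assoc, Matrix.mul_one,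
    Matrix.one_mul]
  rw [mul_comm b.1 a.1]
  abel

theorem IsSpin.conjTranspose (ht : IsSpin t) (a : SpinCoord k) :
    (spinMap t a)ᴴ = -spinMap t (spinHat (spinConj a)) := by
  simp [spinMap_apply, spinHat, spinConj, Matrix.conjTranspose_sum, ht.1, add_comm]

/-- The triple product of matrices is `spinTriple` in coordinates, whichever spin system is used. -/
theorem IsSpin.triple (ht : IsSpin t) (x y z : SpinCoord k) :
    spinMap t (spinTriple x y z) = (1 / 2 : ℂ) • (spinMap t x * (spinMap t y)ᴴ * spinMap t z +
      spinMap t z * (spinMap t y)ᴴ * spinMap t x) := by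
  have h0 : ∀ a : SpinCoord k, spinHat (spinHat a) = a := fun a => by simp [spinHat]
  set w := spinConj y with hw
  have h1 := ht.mul_hat_add x w
  have h2 := ht.mul_hat_add (spinHat x) (spinHat z)
  have h3 := ht.mul_hat_add w z
  rw [h0, h0] at h2
  have h4 : spinForm (spinHat x) (spinHat z) = spinForm x z := by
    simp [spinForm_apply, spinHat]
  rw [h4] at h2
  have h5 : spinMap t x * spinMap t (spinHat w) * spinMap t z +
      spinMap t z * spinMap t (spinHat w) * spinMap t x =
      (-2 * spinForm x w) • spinMap t z - (-2 * spinForm x z) • spinMap t w +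
        (-2 * spinForm w z) • spinMap t x := by
    have e1 := congrArg (· * spinMap t z) h1
    have e2 := congrArg (spinMap t w * ·) h2
    have e3 := congrArg (· * spinMap t x) h3
    simp only [add_mul, mul_add, smul_mul_assoc, mul_smul_comm, Matrix.one_mul, Matrix.mul_one]
      at e1 e2 e3
    rw [← e1, ← e2, ← e3]
    simp only [Matrix.mul_assoc]
    abel
  rw [ht.conjTranspose, ← hw, Matrix.mul_neg, Matrix.mul_neg, Matrix.neg_mul, Matrix.neg_mul,
    ← neg_add, h5, spinTriple, ← hw, spinForm_comm z w, map_sub, map_add, map_smul, map_smul,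
    map_smul]
  module

theorem IsSpin.trace_mul (ht : IsSpin t) {i j : Fin k} (hij : i ≠ j) : (t i * t j).trace = 0 := by
  have h := congrArg Matrix.trace (ht.2 i j)
  rw [if_neg hij, Matrix.trace_add, Matrix.trace_mul_comm (t j), Matrix.trace_zero] at h
  exact add_self_eq_zero.1 h

theorem IsSpin.mul_self (ht : IsSpin t) (i : Fin k) : t i * t i = 1 := by
  have h := ht.2 i i
  rw [if_pos rfl, ← two_smul ℂ] at h
  exact smul_right_injective _ (two_ne_zero (α := ℂ)) (h.trans two_eq_smul_one)

/-- Conjugation by another member of the system changes the sign of `tᵢ`, so its trace vanishes. -/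
theorem IsSpin.trace_eq_zero (ht : IsSpin t) (hk : 2 ≤ k) (i : Fin k) : (t i).trace = 0 := by
  have : Nontrivial (Fin k) := Fin.nontrivial_iff_two_le.2 hk
  obtain ⟨j, hj⟩ := exists_ne i
  have h1 := ht.2 i j
  rw [if_neg (Ne.symm hj)] at h1
  have h2 := congrArg (fun X => (X * t j).trace) h1
  simp only [Matrix.add_mul, Matrix.trace_add, Matrix.zero_mul, Matrix.trace_zero,
    Matrix.mul_assoc, ht.mul_self, Matrix.mul_one] at h2
  rw [Matrix.trace_mul_comm (t j), Matrix.mul_assoc, ht.mul_self, Matrix.mul_one] at h2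
  exact add_self_eq_zero.1 h2

theorem IsSpin.trace_spinMap (ht : IsSpin t) (hk : 2 ≤ k) (a : SpinCoord k) :
    (spinMap t a).trace = a.1 * Fintype.card κ := by
  simp [spinMap_apply, Matrix.trace_sum, ht.trace_eq_zero hk]

theorem IsSpin.trace_spinMap_mul (ht : IsSpin t) (hk : 2 ≤ k) (a : SpinCoord k) (j : Fin k) :
    (spinMap t a * t j).trace = a.2 j * Fintype.card κ := by
  rw [spinMap_apply, Matrix.add_mul, Matrix.trace_add, Matrix.sum_mul, Matrix.trace_sum,
    Finset.sum_eq_single j]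
  · simp [ht.trace_eq_zero hk, ht.mul_self]
  · intro i _ hi
    simp [ht.trace_mul hi]
  · simp

/-- A spin system and `1` are linearly independent, as traces recover the coordinates. -/
theorem IsSpin.injective [Nonempty κ] (ht : IsSpin t) (hk : 2 ≤ k) :
    Function.Injective (spinMap t) := by
  rw [← LinearMap.ker_eq_bot, LinearMap.ker_eq_bot']
  intro a ha
  have hN : (Fintype.card κ : ℂ) ≠ 0 := by exact_mod_cast Fintype.card_ne_zero
  have h1 := ht.trace_spinMap hk a
  rw [ha, Matrix.trace_zero, eq_comm, mul_eq_zero, or_iff_left hN] at h1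
  refine Prod.ext h1 (funext fun j => ?_)
  have h2 := ht.trace_spinMap_mul hk a j
  rw [ha, Matrix.zero_mul, Matrix.trace_zero, eq_comm, mul_eq_zero, or_iff_left hN] at h2
  exact h2

theorem IsSpin.trace_mul_conjTranspose (ht : IsSpin t) (hk : 2 ≤ k) (a : SpinCoord k) :
    (spinMap t a * (spinMap t a)ᴴ).trace = spinForm a (spinConj a) * Fintype.card κ := by
  have h1 : (spinMap t a)ᴴ = star a.1 • 1 + ∑ i, star (a.2 i) • t i := by
    simp [spinMap_apply, Matrix.conjTranspose_sum, ht.1]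
  rw [h1, Matrix.mul_add, Matrix.mul_sum, Matrix.trace_add, Matrix.trace_sum]
  simp only [Matrix.mul_smul, Matrix.mul_one, Matrix.trace_smul, ht.trace_spinMap hk,
    ht.trace_spinMap_mul hk, spinForm_apply, spinConj, smul_eq_mul, add_mul, Finset.sum_mul]
  congr 1
  · ring
  · exact Finset.sum_congr rfl fun i _ => by ring

variable {Z : Type u} [NormedAddCommGroup Z] [NormedSpace ℂ Z] [CompleteSpace Z] [JBStarTriple Z]

theorem range_spinMap {N : ℕ} (s : Fin k → Matrix (Fin N) (Fin N) ℂ) :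
    LinearMap.range (spinMap s) = spinSpan s := by
  refine le_antisymm ?_ (Submodule.span_le.2 ?_)
  · rintro _ ⟨a, rfl⟩
    refine add_mem (Submodule.smul_mem _ _ (Submodule.subset_span (Set.mem_insert _ _)))
      (sum_mem fun i _ => Submodule.smul_mem _ _ (Submodule.subset_span
        (Set.mem_insert_of_mem _ ⟨i, rfl⟩)))
  · rintro _ (rfl | ⟨i, rfl⟩)
    · exact ⟨(1, 0), by simp [spinMap_apply]⟩
    · refine ⟨(0, Pi.single i 1), ?_⟩
      rw [spinMap_apply, Finset.sum_eq_single i]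
      · simp
      · intro j _ hj
        simp [hj]
      · simp

variable (k Z) in
/-- Coordinates on `Z` in which the triple product is that of a spin factor. -/
structure SpinChart where
  equiv : Z ≃ₗ[ℂ] SpinCoord k
  map_tri : ∀ x y z, equiv (tri x y z) = spinTriple (equiv x) (equiv y) (equiv z)

theorem exists_spinChart (h : IsSpinFactor Z k) : Nonempty (SpinChart k Z) := by
  obtain ⟨hk, N, s, hN, hs, e, he⟩ := h
  have : Nonempty (Fin N) := ⟨⟨0, hN⟩⟩
  have hs' : IsSpin s := hs
  have hinj := hs'.injective hk
  let χ : Z ≃ₗ[ℂ] SpinCoord k := e.trans ((LinearEquiv.ofEq _ _ (range_spinMap s).symm).trans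
    (LinearEquiv.ofInjective (spinMap s) hinj).symm)
  have hχ : ∀ z, spinMap s (χ z) = e z := by
    intro z
    have := congrArg Subtype.val ((LinearEquiv.ofInjective (spinMap s) hinj).apply_symm_apply
      (LinearEquiv.ofEq _ _ (range_spinMap s).symm (e z)))
    exact this
  refine ⟨χ, fun x y z => hinj ?_⟩
  rw [hs'.triple, hχ, hχ, hχ, hχ, he]

variable (χ : SpinChart k Z)

/-- The square of the Hilbert space norm of an element of a spin factor. -/
def SpinChart.normSq (g : Z) : ℂ := spinForm (χ.equiv g) (spinConj (χ.equiv g))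

theorem SpinChart.tri_eq (x y z : Z) : tri x y z =
    spinForm (χ.equiv x) (spinConj (χ.equiv y)) • z +
      spinForm (χ.equiv z) (spinConj (χ.equiv y)) • x -
      spinForm (χ.equiv x) (χ.equiv z) • χ.equiv.symm (spinConj (χ.equiv y)) := by
  apply χ.equiv.injective
  rw [χ.map_tri]
  simp [spinTriple]

/-- A nonzero tripotent is either isotropic of norm square `1 / 2` or a multiple of its conjugate
of norm square `1`. -/
theorem SpinChart.tripotent_cases {g : Z} (hg : g ∈ Tri Z) :
    (χ.normSq g = 1 / 2 ∧ spinForm (χ.equiv g) (χ.equiv g) = 0) ∨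
      (χ.normSq g = 1 ∧
        χ.equiv g = spinForm (χ.equiv g) (χ.equiv g) • spinConj (χ.equiv g)) := by
  obtain ⟨h0, h⟩ := hg
  have ha : χ.equiv g ≠ 0 := by simpa using h0
  have h1 := congrArg χ.equiv h
  rw [χ.map_tri, spinTriple, SpinChart.normSq] at *
  set a := χ.equiv g
  set q := spinForm a (spinConj a)
  set β := spinForm a a with hβ
  have h2 : (2 * q - 1) • a = β • spinConj a := by
    have : (2 * q - 1) • a = (q • a + q • a - β • spinConj a) - a + β • spinConj a := by module
    rw [this, h1]
    module
  by_cases hb : β = 0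
  · left
    rw [hb, zero_smul, smul_eq_zero, or_iff_left ha, sub_eq_zero] at h2
    exact ⟨by rw [eq_div_iff two_ne_zero, mul_comm, h2], hb⟩
  · right
    have h3 := congrArg (spinForm a) h2
    rw [map_smul, map_smul, smul_eq_mul, smul_eq_mul, mul_comm β] at h3
    have h4 : 2 * q - 1 = q := mul_right_cancel₀ hb h3
    have h5 : q = 1 := by linear_combination h4
    refine ⟨h5, ?_⟩
    rw [h5] at h2
    norm_num at h2
    exact h2

theorem SpinChart.tri_self (g z : Z) : tri g g z = χ.normSq g • z +
      spinForm (χ.equiv z) (spinConj (χ.equiv g)) • g -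
      spinForm (χ.equiv g) (χ.equiv z) • χ.equiv.symm (spinConj (χ.equiv g)) := χ.tri_eq g g z

/-- Tripotents of norm square `1` are unitary. -/
theorem SpinChart.tri_of_normSq_one {g : Z} (hg : g ∈ Tri Z) (h : χ.normSq g = 1) (z : Z) :
    tri g g z = z := by
  rcases χ.tripotent_cases hg with h1 | ⟨-, h1⟩
  · rw [h1.1] at h
    norm_num at h
  · rw [χ.tri_self, h]
    have h2 : spinForm (χ.equiv g) (χ.equiv z) • χ.equiv.symm (spinConj (χ.equiv g)) =
        spinForm (χ.equiv z) (spinConj (χ.equiv g)) • g := by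
      apply χ.equiv.injective
      rw [map_smul, map_smul, LinearEquiv.apply_symm_apply]
      set β := spinForm (χ.equiv g) (χ.equiv g)
      conv_rhs =>
        arg 2
        rw [h1]
      have h3 : spinForm (χ.equiv g) (χ.equiv z) =
          β * spinForm (spinConj (χ.equiv g)) (χ.equiv z) := by
        conv_lhs => rw [h1, map_smul, LinearMap.smul_apply, smul_eq_mul]
      rw [h3, spinForm_comm (spinConj _), mul_comm, mul_smul]
    rw [h2]
    simp

/-- The minimal tripotents are the isotropic ones. -/
theorem SpinChart.mem_minTri_iff (hk : 2 ≤ k) {g : Z} :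
    g ∈ minTri Z ↔ g ∈ Tri Z ∧ χ.normSq g = 1 / 2 := by
  constructor
  · rintro ⟨hg, h⟩
    refine ⟨hg, ?_⟩
    rcases χ.tripotent_cases hg with h1 | h1
    · exact h1.1
    · have h2 : ∀ z, ∃ c : ℂ, z = c • g := fun z => h z (χ.tri_of_normSq_one hg h1.1 z)
      have h3 : Module.finrank ℂ Z ≤ 1 :=
        finrank_le_one g fun z => (h2 z).imp fun c hc => hc.symm
      rw [χ.equiv.finrank_eq] at h3
      simp at h3
      omega
  · rintro ⟨hg, h⟩
    refine ⟨hg, fun z hz => ?_⟩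
    rcases χ.tripotent_cases hg with h1 | h1
    · have hz' := hz
      rw [χ.tri_self, h] at hz
      have h2 := congrArg (fun x => spinForm (χ.equiv g) (χ.equiv x)) hz
      simp only [map_add, map_sub, map_smul, LinearEquiv.apply_symm_apply, smul_eq_mul, h1.2,
        mul_zero, add_zero] at h2
      have h3 : spinForm (χ.equiv g) (χ.equiv z) = 0 := by
        have h4 : spinForm (χ.equiv g) (spinConj (χ.equiv g)) = 1 / 2 := h
        rw [h4] at h2
        linear_combination -h2
      rw [h3, zero_smul, sub_zero] at hz
      refine ⟨2 * spinForm (χ.equiv z) (spinConj (χ.equiv g)), ?_⟩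
      have h5 : spinForm (χ.equiv z) (spinConj (χ.equiv g)) • g = (1 / 2 : ℂ) • z := by
        rw [eq_sub_of_add_eq' hz]
        module
      rw [mul_smul, h5, smul_smul]
      norm_num
    · rw [h1.1] at h
      norm_num at h

/-- The maximal tripotents are the multiples of their conjugates: an isotropic tripotent annihilates
its conjugate. -/
theorem SpinChart.mem_maxTri_iff {g : Z} :
    g ∈ maxTri Z ↔ g ∈ Tri Z ∧ χ.normSq g = 1 := by
  constructor
  · rintro ⟨hg, h⟩
    refine ⟨hg, ?_⟩
    rcases χ.tripotent_cases hg with h1 | h1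
    · exfalso
      have h2 := h (χ.equiv.symm (spinConj (χ.equiv g))) (by
        rw [χ.tri_self, LinearEquiv.apply_symm_apply, spinForm_spinConj, h1.2, star_zero, zero_smul,
          add_zero]
        exact sub_self _)
      apply hg.1
      rw [LinearEquiv.map_eq_zero_iff] at h2
      have h3 := spinConj_spinConj (χ.equiv g)
      rw [h2] at h3
      rw [← χ.equiv.map_eq_zero_iff, ← h3]
      simp [spinConj]
      rfl
    · exact h1.1
  · rintro ⟨hg, h⟩
    refine ⟨hg, fun z hz => ?_⟩
    rwa [χ.tri_of_normSq_one hg h] at hz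

theorem SpinChart.exists_normSq_one : ∃ g ∈ Tri Z, χ.normSq g = 1 := by
  have h1 : χ.normSq (χ.equiv.symm (1, 0)) = 1 := by
    simp [SpinChart.normSq, spinForm_apply, spinConj]
  refine ⟨χ.equiv.symm (1, 0), ⟨?_, ?_⟩, h1⟩
  · intro h0
    rw [h0] at h1
    simp [SpinChart.normSq] at h1
  · apply χ.equiv.injective
    rw [χ.map_tri, LinearEquiv.apply_symm_apply]
    ext <;> simp [spinTriple, spinForm_apply, spinConj]

theorem SpinChart.exists_normSq_half (hk : 2 ≤ k) : ∃ g ∈ Tri Z, χ.normSq g = 1 / 2 := by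
  let a : SpinCoord k := (1 / 2, Pi.single ⟨0, by omega⟩ (1 / 2))
  have h0 : ∀ b c : ℂ, (∑ i, (Pi.single ⟨0, by omega⟩ b : Fin k → ℂ) i *
      (Pi.single ⟨0, by omega⟩ c : Fin k → ℂ) i) = b * c := by
    intro b c
    rw [Finset.sum_eq_single ⟨0, by omega⟩]
    · simp
    · intro j _ hj
      simp [hj]
    · simp
  have hc : spinConj a = (-(1 / 2), Pi.single ⟨0, by omega⟩ (1 / 2)) := by
    refine Prod.ext (by simp [spinConj, a]) (funext fun i => ?_)
    by_cases hi : i = ⟨0, by omega⟩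
    · subst hi
      simp only [spinConj, a, Pi.single_eq_same]
      norm_num
    · simp [spinConj, a, hi]
  have h1 : spinForm a (spinConj a) = 1 / 2 := by
    rw [hc, spinForm_apply, h0]
    norm_num [a]
  have h2 : spinForm a a = 0 := by
    rw [spinForm_apply, h0]
    norm_num [a]
  have h3 : χ.normSq (χ.equiv.symm a) = 1 / 2 := by
    rw [SpinChart.normSq, LinearEquiv.apply_symm_apply, h1]
  refine ⟨χ.equiv.symm a, ⟨?_, ?_⟩, h3⟩
  · intro h0
    rw [h0] at h3
    simp [SpinChart.normSq] at h3
  · apply χ.equiv.injective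
    rw [χ.map_tri, LinearEquiv.apply_symm_apply, spinTriple, h1, h2]
    module

end SpinCoord

/-! ### Invariants of spin factors -/

section SpinModel

variable {k : ℕ} {Z : Type u} [NormedAddCommGroup Z] [NormedSpace ℂ Z] [CompleteSpace Z]
  [JBStarTriple Z]

/-- In the image of a spin factor of dimension `k + 1`, the tripotent `u = ψ(1)` is a partial isometry
and the elements `ψ(sᵢ) u*` satisfy the Clifford relations with unit `u u*`. Their ordered monomials
times `u` span a ternary subspace. -/
theorem SpinChart.generatesSmall (χ : SpinChart k Z) : GeneratesSmall.{u, w} Z (2 ^ k) := by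
  intro A _ _ _ _ ψ hψ
  let z₀ := χ.equiv.symm (1, 0)
  let s : Fin k → Z := fun i => χ.equiv.symm (0, Pi.single i 1)
  have h1 : tri z₀ z₀ z₀ = z₀ := by
    apply χ.equiv.injective
    rw [χ.map_tri, LinearEquiv.apply_symm_apply]
    ext <;> simp [spinTriple, spinForm_apply, spinConj]
  have hc : ∀ i, spinConj ((0, Pi.single i 1) : SpinCoord k) = (0, Pi.single i 1) := by
    intro i
    refine Prod.ext (by simp [spinConj]) (funext fun j => ?_)
    by_cases hij : j = i
    · subst hij
      simp [spinConj]
    · simp [spinConj, hij]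
  have h2 : ∀ i, tri z₀ (s i) z₀ = s i := by
    intro i
    apply χ.equiv.injective
    rw [χ.map_tri, LinearEquiv.apply_symm_apply, LinearEquiv.apply_symm_apply, spinTriple, hc]
    simp [spinForm_apply]
  have h3 : ∀ i j, tri (s i) z₀ (s j) = if i = j then z₀ else 0 := by
    intro i j
    apply χ.equiv.injective
    rw [χ.map_tri, LinearEquiv.apply_symm_apply, LinearEquiv.apply_symm_apply,
      LinearEquiv.apply_symm_apply, spinTriple]
    by_cases hij : i = j
    · subst hij
      simp [spinForm_apply, spinConj, z₀, Pi.single_apply]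
      rfl
    · simp [spinForm_apply, spinConj, z₀, Pi.single_apply, hij, Ne.symm hij]
  set u := ψ z₀ with hu
  have hu1 : u * star u * u = u := by
    have := hψ z₀ z₀ z₀
    rw [h1, ← two_smul ℂ, smul_smul] at this
    simpa using this.symm
  have hu2 : ∀ i, u * star (ψ (s i)) * u = ψ (s i) := by
    intro i
    have := hψ z₀ (s i) z₀
    rw [h2, ← two_smul ℂ, smul_smul] at this
    simpa using this.symm
  have hu3 : ∀ i j, ψ (s i) * star u * ψ (s j) + ψ (s j) * star u * ψ (s i) =
      if i = j then (2 : ℂ) • u else 0 := by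
    intro i j
    have := hψ (s i) z₀ (s j)
    rw [h3] at this
    have h4 := congrArg ((2 : ℂ) • ·) this
    simp only [smul_smul] at h4
    norm_num at h4
    rw [← h4]
    split_ifs <;> simp [hu]
  have hu4 : star u * u * star u = star u := by simpa [mul_assoc] using congrArg star hu1
  have hl : ∀ i, u * star u * ψ (s i) = ψ (s i) := by
    intro i
    rw [← hu2 i, ← mul_assoc, ← mul_assoc, hu1]
  have hr : ∀ i, ψ (s i) * star u * u = ψ (s i) := by
    intro i
    rw [← hu2 i, mul_assoc _ (star u), mul_assoc _ u, ← mul_assoc u, hu1]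
  let c : ℕ → A := fun i => if h : i < k then ψ (s ⟨i, h⟩) * star u else 0
  have hci : ∀ i (h : i < k), c i = ψ (s ⟨i, h⟩) * star u := fun i h => dif_pos h
  have hC : IsClifford (u * star u) c k := by
    refine ⟨?_, ?_, ?_, ?_, ?_, ?_⟩
    · rw [← mul_assoc, hu1]
    · simp
    · intro i hi
      rw [hci i hi, ← mul_assoc, hl]
    · intro i hi
      rw [hci i hi, ← mul_assoc, hr]
    · intro i hi
      rw [hci i hi, star_mul, star_star]
      have h5 := congrArg star (hl ⟨i, hi⟩)
      simp only [star_mul, star_star] at h5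
      conv_rhs => rw [← hu2 ⟨i, hi⟩, mul_assoc, mul_assoc, h5]
    · intro i hi j hj
      have h5 := congrArg (· * star u) (hu3 ⟨i, hi⟩ ⟨j, hj⟩)
      rw [hci i hi, hci j hj]
      simp only [add_mul, ite_mul, zero_mul, smul_mul_assoc, Fin.mk.injEq] at h5
      simpa only [mul_assoc] using h5
  have := finiteDimensional_cliffordSpan (u * star u) c k
  refine ⟨(cliffordSpan (u * star u) c k).map (LinearMap.mulRight ℂ u), inferInstance,
    (Submodule.finrank_map_le _ _).trans (finrank_cliffordSpan_le _ _ _), ?_, ?_⟩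
  · rintro _ ⟨x, hx, rfl⟩ _ ⟨y, hy, rfl⟩ _ ⟨z, hz, rfl⟩
    refine ⟨x * (u * star u) * star y * z, hC.cliffordSpan_mul_mem (hC.cliffordSpan_mul_mem
      (hC.cliffordSpan_mul_mem hx unit_mem_cliffordSpan) (hC.star_mem_cliffordSpan hy)) hz, ?_⟩
    simp [mul_assoc]
  · intro z
    have hz : z = (χ.equiv z).1 • z₀ + ∑ i, (χ.equiv z).2 i • s i := by
      apply χ.equiv.injective
      simp only [map_add, map_smul, map_sum, z₀, s, LinearEquiv.apply_symm_apply]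
      refine Prod.ext ?_ (funext fun j => ?_)
      · simp [Prod.fst_sum]
      · simp [Prod.snd_sum, Finset.sum_apply, Pi.single_apply]
    rw [hz, map_add, map_smul, map_sum]
    refine add_mem (Submodule.smul_mem _ _ ⟨u * star u, unit_mem_cliffordSpan, hu1⟩)
      (sum_mem fun i _ => ?_)
    rw [map_smul]
    refine Submodule.smul_mem _ _ ⟨c i, hC.gen_mem_cliffordSpan i.2, ?_⟩
    change c i * u = _
    rw [hci i i.2, hr]

variable {I : Type} [Fintype I] [DecidableEq I] {κ : Type} [Fintype κ] [DecidableEq κ]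

/-- The homomorphism of a spin factor given by a family of spin systems. -/
def SpinChart.toRect (χ : SpinChart k Z) (t : I → Fin k → Matrix κ κ ℂ) :
    Z →ₗ[ℂ] Rect (fun _ : I => κ) (fun _ : I => κ) :=
  LinearMap.pi fun b => spinMap (t b) ∘ₗ χ.equiv.toLinearMap

theorem SpinChart.toRect_apply (χ : SpinChart k Z) (t : I → Fin k → Matrix κ κ ℂ) (z : Z) (b : I) :
    χ.toRect t z b = spinMap (t b) (χ.equiv z) := rfl

/-- A family of spin systems whose joint image generates the product of the matrix algebras gives a
model. -/
theorem SpinChart.isModel (χ : SpinChart k Z) {t : I → Fin k → Matrix κ κ ℂ}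
    (ht : ∀ b, IsSpin (t b)) (hgen : ∀ S : Submodule ℂ (I → Matrix κ κ ℂ),
      (∀ X ∈ S, ∀ Y ∈ S, X * Y ∈ S) → 1 ∈ S → (∀ i, (fun b => t b i) ∈ S) → S = ⊤) :
    IsModel (χ.toRect t) where
  triple x y z b := by
    simp only [χ.toRect_apply, χ.map_tri]
    exact (ht b).triple _ _ _
  generates S hS hρ := by
    have h1 : (1 : I → Matrix κ κ ℂ) ∈ S := by
      have := hρ (χ.equiv.symm (1, 0))
      convert this using 1
      funext b
      simp [χ.toRect_apply, spinMap_apply]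
    refine hgen S (fun X hX Y hY => ?_) h1 fun i => ?_
    · have := hS X hX 1 h1 Y hY
      convert this using 1
      funext b
      simp
    · have := hρ (χ.equiv.symm (0, Pi.single i 1))
      convert this using 1
      funext b
      rw [χ.toRect_apply, LinearEquiv.apply_symm_apply, spinMap_apply, Finset.sum_eq_single i]
      · simp
      · intro j _ hj
        simp [hj]
      · simp

/-- All blocks give the same trace, determined by the norm of the tripotent. -/
theorem SpinChart.mem_traceClasses (χ : SpinChart k Z) (hk : 2 ≤ k)
    {t : I → Fin k → Matrix κ κ ℂ} (ht : ∀ b, IsSpin (t b)) (S : Set Z) (x : I → ℤ) :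
    x ∈ traceClasses (χ.toRect t) S ↔
      ∃ g ∈ S, ∀ b, ((x b : ℤ) : ℂ) = χ.normSq g * Fintype.card κ := by
  simp only [traceClasses, χ.toRect_apply, Set.mem_ofPred_eq, (ht _).trace_mul_conjTranspose hk]
  rfl

theorem SpinChart.traceClasses_minTri (χ : SpinChart k Z) (hk : 2 ≤ k)
    {t : I → Fin k → Matrix κ κ ℂ} (ht : ∀ b, IsSpin (t b)) {N : ℕ} (hN : Fintype.card κ = 2 * N) :
    traceClasses (χ.toRect t) (minTri Z) = {fun _ => (N : ℤ)} := by
  ext x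
  rw [χ.mem_traceClasses hk ht, Set.mem_singleton_iff]
  have h : (1 / 2 : ℂ) * Fintype.card κ = ((N : ℤ) : ℂ) := by
    rw [hN]
    push_cast
    ring
  constructor
  · rintro ⟨g, hg, hx⟩
    funext b
    have := hx b
    rw [((χ.mem_minTri_iff hk).1 hg).2, h] at this
    exact_mod_cast this
  · rintro rfl
    obtain ⟨g, hg, hgq⟩ := χ.exists_normSq_half hk
    exact ⟨g, (χ.mem_minTri_iff hk).2 ⟨hg, hgq⟩, fun b => by rw [hgq, h]⟩

theorem SpinChart.traceClasses_maxTri (χ : SpinChart k Z) (hk : 2 ≤ k)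
    {t : I → Fin k → Matrix κ κ ℂ} (ht : ∀ b, IsSpin (t b)) {N : ℕ} (hN : Fintype.card κ = 2 * N) :
    traceClasses (χ.toRect t) (maxTri Z) = {fun _ => (2 * N : ℤ)} := by
  ext x
  rw [χ.mem_traceClasses hk ht, Set.mem_singleton_iff]
  have h : (1 : ℂ) * Fintype.card κ = ((2 * N : ℤ) : ℂ) := by
    rw [hN]
    push_cast
    ring
  constructor
  · rintro ⟨g, hg, hx⟩
    funext b
    have := hx b
    rw [(χ.mem_maxTri_iff.1 hg).2, h] at this
    exact_mod_cast this
  · rintro rfl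
    obtain ⟨g, hg, hgq⟩ := χ.exists_normSq_one
    exact ⟨g, χ.mem_maxTri_iff.2 ⟨hg, hgq⟩, fun b => by rw [hgq, h]⟩

theorem SpinChart.traceClasses_Tri (χ : SpinChart k Z) (hk : 2 ≤ k)
    {t : I → Fin k → Matrix κ κ ℂ} (ht : ∀ b, IsSpin (t b)) {N : ℕ} (hN : Fintype.card κ = 2 * N) :
    traceClasses (χ.toRect t) (Tri Z) = {fun _ => (N : ℤ), fun _ => (2 * N : ℤ)} := by
  have h : Tri Z = minTri Z ∪ maxTri Z := by
    ext g
    rw [Set.mem_union, χ.mem_minTri_iff hk, χ.mem_maxTri_iff, ← and_or_left]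
    exact ⟨fun hg => ⟨hg, (χ.tripotent_cases hg).imp And.left And.left⟩, And.left⟩
  have h2 : ∀ S T : Set Z, traceClasses (χ.toRect t) (S ∪ T) =
      traceClasses (χ.toRect t) S ∪ traceClasses (χ.toRect t) T := by
    intro S T
    ext x
    simp only [traceClasses, Set.mem_union, Set.mem_ofPred_eq, or_and_right, exists_or]
  rw [h, h2, χ.traceClasses_minTri hk ht hN, χ.traceClasses_maxTri hk ht hN]
  rfl

end SpinModel

section Spinors

variable {k : ℕ} {κ : Type} [Fintype κ] [DecidableEq κ] {t : Fin k → Matrix κ κ ℂ}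

theorem IsSpin.snoc (ht : IsSpin t) {τ : Matrix κ κ ℂ} (h1 : τᴴ = τ) (h2 : τ * τ = 1)
    (h3 : ∀ i, τ * t i + t i * τ = 0) :
    IsSpin (Fin.snoc (α := fun _ => Matrix κ κ ℂ) t τ : Fin (k + 1) → Matrix κ κ ℂ) := by
  constructor
  · intro i
    refine Fin.lastCases ?_ (fun i => ?_) i
    · simpa using h1
    · simpa using ht.1 i
  · intro i j
    refine Fin.lastCases ?_ (fun i => ?_) i <;> refine Fin.lastCases ?_ (fun j => ?_) j
    · simp [h2, one_add_one_eq_two]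
    · simpa [(Fin.castSucc_lt_last j).ne'] using h3 j
    · simpa [(Fin.castSucc_lt_last i).ne, add_comm] using h3 i
    · simpa using ht.2 i j

/-- The spin system on two copies of the space, with opposite signs. -/
theorem IsSpin.double (ht : IsSpin t) :
    IsSpin fun i => Matrix.fromBlocks (t i) 0 0 (-t i) := by
  constructor
  · intro i
    simp [Matrix.fromBlocks_conjTranspose, ht.1]
  · intro i j
    simp only [Matrix.fromBlocks_multiply, Matrix.fromBlocks_add, Matrix.mul_zero, Matrix.zero_mul,
      add_zero, zero_add, neg_mul_neg, ht.2]
    split_ifs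
    · rw [two_eq_smul_one, two_eq_smul_one, ← Matrix.fromBlocks_one, Matrix.fromBlocks_smul]
      simp
    · simp

/-- Irreducible spin systems with `2 n` elements on a space of dimension `2 ^ n`, together with
a further anticommuting symmetry. -/
theorem exists_spinors (n : ℕ) : ∃ (κ : Type) (_ : Fintype κ) (_ : DecidableEq κ)
    (t : Fin (2 * n) → Matrix κ κ ℂ) (τ : Matrix κ κ ℂ), Fintype.card κ = 2 ^ n ∧ IsSpin t ∧
      τᴴ = τ ∧ τ * τ = 1 ∧ (∀ i, τ * t i + t i * τ = 0) ∧
      ∀ S : Submodule ℂ (Matrix κ κ ℂ), (∀ X ∈ S, ∀ Y ∈ S, X * Y ∈ S) → 1 ∈ S →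
        (∀ i, t i ∈ S) → S = ⊤ := by
  induction n with
  | zero =>
    refine ⟨Unit, inferInstance, inferInstance, fun i => i.elim0, 1, rfl,
      ⟨fun i => i.elim0, fun i => i.elim0⟩, by simp, by simp, fun i => i.elim0, ?_⟩
    intro S _ h1 _
    refine eq_top_iff.2 fun X _ => ?_
    have : X = X () () • 1 := by
      ext i j
      simp
    rw [this]
    exact S.smul_mem _ h1
  | succ n ih =>
    obtain ⟨κ, _, _, t, τ, hcard, ht, hτ1, hτ2, hτ3, hgen⟩ := ih
    let σ₁ : Matrix (κ ⊕ κ) (κ ⊕ κ) ℂ := Matrix.fromBlocks 0 1 1 0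
    let σ₂ : Matrix (κ ⊕ κ) (κ ⊕ κ) ℂ :=
      Matrix.fromBlocks 0 (-Complex.I • 1) (Complex.I • 1) 0
    have h1 := ht.double.snoc (τ := σ₁) (by simp [σ₁, Matrix.fromBlocks_conjTranspose])
      (by simp [σ₁, Matrix.fromBlocks_multiply])
      (fun i => by simp [σ₁, Matrix.fromBlocks_multiply, Matrix.fromBlocks_add])
    have h2 := h1.snoc (τ := σ₂) (by simp [σ₂, Matrix.fromBlocks_conjTranspose])
      (by simp [σ₂, Matrix.fromBlocks_multiply, smul_smul])
      (fun i => by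
        refine Fin.lastCases ?_ (fun i => ?_) i
        · simp [σ₁, σ₂, Matrix.fromBlocks_multiply, Matrix.fromBlocks_add]
        · simp [σ₂, Matrix.fromBlocks_multiply, Matrix.fromBlocks_add])
    refine ⟨κ ⊕ κ, inferInstance, inferInstance, _, Matrix.fromBlocks τ 0 0 (-τ), ?_, h2, ?_, ?_,
      ?_, ?_⟩
    · rw [Fintype.card_sum, hcard, pow_succ]
      ring
    · simp [Matrix.fromBlocks_conjTranspose, hτ1]
    · simp [Matrix.fromBlocks_multiply, hτ2]
    · intro i
      refine Fin.lastCases ?_ (fun i => ?_) i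
      · simp [σ₂, Matrix.fromBlocks_multiply, Matrix.fromBlocks_add]
      · refine Fin.lastCases ?_ (fun i => ?_) i
        · simp [σ₁, Matrix.fromBlocks_multiply, Matrix.fromBlocks_add]
        · simp [Matrix.fromBlocks_multiply, Matrix.fromBlocks_add, hτ3]
    · intro S hS hS1 hSt
      have m1 : σ₁ ∈ S := by simpa using hSt (Fin.last (2 * n)).castSucc
      have m2 : σ₂ ∈ S := by simpa using hSt (Fin.last (2 * n + 1))
      have m3 : ∀ i, Matrix.fromBlocks (t i) 0 0 (-t i) ∈ S := fun i => by
        simpa using hSt i.castSucc.castSucc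
      -- the product of `σ₁` and `σ₂` separates the two diagonal blocks
      have m4 : Matrix.fromBlocks (1 : Matrix κ κ ℂ) 0 0 0 ∈ S := by
        have := S.smul_mem (1 / 2 : ℂ) (add_mem hS1
          (S.smul_mem (-Complex.I) (hS _ m1 _ m2)))
        have h3 : -Complex.I • (σ₁ * σ₂) = Matrix.fromBlocks 1 0 0 (-1) := by
          simp [σ₁, σ₂, Matrix.fromBlocks_multiply, Matrix.fromBlocks_smul, smul_smul,
            Matrix.fromBlocks_neg]
        convert this using 1
        rw [h3, ← Matrix.fromBlocks_one, Matrix.fromBlocks_add, Matrix.fromBlocks_smul]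
        congr 1
        · module
        · simp
        · simp
        · simp
      have m5 : ∀ X : Matrix κ κ ℂ, Matrix.fromBlocks X 0 0 0 ∈ S := by
        let L : Matrix κ κ ℂ →ₗ[ℂ] Matrix (κ ⊕ κ) (κ ⊕ κ) ℂ :=
          { toFun := fun X => Matrix.fromBlocks X 0 0 0
            map_add' := fun X Y => by simp [Matrix.fromBlocks_add]
            map_smul' := fun c X => by simp [Matrix.fromBlocks_smul] }
        have h3 : S.comap L = ⊤ := by
          refine hgen _ (fun X hX Y hY => ?_) m4 fun i => ?_
          · have := hS _ hX _ hY
            rw [Submodule.mem_comap]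
            convert this using 1
            simp [L, Matrix.fromBlocks_multiply]
          · have := hS _ m4 _ (m3 i)
            rw [Submodule.mem_comap]
            convert this using 1
            simp [L, Matrix.fromBlocks_multiply]
        intro X
        have : X ∈ S.comap L := h3 ▸ Submodule.mem_top
        exact this
      refine eq_top_iff.2 fun X _ => ?_
      have h4 : X = Matrix.fromBlocks X.toBlocks₁₁ 0 0 0 +
          Matrix.fromBlocks X.toBlocks₁₂ 0 0 0 * σ₁ + σ₁ * Matrix.fromBlocks X.toBlocks₂₁ 0 0 0 +
          σ₁ * Matrix.fromBlocks X.toBlocks₂₂ 0 0 0 * σ₁ := by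
        conv_lhs => rw [← Matrix.fromBlocks_toBlocks X]
        simp [σ₁, Matrix.fromBlocks_multiply, Matrix.fromBlocks_add]
      rw [h4]
      exact add_mem (add_mem (add_mem (m5 _) (hS _ (m5 _) _ m1)) (hS _ m1 _ (m5 _)))
        (hS _ (hS _ m1 _ (m5 _)) _ m1)

variable {Z : Type u} [NormedAddCommGroup Z] [NormedSpace ℂ Z] [CompleteSpace Z]
  [JBStarTriple Z]

/-- Spin factors of odd dimension `2 n + 1`: the Clifford algebra is a full matrix algebra of size
`2 ^ n`. -/
theorem hasInvariantMinMax_spin_odd {n : ℕ} (hn : 2 ≤ n) (hZ : IsSpinFactor Z (2 * n)) :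
    HasInvariantMinMax.{u, v, w} Z
        (Set.Ici (0 : ℤ)) (Set.Icc (0 : ℤ) (2 ^ n)) (Set.Icc (0 : ℤ) (2 ^ n))
        ((2 : ℤ) ^ (n - 1)) ((2 : ℤ) ^ n) := by
  obtain ⟨χ⟩ := exists_spinChart hZ
  obtain ⟨κ, _, _, t, τ, hcard, ht, -, -, -, hgen⟩ := exists_spinors n
  have hN : Fintype.card κ = 2 * 2 ^ (n - 1) := by
    rw [hcard, ← pow_succ']
    congr 1
    omega
  have hN' : (2 : ℤ) ^ n = 2 * 2 ^ (n - 1) := by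
    rw [← pow_succ']
    congr 1
    omega
  have : Nonempty κ := Fintype.card_pos_iff.1 (by rw [hcard]; positivity)
  have hm : IsModel (χ.toRect fun _ : Unit => t) := by
    refine χ.isModel (fun _ => ht) fun S hS h1 hSt => ?_
    let L : Matrix κ κ ℂ →ₗ[ℂ] Unit → Matrix κ κ ℂ := LinearMap.pi fun _ => LinearMap.id
    have h2 : S.comap L = ⊤ := hgen _ (fun X hX Y hY => hS _ hX _ hY) h1 hSt
    refine eq_top_iff.2 fun X _ => ?_
    have h3 : X () ∈ S.comap L := h2 ▸ Submodule.mem_top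
    exact h3
  have hd : Module.finrank ℂ (Rect (fun _ : Unit => κ) fun _ => κ) = 2 ^ (2 * n) := by
    rw [Module.finrank_pi_fintype]
    simp only [Module.finrank_matrix, hcard, Module.finrank_self]
    simp
    ring
  refine hm.hasInvariantMinMax (hm.hasLift_of_generatesSmall (by rw [hd]; exact χ.generatesSmall))
    (hm.hasLift_of_generatesSmall (by rw [hd]; exact χ.generatesSmall)) unitEquiv ?_
    (unitEquiv_image fun y => ?_) (unitEquiv_image fun y => ?_) (unitEquiv_image fun y => ?_)
    ?_ ?_ ?_
  · rw [hN']
    have : (0 : ℤ) < 2 ^ (n - 1) := by positivity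
    omega
  · simp
  · simp [hcard]
  · simp [hcard]
  · rw [χ.traceClasses_Tri (by omega) (fun _ => ht) hN, Set.image_pair, hN']
    push_cast
    rfl
  · rw [χ.traceClasses_minTri (by omega) (fun _ => ht) hN, Set.image_singleton]
    push_cast
    rfl
  · rw [χ.traceClasses_maxTri (by omega) (fun _ => ht) hN, Set.image_singleton, hN']
    push_cast
    rfl

/-- Spin factors of even dimension `2 n`: the Clifford algebra is a product of two matrix algebras of
size `2 ^ (n - 1)`. The two irreducible representations differ by the sign of the last generator. -/
theorem hasInvariantMinMax_spin_even {n : ℕ} (hn : 2 ≤ n) (hZ : IsSpinFactor Z (2 * n - 1)) :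
    HasInvariantMinMax.{u, v, w} Z
        {x : ℤ × ℤ | 0 ≤ x.1 ∧ 0 ≤ x.2}
        (Set.Icc (0 : ℤ) (2 ^ (n - 1)) ×ˢ Set.Icc (0 : ℤ) (2 ^ (n - 1)))
        (Set.Icc (0 : ℤ) (2 ^ (n - 1)) ×ˢ Set.Icc (0 : ℤ) (2 ^ (n - 1)))
        ((2 : ℤ) ^ (n - 2), (2 : ℤ) ^ (n - 2)) ((2 : ℤ) ^ (n - 1), (2 : ℤ) ^ (n - 1)) := by
  obtain ⟨m, rfl⟩ : ∃ m, n = m + 1 := ⟨n - 1, by omega⟩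
  have hk : 2 * (m + 1) - 1 = 2 * m + 1 := by omega
  rw [hk] at hZ
  have hm2 : m + 1 - 2 = m - 1 := by omega
  rw [Nat.add_sub_cancel, hm2]
  obtain ⟨χ⟩ := exists_spinChart hZ
  obtain ⟨κ, _, _, t, τ, hcard, ht, hτ1, hτ2, hτ3, hgen⟩ := exists_spinors m
  have hN : Fintype.card κ = 2 * 2 ^ (m - 1) := by
    rw [hcard, ← pow_succ']
    congr 1
    omega
  have hN' : (2 : ℤ) ^ m = 2 * 2 ^ (m - 1) := by
    rw [← pow_succ']
    congr 1
    omega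
  have : Nonempty κ := Fintype.card_pos_iff.1 (by rw [hcard]; positivity)
  let T : Bool → Fin (2 * m + 1) → Matrix κ κ ℂ := fun b =>
    Fin.snoc (α := fun _ => Matrix κ κ ℂ) t (cond b (-τ) τ)
  have hT : ∀ b, IsSpin (T b) := by
    intro b
    cases b
    · exact ht.snoc hτ1 hτ2 hτ3
    · refine ht.snoc (τ := -τ) (by simp [hτ1]) (by simp [hτ2]) fun i => ?_
      rw [neg_mul, mul_neg, ← neg_add, hτ3, neg_zero]
  have hm : IsModel (χ.toRect T) := by
    refine χ.isModel hT fun S hS h1 hSt => ?_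
    let L : Matrix κ κ ℂ →ₗ[ℂ] Bool → Matrix κ κ ℂ := LinearMap.pi fun _ => LinearMap.id
    have h2 : S.comap L = ⊤ := hgen _ (fun X hX Y hY => hS _ hX _ hY) h1 fun i => by
      have := hSt i.castSucc
      have h3 : (fun b => T b i.castSucc) = L (t i) := by
        funext b
        simp [T, L]
      rwa [h3] at this
    have h3 : ∀ X, L X ∈ S := fun X => by
      have : X ∈ S.comap L := h2 ▸ Submodule.mem_top
      exact this
    have h4 : (fun b => cond b (-τ) τ) ∈ S := by
      have := hSt (Fin.last (2 * m))
      simpa [T] using this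
    -- multiplying by `τ` in both blocks gives the symmetry that separates the blocks
    have h5 : (fun b => cond b (-1) 1 : Bool → Matrix κ κ ℂ) ∈ S := by
      have := hS _ (h3 τ) _ h4
      convert this using 1
      funext b
      cases b <;> simp [L, hτ2]
    refine eq_top_iff.2 fun X _ => ?_
    have h6 : X = L ((1 / 2 : ℂ) • (X false + X true)) +
        L ((1 / 2 : ℂ) • (X false - X true)) * fun b => cond b (-1) 1 := by
      funext b
      cases b
      · simp [L]
        module
      · simp [L]
        module
    rw [h6]
    exact add_mem (h3 _) (hS _ (h3 _) _ h5)
  have hd : Module.finrank ℂ (Rect (fun _ : Bool => κ) fun _ => κ) = 2 ^ (2 * m + 1) := by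
    rw [Module.finrank_pi_fintype]
    simp only [Module.finrank_matrix, hcard, Module.finrank_self]
    simp
    ring
  refine hm.hasInvariantMinMax (hm.hasLift_of_generatesSmall (by rw [hd]; exact χ.generatesSmall))
    (hm.hasLift_of_generatesSmall (by rw [hd]; exact χ.generatesSmall)) boolEquiv ?_
    (boolEquiv_image fun y => ?_) (boolEquiv_image fun y => ?_) (boolEquiv_image fun y => ?_)
    ?_ ?_ ?_
  · rw [hN']
    have : (0 : ℤ) < 2 ^ (m - 1) := by positivity
    intro h
    have := congrArg Prod.fst h
    simp only at this
    omega
  · simp [Bool.forall_bool]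
  · simp only [Set.mem_ofPred_eq, Bool.forall_bool, hcard, Set.mem_prod, Set.mem_Icc]
    push_cast
    exact Iff.rfl
  · simp only [Set.mem_ofPred_eq, Bool.forall_bool, hcard, Set.mem_prod, Set.mem_Icc]
    push_cast
    exact Iff.rfl
  · rw [χ.traceClasses_Tri (by omega) hT hN, Set.image_pair, hN']
    push_cast
    rfl
  · rw [χ.traceClasses_minTri (by omega) hT hN, Set.image_singleton]
    push_cast
    rfl
  · rw [χ.traceClasses_maxTri (by omega) hT hN, Set.image_singleton, hN']
    push_cast
    rfl

end Spinors

/-! ### Words in a Hilbert space triple -/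

section Words

/-- A subspace that contains the values of an alternating function at strictly increasing tuples
contains all its values; it suffices that the function alternates modulo the subspace. -/
theorem mem_of_strictMono {α : Type*} [LinearOrder α] {A : Type*} [AddCommGroup A] [Module ℂ A]
    (S : Submodule ℂ A) {q : ℕ} (f : (Fin q → α) → A)
    (h : ∀ i (a b : Fin q), (a : ℕ) + 1 = b → f (i ∘ Equiv.swap a b) + f i ∈ S)
    (hs : ∀ i, StrictMono i → f i ∈ S) (i : Fin q → α) : f i ∈ S := by
  cases q with
  | zero => exact hs i fun a => a.elim0
  | succ q =>
    have key : ∀ σ : Equiv.Perm (Fin (q + 1)), ∀ i, f (i ∘ σ) ∈ S ↔ f i ∈ S := by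
      intro σ
      have hσ : σ ∈ Submonoid.closure
          (Set.range fun a : Fin q => Equiv.swap a.castSucc a.succ) := by
        rw [Equiv.Perm.mclosure_swap_castSucc_succ]
        trivial
      induction hσ using Submonoid.closure_induction with
      | mem x hx =>
        obtain ⟨a, rfl⟩ := hx
        intro i
        have h1 := h i a.castSucc a.succ (by simp)
        constructor
        · intro h2
          exact (Submodule.add_mem_iff_right S h2).1 h1
        · intro h2
          exact (Submodule.add_mem_iff_left S h2).1 h1
      | one => exact fun i => Iff.rfl
      | mul x y _ _ hx hy =>
        intro i
        rw [Equiv.Perm.coe_mul, ← Function.comp_assoc, hy, hx]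
    rw [← key (Tuple.sort i)]
    have hmono := Tuple.monotone_sort i
    set j := i ∘ Tuple.sort i
    by_cases hj : StrictMono j
    · exact hs j hj
    · rw [Fin.strictMono_iff_lt_succ] at hj
      push Not at hj
      obtain ⟨a, ha⟩ := hj
      have h1 : j a.castSucc = j a.succ :=
        le_antisymm (hmono a.castSucc_lt_succ.le) ha
      have h2 : j ∘ Equiv.swap a.castSucc a.succ = j := by
        funext b
        rw [Function.comp_apply, Equiv.swap_apply_def]
        split_ifs with h3 h4
        · rw [h3, h1]
        · rw [h4, h1]
        · rfl
      have h3 := h j a.castSucc a.succ (by simp)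
      rw [h2, ← two_smul ℂ] at h3
      have h4 := S.smul_mem (1 / 2 : ℂ) h3
      rw [smul_smul] at h4
      norm_num at h4
      exact h4

variable {A : Type*} [Ring A] [StarRing A] [Algebra ℂ A] [StarModule ℂ A] {n : ℕ}

/-- The triple relations of an orthonormal basis of a Hilbert space. -/
def HilbertRel (u : Fin n → A) : Prop := ∀ i j k,
  u i * star (u j) * u k + u k * star (u j) * u i =
    (if i = j then u k else 0) + (if k = j then u i else 0)

/-- The word `u(i 0) u(j 0)* u(i 1) ⋯ u(j (q - 1))* u(i q)`. -/
def word (u : Fin n → A) (i j : ℕ → Fin n) : ℕ → A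
  | 0 => u (i 0)
  | q + 1 => word u i j q * star (u (j q)) * u (i (q + 1))

/-- A word without its last letter. -/
def wordInit (u : Fin n → A) (i j : ℕ → Fin n) : ℕ → A
  | 0 => 1
  | q + 1 => word u i j q * star (u (j q))

theorem word_eq_init_mul (u : Fin n → A) (i j : ℕ → Fin n) (q : ℕ) :
    word u i j q = wordInit u i j q * u (i q) := by
  cases q with
  | zero => rw [wordInit, one_mul, word]
  | succ q => rfl

theorem word_congr (u : Fin n → A) {i i' j j' : ℕ → Fin n} {q : ℕ} (hi : ∀ a ≤ q, i a = i' a)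
    (hj : ∀ a < q, j a = j' a) : word u i j q = word u i' j' q := by
  induction q with
  | zero => rw [word, word, hi 0 le_rfl]
  | succ q ih =>
    rw [word, word, hi _ le_rfl, hj q (by omega),
      ih (fun a ha => hi a (by omega)) fun a ha => hj a (by omega)]

theorem wordInit_congr (u : Fin n → A) {i i' j j' : ℕ → Fin n} {q : ℕ} (hi : ∀ a < q, i a = i' a)
    (hj : ∀ a < q, j a = j' a) : wordInit u i j q = wordInit u i' j' q := by
  cases q with
  | zero => rfl
  | succ q =>
    rw [wordInit, wordInit, hj q (by omega),
      word_congr u (fun a ha => hi a (by omega)) fun a ha => hj a (by omega)]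

/-- The span of the words with fewer than `p` starred letters. -/
def wordSpan (u : Fin n → A) (p : ℕ) : Submodule ℂ A :=
  Submodule.span ℂ {x | ∃ q < p, ∃ i j, x = word u i j q}

variable {u : Fin n → A}

theorem word_mem {p q : ℕ} (h : q < p) (i j : ℕ → Fin n) : word u i j q ∈ wordSpan u p :=
  Submodule.subset_span ⟨q, h, i, j, rfl⟩

theorem wordInit_mul_mem (i j : ℕ → Fin n) (q : ℕ) (c : Fin n) :
    wordInit u i j q * u c ∈ wordSpan u (q + 1) := by
  have h : wordInit u i j q * u c = word u (Function.update i q c) j q := by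
    rw [word_eq_init_mul, Function.update_self]
    congr 1
    exact wordInit_congr u (fun a ha => (Function.update_of_ne (by omega) _ _).symm)
      fun _ _ => rfl
  rw [h]
  exact word_mem (by omega) _ _

theorem wordSpan_mul_mem {p : ℕ} {x : A} (hx : x ∈ wordSpan u p) (b c : Fin n) :
    x * star (u b) * u c ∈ wordSpan u (p + 1) := by
  induction hx using Submodule.span_induction with
  | mem x hx =>
    obtain ⟨q, hq, i, j, rfl⟩ := hx
    have h : word u i j q * star (u b) * u c =
        word u (Function.update i (q + 1) c) (Function.update j q b) (q + 1) := by
      rw [word, Function.update_self, Function.update_self]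
      congr 2
      exact word_congr u (fun a ha => (Function.update_of_ne (by omega) _ _).symm)
        fun a ha => (Function.update_of_ne (by omega) _ _).symm
    rw [h]
    exact word_mem (by omega) _ _
  | zero => simp
  | add x y _ _ hx hy =>
    rw [add_mul, add_mul]
    exact add_mem hx hy
  | smul r x _ hx =>
    rw [smul_mul_assoc, smul_mul_assoc]
    exact Submodule.smul_mem _ _ hx

/-- Exchanging neighbouring unstarred letters changes the sign modulo shorter words. -/
theorem HilbertRel.swap_left (h : HilbertRel u) (i j : ℕ → Fin n) {q a : ℕ} (ha : a < q) :
    word u (i ∘ Equiv.swap a (a + 1)) j q + word u i j q ∈ wordSpan u q := by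
  induction q with
  | zero => omega
  | succ q ih =>
    by_cases haq : a = q
    · subst haq
      have h1 : wordInit u (i ∘ Equiv.swap a (a + 1)) j a = wordInit u i j a :=
        wordInit_congr u (fun b hb => by
          rw [Function.comp_apply, Equiv.swap_apply_of_ne_of_ne (by omega) (by omega)])
          fun _ _ => rfl
      have h2 : word u (i ∘ Equiv.swap a (a + 1)) j (a + 1) + word u i j (a + 1) =
          wordInit u i j a * (u (i (a + 1)) * star (u (j a)) * u (i a) +
            u (i a) * star (u (j a)) * u (i (a + 1))) := by
        rw [word, word, word_eq_init_mul, word_eq_init_mul, h1, Function.comp_apply,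
          Function.comp_apply, Equiv.swap_apply_left, Equiv.swap_apply_right]
        noncomm_ring
      rw [h2, h, mul_add]
      refine add_mem ?_ ?_ <;> split_ifs
      · exact wordInit_mul_mem _ _ _ _
      · simp
      · exact wordInit_mul_mem _ _ _ _
      · simp
    · have h1 : word u (i ∘ Equiv.swap a (a + 1)) j (q + 1) + word u i j (q + 1) =
          (word u (i ∘ Equiv.swap a (a + 1)) j q + word u i j q) * star (u (j q)) *
            u (i (q + 1)) := by
        rw [word, word, Function.comp_apply, Equiv.swap_apply_of_ne_of_ne (by omega) (by omega)]
        noncomm_ring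
      rw [h1]
      exact wordSpan_mul_mem (ih (by omega)) _ _

/-- Exchanging neighbouring starred letters changes the sign modulo shorter words. -/
theorem HilbertRel.swap_right (h : HilbertRel u) (i j : ℕ → Fin n) {q a : ℕ} (ha : a + 1 < q) :
    word u i (j ∘ Equiv.swap a (a + 1)) q + word u i j q ∈ wordSpan u q := by
  induction q with
  | zero => omega
  | succ q ih =>
    by_cases haq : a + 1 = q
    · subst haq
      have h1 : word u i (j ∘ Equiv.swap a (a + 1)) a = word u i j a :=
        word_congr u (fun _ _ => rfl) (fun b hb => by
          rw [Function.comp_apply, Equiv.swap_apply_of_ne_of_ne (by omega) (by omega)])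
      have h2 : word u i (j ∘ Equiv.swap a (a + 1)) (a + 1 + 1) + word u i j (a + 1 + 1) =
          word u i j a * star (u (j a) * star (u (i (a + 1))) * u (j (a + 1)) +
            u (j (a + 1)) * star (u (i (a + 1))) * u (j a)) * u (i (a + 1 + 1)) := by
        rw [word, word, word, word, h1, Function.comp_apply,
          Function.comp_apply, Equiv.swap_apply_left, Equiv.swap_apply_right]
        simp only [star_add, star_mul, star_star]
        noncomm_ring
      rw [h2, h, star_add, mul_add, add_mul]
      refine add_mem ?_ ?_ <;> split_ifs
      · exact wordSpan_mul_mem (word_mem (by omega) _ _) _ _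
      · simp
      · exact wordSpan_mul_mem (word_mem (by omega) _ _) _ _
      · simp
    · have h1 : word u i (j ∘ Equiv.swap a (a + 1)) (q + 1) + word u i j (q + 1) =
          (word u i (j ∘ Equiv.swap a (a + 1)) q + word u i j q) * star (u (j q)) *
            u (i (q + 1)) := by
        rw [word, word, Function.comp_apply, Equiv.swap_apply_of_ne_of_ne (by omega) (by omega)]
        noncomm_ring
      rw [h1]
      exact wordSpan_mul_mem (ih (by omega)) _ _

/-- A finite tuple of indices as a sequence. -/
def extendTuple (d : Fin n) {q : ℕ} (i : Fin q → Fin n) (a : ℕ) : Fin n :=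
  if h : a < q then i ⟨a, h⟩ else d

theorem extendTuple_of_lt (d : Fin n) {q : ℕ} (i : Fin q → Fin n) {a : ℕ} (h : a < q) :
    extendTuple d i a = i ⟨a, h⟩ := dif_pos h

theorem extendTuple_swap (d : Fin n) {q : ℕ} (i : Fin q → Fin n) (a b : Fin q)
    (hab : (a : ℕ) + 1 = b) {c : ℕ} (hc : c < q) :
    extendTuple d (i ∘ Equiv.swap a b) c =
      (extendTuple d i ∘ Equiv.swap (a : ℕ) ((a : ℕ) + 1)) c := by
  have h1 := Fin.val_injective.map_swap a b ⟨c, hc⟩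
  rw [hab, Function.comp_apply, extendTuple_of_lt d _ hc, Function.comp_apply]
  change _ = extendTuple d i (Equiv.swap (a : ℕ) (b : ℕ) ((⟨c, hc⟩ : Fin q) : ℕ))
  rw [← h1, extendTuple_of_lt d _ (Fin.is_lt _)]

/-- Words are combinations of words with increasing indices and of shorter words. -/
theorem HilbertRel.wordSpan_succ_le (h : HilbertRel u) (d : Fin n) (p : ℕ) :
    wordSpan u (p + 1) ≤ wordSpan u p ⊔ Submodule.span ℂ (Set.range
      fun x : {i : Fin (p + 1) → Fin n // StrictMono i} × {j : Fin p → Fin n // StrictMono j} =>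
        word u (extendTuple d x.1.1) (extendTuple d x.2.1) p) := by
  set S := wordSpan u p ⊔ Submodule.span ℂ (Set.range
      fun x : {i : Fin (p + 1) → Fin n // StrictMono i} × {j : Fin p → Fin n // StrictMono j} =>
        word u (extendTuple d x.1.1) (extendTuple d x.2.1) p) with hS
  have h1 : ∀ (j : Fin p → Fin n), StrictMono j → ∀ i : Fin (p + 1) → Fin n,
      word u (extendTuple d i) (extendTuple d j) p ∈ S := by
    intro j hj
    refine mem_of_strictMono S _ (fun i a b hab => ?_) fun i hi => ?_
    · have h2 : word u (extendTuple d (i ∘ Equiv.swap a b)) (extendTuple d j) p =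
          word u (extendTuple d i ∘ Equiv.swap (a : ℕ) ((a : ℕ) + 1)) (extendTuple d j) p :=
        word_congr u (fun c hc => extendTuple_swap d i a b hab (by omega)) fun _ _ => rfl
      rw [h2]
      exact Submodule.mem_sup_left (h.swap_left _ _ (by omega))
    · exact Submodule.mem_sup_right (Submodule.subset_span ⟨(⟨i, hi⟩, ⟨j, hj⟩), rfl⟩)
  have h2 : ∀ (i : Fin (p + 1) → Fin n) (j : Fin p → Fin n),
      word u (extendTuple d i) (extendTuple d j) p ∈ S := by
    intro i
    refine mem_of_strictMono S _ (fun j a b hab => ?_) fun j hj => h1 j hj i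
    have h2 : word u (extendTuple d i) (extendTuple d (j ∘ Equiv.swap a b)) p =
        word u (extendTuple d i) (extendTuple d j ∘ Equiv.swap (a : ℕ) ((a : ℕ) + 1)) p :=
      word_congr u (fun _ _ => rfl) fun c hc => extendTuple_swap d j a b hab hc
    rw [h2]
    exact Submodule.mem_sup_left (h.swap_right _ _ (by omega))
  refine Submodule.span_le.2 ?_
  rintro _ ⟨q, hq, i, j, rfl⟩
  by_cases hqp : q = p
  · subst hqp
    have h3 := h2 (fun a => i a) fun a => j a
    have h4 : word u (extendTuple d fun a : Fin (q + 1) => i a)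
        (extendTuple d fun a : Fin q => j a) q = word u i j q :=
      word_congr u (fun a ha => extendTuple_of_lt _ _ (by omega))
        fun a ha => extendTuple_of_lt _ _ ha
    rwa [h4] at h3
  · exact Submodule.mem_sup_left (word_mem (by omega) _ _)

theorem card_strictMono_le (q n : ℕ) :
    Fintype.card {i : Fin q → Fin n // StrictMono i} ≤ n.choose q := by
  have h : Fintype.card {i : Fin q → Fin n // StrictMono i} ≤
      Fintype.card {s : Finset (Fin n) // s.card = q} := by
    refine Fintype.card_le_of_injective
      (fun i => ⟨Finset.univ.map ⟨i.1, i.2.injective⟩, by simp⟩) fun i i' hi => ?_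
    have h1 := congrArg (fun s : {s : Finset (Fin n) // s.card = q} => (s.1 : Set (Fin n))) hi
    simp only [Finset.coe_map, Finset.coe_univ, Set.image_univ, Function.Embedding.coeFn_mk] at h1
    exact Subtype.ext ((StrictMono.range_inj i.2 i'.2).1 h1)
  refine h.trans (le_of_eq ?_)
  rw [Fintype.card_finset_len, Fintype.card_fin]

/-- The words with increasing indices are counted by pairs of subsets of sizes `q + 1` and `q`. -/
theorem HilbertRel.finrank_wordSpan_le (h : HilbertRel u) (d : Fin n) (p : ℕ) :
    FiniteDimensional ℂ (wordSpan u p) ∧ Module.finrank ℂ (wordSpan u p) ≤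
      ∑ q ∈ Finset.range p, n.choose (q + 1) * n.choose q := by
  induction p with
  | zero =>
    have h0 : wordSpan u 0 = ⊥ := by simp [wordSpan]
    rw [h0]
    exact ⟨inferInstance, by simp⟩
  | succ p ih =>
    obtain ⟨h1, h2⟩ := ih
    have h3 := h.wordSpan_succ_le d p
    have h4 := finrank_range_le_card (R := ℂ)
      fun x : {i : Fin (p + 1) → Fin n // StrictMono i} × {j : Fin p → Fin n // StrictMono j} =>
        word u (extendTuple d x.1.1) (extendTuple d x.2.1) p
    rw [Fintype.card_prod] at h4
    have h5 := FiniteDimensional.span_of_finite ℂ (Set.finite_range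
      fun x : {i : Fin (p + 1) → Fin n // StrictMono i} × {j : Fin p → Fin n // StrictMono j} =>
        word u (extendTuple d x.1.1) (extendTuple d x.2.1) p)
    refine ⟨Submodule.finiteDimensional_of_le h3, ?_⟩
    rw [Finset.sum_range_succ]
    refine (Submodule.finrank_mono h3).trans
      ((Submodule.finrank_add_le_finrank_add_finrank _ _).trans ?_)
    refine add_le_add h2 (le_trans h4 ?_)
    exact Nat.mul_le_mul (card_strictMono_le _ _) (card_strictMono_le _ _)

/-- There are no increasing words of length more than `n`, so the words with fewer than `n` starred
letters span a ternary subspace. -/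
theorem HilbertRel.ternary_mem (h : HilbertRel u) (d : Fin n) {x y z : A} (hx : x ∈ wordSpan u n)
    (hy : y ∈ wordSpan u n) (hz : z ∈ wordSpan u n) : x * star y * z ∈ wordSpan u n := by
  have h1 : ∀ x ∈ wordSpan u n, ∀ b c, x * star (u b) * u c ∈ wordSpan u n := by
    intro x hx b c
    have h2 := h.wordSpan_succ_le d n (wordSpan_mul_mem hx b c)
    have h3 : IsEmpty {i : Fin (n + 1) → Fin n // StrictMono i} := ⟨fun i => by
      have := Fintype.card_le_of_injective i.1 i.2.injective
      simp at this⟩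
    rwa [Set.range_eq_empty, Submodule.span_empty, sup_bot_eq] at h2
  have h2 : ∀ q i j, ∀ x ∈ wordSpan u n, ∀ b, x * star (u b) * word u i j q ∈ wordSpan u n := by
    intro q i j
    induction q with
    | zero => exact fun x hx b => h1 x hx b _
    | succ q ih =>
      intro x hx b
      rw [word, ← mul_assoc, ← mul_assoc]
      exact h1 _ (ih x hx b) _ _
  have h3 : ∀ x ∈ wordSpan u n, ∀ b, ∀ z ∈ wordSpan u n, x * star (u b) * z ∈ wordSpan u n := by
    intro x hx b z hz
    induction hz using Submodule.span_induction with
    | mem z hz =>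
      obtain ⟨q, -, i, j, rfl⟩ := hz
      exact h2 q i j x hx b
    | zero => simp
    | add z z' _ _ hz hz' =>
      rw [mul_add]
      exact add_mem hz hz'
    | smul r z _ hz =>
      rw [mul_smul_comm]
      exact Submodule.smul_mem _ _ hz
  have h4 : ∀ q i j, ∀ x ∈ wordSpan u n, ∀ z ∈ wordSpan u n,
      x * star (word u i j q) * z ∈ wordSpan u n := by
    intro q i j
    induction q with
    | zero => exact fun x hx z hz => h3 x hx _ z hz
    | succ q ih =>
      intro x hx z hz
      have h5 : x * star (word u i j (q + 1)) * z =
          x * star (u (i (q + 1))) * u (j q) * star (word u i j q) * z := by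
        rw [word]
        simp [mul_assoc]
      rw [h5]
      exact ih _ (h1 _ hx _ _) _ hz
  induction hy using Submodule.span_induction with
  | mem y hy =>
    obtain ⟨q, -, i, j, rfl⟩ := hy
    exact h4 q i j x hx z hz
  | zero => simp
  | add y y' _ _ hy hy' =>
    rw [star_add, mul_add, add_mul]
    exact add_mem hy hy'
  | smul r y _ hy =>
    rw [star_smul, mul_smul_comm, smul_mul_assoc]
    exact Submodule.smul_mem _ _ hy

variable {Z : Type u} [NormedAddCommGroup Z] [NormedSpace ℂ Z] [CompleteSpace Z] [JBStarTriple Z]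

/-- The row vector with a single entry `1`. -/
def rowSingle (i : Fin n) : Matrix (Fin 1) (Fin n) ℂ := Matrix.single 0 i 1

/-- The images of a Hilbert space of dimension `n` generate ternary subspaces whose dimension is at
most that of the blocks of the creation operators. -/
theorem generatesSmall_C1_one (hn : 1 ≤ n) (e : Z ≃ₗ[ℂ] C1 1 n)
    (he : ∀ x y z, (e (tri x y z) : Matrix (Fin 1) (Fin n) ℂ) =
      (1 / 2 : ℂ) • ((e x : Matrix (Fin 1) (Fin n) ℂ) * (e y : Matrix (Fin 1) (Fin n) ℂ)ᴴ *
          (e z : Matrix (Fin 1) (Fin n) ℂ)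
        + (e z : Matrix (Fin 1) (Fin n) ℂ) * (e y : Matrix (Fin 1) (Fin n) ℂ)ᴴ *
          (e x : Matrix (Fin 1) (Fin n) ℂ))) :
    GeneratesSmall.{u, w} Z (∑ q ∈ Finset.range n, n.choose (q + 1) * n.choose q) := by
  intro A _ _ _ _ ψ hψ
  obtain ⟨Ψ, h1, h2⟩ := exists_tripleOn e he ψ hψ
  let u : Fin n → A := fun i => Ψ (rowSingle i)
  have hu : HilbertRel u := by
    intro i j k
    have h3 := h2 (rowSingle i) trivial (rowSingle j) trivial (rowSingle k) trivial
    change Ψ (rowSingle i) * star (Ψ (rowSingle j)) * Ψ (rowSingle k) +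
      Ψ (rowSingle k) * star (Ψ (rowSingle j)) * Ψ (rowSingle i) = _
    rw [← h3, map_add]
    congr 1
    · by_cases hij : i = j <;> simp [rowSingle, hij, u]
    · by_cases hij : k = j <;> simp [rowSingle, hij, u]
  let d : Fin n := ⟨0, hn⟩
  obtain ⟨h3, h4⟩ := hu.finrank_wordSpan_le d n
  refine ⟨wordSpan u n, h3, h4, fun x hx y hy z hz => hu.ternary_mem d hx hy hz, fun z => ?_⟩
  rw [← h1, Matrix.matrix_eq_sum_single (e z : Matrix (Fin 1) (Fin n) ℂ)]
  simp only [map_sum]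
  refine sum_mem fun a _ => sum_mem fun i _ => ?_
  have h5 : Matrix.single a i ((e z : Matrix (Fin 1) (Fin n) ℂ) a i) =
      (e z : Matrix (Fin 1) (Fin n) ℂ) a i • rowSingle i := by
    rw [rowSingle, Matrix.smul_single, smul_eq_mul, mul_one, Subsingleton.elim a 0]
  rw [h5, map_smul]
  exact Submodule.smul_mem _ _ (word_mem (q := 0) (by omega) (fun _ => i) fun _ => i)

end Words

/-! ### Creation operators and Hilbert spaces -/

section Fock

variable {n : ℕ} {Φ : Type} [Fintype Φ] [DecidableEq Φ]

/-- `X` raises the degree by one. -/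
def Raises (deg : Φ → ℕ) (X : Matrix Φ Φ ℂ) : Prop := ∀ x y, X x y ≠ 0 → deg x = deg y + 1

/-- Creation operators `c 0, …, c (n - 1)` on an antisymmetric Fock space with a basis `Φ` graded by
the number of particles: they satisfy the canonical anticommutation relations, and the subspaces
that are closed under `X Y* W` and contain them contain all matrices that raise the degree by one. -/
structure IsFock (deg : Φ → ℕ) (c : Fin n → Matrix Φ Φ ℂ) : Prop where
  card : ∀ k, ∑ x, (if deg x = k then 1 else 0) = n.choose k
  raises : ∀ i, Raises deg (c i)
  anticomm : ∀ i j, c i * c j + c j * c i = 0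
  anticomm_adjoint : ∀ i j, c i * (c j)ᴴ + (c j)ᴴ * c i = if i = j then 1 else 0
  generates : ∀ S : Submodule ℂ (Matrix Φ Φ ℂ),
    (∀ X ∈ S, ∀ Y ∈ S, ∀ W ∈ S, X * Yᴴ * W ∈ S) → (∀ i, c i ∈ S) →
      ∀ x y, deg x = deg y + 1 → Matrix.single x y 1 ∈ S

variable {deg : Φ → ℕ} {c : Fin n → Matrix Φ Φ ℂ}

theorem IsFock.exists_deg_eq (h : IsFock deg c) {k : ℕ} (hk : k ≤ n) : ∃ x, deg x = k := by
  by_contra! hx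
  have h1 := h.card k
  simp only [hx, if_false, Finset.sum_const_zero] at h1
  exact (Nat.choose_pos hk).ne h1

theorem IsFock.deg_le (h : IsFock deg c) (x : Φ) : deg x ≤ n := by
  by_contra! hx
  have h1 := h.card (deg x)
  rw [Nat.choose_eq_zero_of_lt hx, Finset.sum_eq_zero_iff] at h1
  simpa using h1 x (Finset.mem_univ x)

theorem fromBlocks_single₁₁ (x y : Φ) : (Matrix.single (Sum.inl x) (Sum.inl y) 1 :
    Matrix (Φ ⊕ Φ) (Φ ⊕ Φ) ℂ) = Matrix.fromBlocks (Matrix.single x y 1) 0 0 0 := by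
  ext (i | i) (j | j) <;> simp [Matrix.single_apply]

theorem fromBlocks_single₁₂ (x y : Φ) : (Matrix.single (Sum.inl x) (Sum.inr y) 1 :
    Matrix (Φ ⊕ Φ) (Φ ⊕ Φ) ℂ) = Matrix.fromBlocks 0 (Matrix.single x y 1) 0 0 := by
  ext (i | i) (j | j) <;> simp [Matrix.single_apply]

theorem fromBlocks_single₂₁ (x y : Φ) : (Matrix.single (Sum.inr x) (Sum.inl y) 1 :
    Matrix (Φ ⊕ Φ) (Φ ⊕ Φ) ℂ) = Matrix.fromBlocks 0 0 (Matrix.single x y 1) 0 := by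
  ext (i | i) (j | j) <;> simp [Matrix.single_apply]

theorem fromBlocks_single₂₂ (x y : Φ) : (Matrix.single (Sum.inr x) (Sum.inr y) 1 :
    Matrix (Φ ⊕ Φ) (Φ ⊕ Φ) ℂ) = Matrix.fromBlocks 0 0 0 (Matrix.single x y 1) := by
  ext (i | i) (j | j) <;> simp [Matrix.single_apply]

/-- The generation step in the passage from `n` to `n + 1` creation operators: the new one is the
lower left corner, and the old ones act with opposite signs on the two copies. -/
theorem IsFock.single_mem_double (h : IsFock deg c) (S : Submodule ℂ (Matrix (Φ ⊕ Φ) (Φ ⊕ Φ) ℂ))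
    (hS : ∀ X ∈ S, ∀ Y ∈ S, ∀ W ∈ S, X * Yᴴ * W ∈ S)
    (he : Matrix.fromBlocks 0 0 1 0 ∈ S) (hc : ∀ i, Matrix.fromBlocks (c i) 0 0 (-c i) ∈ S)
    (x y : Φ ⊕ Φ) (hxy : Sum.elim deg (fun x => deg x + 1) x =
      Sum.elim deg (fun x => deg x + 1) y + 1) : Matrix.single x y 1 ∈ S := by
  -- `e e*` is the projection onto the second copy
  have h1 : ∀ i, Matrix.fromBlocks 0 0 0 (-c i) ∈ S := fun i => by
    simpa [Matrix.fromBlocks_conjTranspose, Matrix.fromBlocks_multiply] using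
      hS _ he _ he _ (hc i)
  have h2 : ∀ i, Matrix.fromBlocks (c i) 0 0 0 ∈ S := fun i => by
    have := sub_mem (hc i) (h1 i)
    convert this using 1
    ext (i | i) (j | j) <;> simp
  let L₁ : Matrix Φ Φ ℂ →ₗ[ℂ] Matrix (Φ ⊕ Φ) (Φ ⊕ Φ) ℂ :=
    { toFun := fun X => Matrix.fromBlocks X 0 0 0
      map_add' := fun X Y => by simp [Matrix.fromBlocks_add]
      map_smul' := fun c X => by simp [Matrix.fromBlocks_smul] }
  let L₂ : Matrix Φ Φ ℂ →ₗ[ℂ] Matrix (Φ ⊕ Φ) (Φ ⊕ Φ) ℂ :=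
    { toFun := fun X => Matrix.fromBlocks 0 0 0 X
      map_add' := fun X Y => by simp [Matrix.fromBlocks_add]
      map_smul' := fun c X => by simp [Matrix.fromBlocks_smul] }
  have m1 : ∀ x y, deg x = deg y + 1 → Matrix.fromBlocks (Matrix.single x y 1) 0 0 0 ∈ S := by
    refine h.generates (S.comap L₁) (fun X hX Y hY W hW => ?_) h2
    have := hS _ hX _ hY _ hW
    rw [Submodule.mem_comap]
    convert this using 1
    simp [L₁, Matrix.fromBlocks_multiply, Matrix.fromBlocks_conjTranspose]
  have m2 : ∀ x y, deg x = deg y + 1 → Matrix.fromBlocks 0 0 0 (Matrix.single x y 1) ∈ S := by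
    refine h.generates (S.comap L₂) (fun X hX Y hY W hW => ?_) fun i => ?_
    · have := hS _ hX _ hY _ hW
      rw [Submodule.mem_comap]
      convert this using 1
      simp [L₂, Matrix.fromBlocks_multiply, Matrix.fromBlocks_conjTranspose]
    · have := h1 i
      rwa [← neg_mem_iff, Matrix.fromBlocks_neg, neg_zero, neg_neg] at this
  rcases x with x | x <;> rcases y with y | y
  · rw [fromBlocks_single₁₁]
    exact m1 x y hxy
  · rw [fromBlocks_single₁₂]
    have hd : deg x = deg y + 1 + 1 := hxy
    have hx := h.deg_le x
    obtain ⟨z, hz⟩ := h.exists_deg_eq (k := deg y + 1) (by omega)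
    simpa [Matrix.fromBlocks_conjTranspose, Matrix.fromBlocks_multiply] using
      hS _ (m1 x z (by omega)) _ he _ (m2 z y hz)
  · rw [fromBlocks_single₂₁]
    have hd : deg x = deg y := Nat.succ_injective hxy
    have hx := h.deg_le x
    by_cases hlt : deg x < n
    · obtain ⟨z, hz⟩ := h.exists_deg_eq (k := deg x + 1) hlt
      simpa [Matrix.fromBlocks_conjTranspose, Matrix.fromBlocks_multiply] using
        hS _ he _ (m1 z x hz) _ (m1 z y (by omega))
    by_cases hpos : deg x = 0
    · -- without old creation operators the space of each copy is one-dimensional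
      have hn : n = 0 := by omega
      subst hn
      have h0 : ∀ z, deg z = 0 := fun z => Nat.le_zero.1 (h.deg_le z)
      have h3 := h.card 0
      simp only [h0, if_true, Finset.sum_const, Finset.card_univ, smul_eq_mul, mul_one,
        Nat.choose_self] at h3
      have : Subsingleton Φ := Fintype.card_le_one_iff_subsingleton.1 h3.le
      have h4 : (Matrix.single x y 1 : Matrix Φ Φ ℂ) = 1 := by
        ext i j
        rw [Subsingleton.elim i x, Subsingleton.elim j x, Subsingleton.elim y x]
        simp
      rwa [h4]
    · obtain ⟨z, hz⟩ := h.exists_deg_eq (k := deg x - 1) (by omega)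
      simpa [Matrix.fromBlocks_conjTranspose, Matrix.fromBlocks_multiply] using
        hS _ (m2 x z (by omega)) _ (m2 y z (by omega)) _ he
  · rw [fromBlocks_single₂₂]
    exact m2 x y (Nat.succ_injective hxy)

/-- The Fock space of a sum of a Hilbert space and a line: two copies of the old Fock space, in the
second of which the new state is occupied. -/
theorem IsFock.double (h : IsFock deg c) :
    IsFock (Sum.elim deg fun x => deg x + 1) (Fin.snoc (α := fun _ => Matrix (Φ ⊕ Φ) (Φ ⊕ Φ) ℂ)
      (fun i => Matrix.fromBlocks (c i) 0 0 (-c i)) (Matrix.fromBlocks 0 0 1 0) :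
        Fin (n + 1) → Matrix (Φ ⊕ Φ) (Φ ⊕ Φ) ℂ) where
  card k := by
    rw [Fintype.sum_sum_type]
    change (∑ x, if deg x = k then 1 else 0) + (∑ x, if deg x + 1 = k then 1 else 0) = _
    cases k with
    | zero => rw [h.card]; simp
    | succ k =>
      simp only [Nat.succ_inj]
      rw [h.card, h.card, Nat.choose_succ_succ, add_comm]
  raises i := by
    refine Fin.lastCases ?_ (fun i => ?_) i
    · rw [Fin.snoc_last]
      rintro (x | x) (y | y) hxy
      · simp at hxy
      · simp at hxy
      · rw [Matrix.fromBlocks_apply₂₁, Matrix.one_apply] at hxy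
        simp only [ne_eq, ite_eq_right_iff, one_ne_zero, imp_false, not_not] at hxy
        simp [hxy]
      · simp at hxy
    · rw [Fin.snoc_castSucc]
      rintro (x | x) (y | y) hxy
      · exact h.raises i x y hxy
      · simp at hxy
      · simp at hxy
      · have := h.raises i x y (neg_ne_zero.1 hxy)
        simp [this]
  anticomm i j := by
    refine Fin.lastCases ?_ (fun i => ?_) i <;> refine Fin.lastCases ?_ (fun j => ?_) j
    · simp [Matrix.fromBlocks_multiply]
    · simp [Matrix.fromBlocks_multiply, Matrix.fromBlocks_add]
    · simp [Matrix.fromBlocks_multiply, Matrix.fromBlocks_add]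
    · simp [Matrix.fromBlocks_multiply, Matrix.fromBlocks_add, h.anticomm]
  anticomm_adjoint i j := by
    refine Fin.lastCases ?_ (fun i => ?_) i <;> refine Fin.lastCases ?_ (fun j => ?_) j
    · simp [Matrix.fromBlocks_multiply, Matrix.fromBlocks_add, Matrix.fromBlocks_conjTranspose]
    · simp [Matrix.fromBlocks_multiply, Matrix.fromBlocks_add, Matrix.fromBlocks_conjTranspose,
        (Fin.castSucc_lt_last j).ne']
    · simp [Matrix.fromBlocks_multiply, Matrix.fromBlocks_add, Matrix.fromBlocks_conjTranspose,
        (Fin.castSucc_lt_last i).ne]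
    · simp only [Fin.snoc_castSucc, Matrix.fromBlocks_multiply, Matrix.fromBlocks_add,
        Matrix.fromBlocks_conjTranspose, Matrix.mul_zero, Matrix.zero_mul, add_zero, zero_add,
        Matrix.conjTranspose_neg, neg_mul_neg, h.anticomm_adjoint, Matrix.conjTranspose_zero,
        Fin.castSucc_inj]
      split_ifs
      · exact Matrix.fromBlocks_one
      · exact Matrix.fromBlocks_zero
  generates S hS hc := h.single_mem_double S hS (by simpa using hc (Fin.last n)) fun i => by
    simpa using hc i.castSucc

theorem exists_isFock (n : ℕ) : ∃ (Φ : Type) (_ : Fintype Φ) (_ : DecidableEq Φ) (deg : Φ → ℕ)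
    (c : Fin n → Matrix Φ Φ ℂ), IsFock deg c := by
  induction n with
  | zero =>
    refine ⟨Unit, inferInstance, inferInstance, fun _ => 0, fun i => i.elim0,
      fun k => ?_, fun i => i.elim0, fun i => i.elim0, fun i => i.elim0, fun S _ _ x y h => ?_⟩
    · cases k <;> simp
    · exact absurd h (by simp)
  | succ n ih =>
    obtain ⟨Φ, _, _, deg, c, h⟩ := ih
    exact ⟨Φ ⊕ Φ, inferInstance, inferInstance, _, _, h.double⟩

/-- The creation operator of a vector. -/
def fockMap (c : Fin n → Matrix Φ Φ ℂ) : Matrix (Fin 1) (Fin n) ℂ →ₗ[ℂ] Matrix Φ Φ ℂ where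
  toFun a := ∑ i, a 0 i • c i
  map_add' a b := by simp [add_smul, Finset.sum_add_distrib]
  map_smul' r a := by simp [mul_smul, Finset.smul_sum]

theorem fockMap_apply (c : Fin n → Matrix Φ Φ ℂ) (a : Matrix (Fin 1) (Fin n) ℂ) :
    fockMap c a = ∑ i, a 0 i • c i := rfl

theorem fockMap_rowSingle (c : Fin n → Matrix Φ Φ ℂ) (i : Fin n) :
    fockMap c (rowSingle i) = c i := by
  rw [fockMap_apply, Finset.sum_eq_single i]
  · simp [rowSingle]
  · intro j _ hj
    simp [rowSingle, Ne.symm hj]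
  · simp

theorem IsFock.raises_fockMap (h : IsFock deg c) (a : Matrix (Fin 1) (Fin n) ℂ) :
    Raises deg (fockMap c a) := by
  intro x y hxy
  rw [fockMap_apply, Matrix.sum_apply] at hxy
  obtain ⟨i, -, hi⟩ := Finset.exists_ne_zero_of_sum_ne_zero hxy
  exact h.raises i x y (right_ne_zero_of_mul hi)

theorem IsFock.fockMap_anticomm (h : IsFock deg c) (a b : Matrix (Fin 1) (Fin n) ℂ) :
    fockMap c a * fockMap c b + fockMap c b * fockMap c a = 0 := by
  have h1 : fockMap c b * fockMap c a = ∑ i, ∑ j, (a 0 i * b 0 j) • (c j * c i) := by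
    rw [fockMap_apply, fockMap_apply, Finset.sum_mul_sum, Finset.sum_comm]
    simp only [smul_mul_smul_comm, mul_comm]
  rw [h1, fockMap_apply, fockMap_apply, Finset.sum_mul_sum]
  simp only [smul_mul_smul_comm, ← Finset.sum_add_distrib, ← smul_add, h.anticomm, smul_zero,
    Finset.sum_const_zero]

theorem IsFock.fockMap_anticomm_adjoint (h : IsFock deg c) (a b : Matrix (Fin 1) (Fin n) ℂ) :
    fockMap c a * (fockMap c b)ᴴ + (fockMap c b)ᴴ * fockMap c a =
      ((a * bᴴ) 0 0) • (1 : Matrix Φ Φ ℂ) := by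
  have h0 : (fockMap c b)ᴴ = ∑ i, star (b 0 i) • (c i)ᴴ := by
    simp [fockMap_apply, Matrix.conjTranspose_sum]
  have h1 : (fockMap c b)ᴴ * fockMap c a =
      ∑ i, ∑ j, (a 0 i * star (b 0 j)) • ((c j)ᴴ * c i) := by
    rw [h0, fockMap_apply, Finset.sum_mul_sum, Finset.sum_comm]
    simp only [smul_mul_smul_comm, mul_comm]
  rw [h1, h0, fockMap_apply, Finset.sum_mul_sum]
  simp only [smul_mul_smul_comm, ← Finset.sum_add_distrib, ← smul_add, h.anticomm_adjoint]
  rw [Matrix.mul_apply, Finset.sum_smul]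
  refine Finset.sum_congr rfl fun i _ => ?_
  rw [Finset.sum_eq_single i]
  · simp
  · intro j _ hj
    rw [if_neg (Ne.symm hj), smul_zero]
  · simp

theorem fockMap_mul_mul (c : Fin n → Matrix Φ Φ ℂ) (x y z : Matrix (Fin 1) (Fin n) ℂ) :
    fockMap c (x * yᴴ * z) = ((x * yᴴ) 0 0) • fockMap c z := by
  simp only [fockMap_apply, Finset.smul_sum, smul_smul]
  refine Finset.sum_congr rfl fun i _ => ?_
  rw [Matrix.mul_apply, Fin.sum_univ_one]

/-- By the anticommutation relations, the creation operators represent the triple product of the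
Hilbert space. -/
theorem IsFock.triple (h : IsFock deg c) (x y z : Matrix (Fin 1) (Fin n) ℂ) :
    fockMap c (x * yᴴ * z + z * yᴴ * x) = fockMap c x * (fockMap c y)ᴴ * fockMap c z +
      fockMap c z * (fockMap c y)ᴴ * fockMap c x := by
  rw [map_add, fockMap_mul_mul, fockMap_mul_mul]
  have e1 := congrArg (· * fockMap c z) (h.fockMap_anticomm_adjoint x y)
  have e2 := congrArg (· * fockMap c x) (h.fockMap_anticomm_adjoint z y)
  have e3 := congrArg ((fockMap c y)ᴴ * ·) (h.fockMap_anticomm x z)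
  simp only [add_mul, mul_add, smul_mul_assoc, Matrix.one_mul, Matrix.mul_zero,
    ← Matrix.mul_assoc] at e1 e2 e3
  rw [← e1, ← e2, add_add_add_comm, e3, add_zero]

/-- A product can be computed on the indices that the left factor reaches. -/
theorem submatrix_mul_of_support {α β : Type*} {p r : Φ → Prop} [DecidablePred r]
    {X : Matrix Φ Φ ℂ} (hX : ∀ x z, p x → X x z ≠ 0 → r z) (V : Matrix Φ β ℂ) (f : α → β) :
    (X * V).submatrix (Subtype.val : Subtype p → Φ) f =
      X.submatrix Subtype.val (Subtype.val : Subtype r → Φ) * V.submatrix Subtype.val f := by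
  ext x y
  refine (Fintype.sum_of_injective Subtype.val Subtype.val_injective
    (fun z : Subtype r => X x z * V z (f y)) (fun z => X x z * V z (f y)) (fun z hz => ?_)
    fun _ => rfl).symm
  rw [Subtype.range_coe_subtype] at hz
  have : X x z = 0 := by
    by_contra h
    exact hz (hX x z x.2 h)
  change X x z * V z (f y) = 0
  rw [this, zero_mul]

variable (deg) in
/-- The blocks of a matrix that lead from degree `k` to degree `k + 1`. -/
def raisingBlocks (n : ℕ) : Matrix Φ Φ ℂ →ₗ[ℂ]
    Rect (fun k : Fin n => {x // deg x = (k : ℕ) + 1}) (fun k : Fin n => {x // deg x = (k : ℕ)}) where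
  toFun X _ := X.submatrix Subtype.val Subtype.val
  map_add' _ _ := rfl
  map_smul' _ _ := rfl

theorem raisingBlocks_apply (X : Matrix Φ Φ ℂ) (k : Fin n) :
    raisingBlocks deg n X k = X.submatrix Subtype.val Subtype.val := rfl

theorem Raises.raisingBlocks_mul {X Y W : Matrix Φ Φ ℂ} (hX : Raises deg X) (hY : Raises deg Y)
    (k : Fin n) : raisingBlocks deg n (X * Yᴴ * W) k =
      raisingBlocks deg n X k * (raisingBlocks deg n Y k)ᴴ * raisingBlocks deg n W k := by
  rw [Matrix.mul_assoc, Matrix.mul_assoc]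
  simp only [raisingBlocks_apply]
  rw [submatrix_mul_of_support (r := fun x => deg x = (k : ℕ)) (fun x z hx hz => by
      have := hX x z hz
      omega),
    submatrix_mul_of_support (r := fun x => deg x = (k : ℕ) + 1) (fun x z hx hz => by
      rw [Matrix.conjTranspose_apply, star_ne_zero] at hz
      have := hY z x hz
      omega)]
  rfl

theorem Raises.mul {X Y W : Matrix Φ Φ ℂ} (hX : Raises deg X) (hY : Raises deg Y)
    (hW : Raises deg W) : Raises deg (X * Yᴴ * W) := by
  intro x y h
  rw [Matrix.mul_apply] at h
  obtain ⟨z, -, hz⟩ := Finset.exists_ne_zero_of_sum_ne_zero h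
  have h1 := left_ne_zero_of_mul hz
  rw [Matrix.mul_apply] at h1
  obtain ⟨t, -, ht⟩ := Finset.exists_ne_zero_of_sum_ne_zero h1
  have h2 := hX x t (left_ne_zero_of_mul ht)
  have h3 := right_ne_zero_of_mul ht
  rw [Matrix.conjTranspose_apply, star_ne_zero] at h3
  have h4 := hY z t h3
  have h5 := hW z y (right_ne_zero_of_mul hz)
  omega

theorem IsFock.card_subtype (h : IsFock deg c) (k : ℕ) :
    Fintype.card {x // deg x = k} = n.choose k := by
  rw [Fintype.card_subtype, Finset.card_filter, h.card]

/-- The relation `C C* + C* C = |a|²` determines the traces of `C C*` on the homogeneous parts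
recursively. -/
theorem IsFock.trace_raisingBlocks {n : ℕ} {c : Fin (n + 1) → Matrix Φ Φ ℂ} (h : IsFock deg c)
    (a : Matrix (Fin 1) (Fin (n + 1)) ℂ) (k : Fin (n + 1)) :
    (raisingBlocks deg (n + 1) (fockMap c a) k *
      (raisingBlocks deg (n + 1) (fockMap c a) k)ᴴ).trace =
        (a * aᴴ) 0 0 * (n.choose k : ℂ) := by
  set C := fockMap c a with hC
  have hr := h.raises_fockMap a
  rw [← hC] at hr
  let T : ℕ → ℂ := fun j => ∑ x, if deg x = j then (C * Cᴴ) x x else 0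
  have h1 : (raisingBlocks deg (n + 1) C k * (raisingBlocks deg (n + 1) C k)ᴴ).trace =
      T (k + 1) := by
    have h2 : raisingBlocks deg (n + 1) C k * (raisingBlocks deg (n + 1) C k)ᴴ =
        (C * Cᴴ).submatrix Subtype.val Subtype.val := by
      rw [submatrix_mul_of_support (r := fun x => deg x = (k : ℕ)) (fun x z hx hz => by
        have := hr x z hz
        omega)]
      rfl
    rw [h2, Matrix.trace]
    refine Fintype.sum_of_injective Subtype.val Subtype.val_injective _ _ (fun z hz => ?_)
      fun x => ?_
    · rw [Subtype.range_coe_subtype] at hz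
      exact if_neg hz
    · rw [if_pos x.2]
      rfl
  have h3 : T 0 = 0 := by
    refine Finset.sum_eq_zero fun x _ => ?_
    split_ifs with hx
    · rw [Matrix.mul_apply]
      refine Finset.sum_eq_zero fun y _ => ?_
      have : C x y = 0 := by
        by_contra hxy
        have := hr x y hxy
        omega
      rw [this, zero_mul]
    · rfl
  have h4 : ∀ j, ∑ x, (if deg x = j then (Cᴴ * C) x x else 0) = T (j + 1) := by
    intro j
    have h5 : ∀ x, (if deg x = j then (Cᴴ * C) x x else 0) =
        ∑ y, if deg x = j then star (C y x) * C y x else 0 := by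
      intro x
      split_ifs <;> simp [Matrix.mul_apply]
    have h6 : ∀ y, (if deg y = j + 1 then (C * Cᴴ) y y else 0) =
        ∑ x, if deg y = j + 1 then C y x * star (C y x) else 0 := by
      intro x
      split_ifs <;> simp [Matrix.mul_apply]
    simp only [T, h5, h6]
    rw [Finset.sum_comm]
    refine Finset.sum_congr rfl fun y _ => Finset.sum_congr rfl fun x _ => ?_
    by_cases hxy : C y x = 0
    · simp [hxy]
    · rw [hr y x hxy, mul_comm]
      simp
  have h5 : ∀ j, T j + T (j + 1) = (a * aᴴ) 0 0 * ((n + 1).choose j : ℂ) := by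
    intro j
    rw [← h4, ← Finset.sum_add_distrib, ← h.card j]
    push_cast
    rw [Finset.mul_sum]
    refine Finset.sum_congr rfl fun x _ => ?_
    have h6 := congrFun (congrFun (h.fockMap_anticomm_adjoint a a) x) x
    rw [← hC, Matrix.add_apply, Matrix.smul_apply, Matrix.one_apply_eq] at h6
    split_ifs
    · exact h6
    · simp
  have h6 : ∀ j, T (j + 1) = (a * aᴴ) 0 0 * (n.choose j : ℂ) := by
    intro j
    induction j with
    | zero =>
      have := h5 0
      rw [h3, zero_add, Nat.choose_zero_right] at this
      rw [this, Nat.choose_zero_right]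
    | succ j ih =>
      have := h5 (j + 1)
      rw [ih, Nat.choose_succ_succ] at this
      push_cast at this
      linear_combination this
  rw [h1, h6]

variable {Z : Type u} [NormedAddCommGroup Z] [NormedSpace ℂ Z] [CompleteSpace Z] [JBStarTriple Z]

/-- A Hilbert space acts on the antisymmetric Fock space by creation operators, whose blocks between
consecutive degrees give a model. -/
theorem IsFock.isModel (h : IsFock deg c) (e : Z ≃ₗ[ℂ] C1 1 n)
    (he : ∀ x y z, (e (tri x y z) : Matrix (Fin 1) (Fin n) ℂ) =
      (1 / 2 : ℂ) • ((e x : Matrix (Fin 1) (Fin n) ℂ) * (e y : Matrix (Fin 1) (Fin n) ℂ)ᴴ *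
          (e z : Matrix (Fin 1) (Fin n) ℂ)
        + (e z : Matrix (Fin 1) (Fin n) ℂ) * (e y : Matrix (Fin 1) (Fin n) ℂ)ᴴ *
          (e x : Matrix (Fin 1) (Fin n) ℂ))) :
    IsModel (raisingBlocks deg n ∘ₗ fockMap c ∘ₗ (C1 1 n).subtype ∘ₗ e.toLinearMap) where
  triple x y z k := by
    change raisingBlocks deg n (fockMap c (e (tri x y z))) k = _
    rw [he, map_smul, h.triple, map_smul, map_add, Pi.smul_apply, Pi.add_apply,
      (h.raises_fockMap _).raisingBlocks_mul (h.raises_fockMap _),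
      (h.raises_fockMap _).raisingBlocks_mul (h.raises_fockMap _)]
    rfl
  generates S hS hρ := by
    let R : Submodule ℂ (Matrix Φ Φ ℂ) :=
      { carrier := {X | Raises deg X ∧ raisingBlocks deg n X ∈ S}
        zero_mem' := ⟨fun x y hxy => absurd rfl hxy, by rw [map_zero]; exact S.zero_mem⟩
        add_mem' := fun {X Y} hX hY => ⟨fun x y hxy => by
            by_cases h0 : X x y = 0
            · exact hY.1 x y fun h1 => hxy (by simp [h0, h1])
            · exact hX.1 x y h0, by rw [map_add]; exact S.add_mem hX.2 hY.2⟩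
        smul_mem' := fun r X hX => ⟨fun x y hxy => hX.1 x y (right_ne_zero_of_mul hxy), by
            rw [map_smul]; exact S.smul_mem r hX.2⟩ }
    have hR := h.generates R (fun X hX Y hY W hW => ⟨hX.1.mul hY.1 hW.1, by
        have := hS _ hX.2 _ hY.2 _ hW.2
        convert this using 1
        funext k
        exact hX.1.raisingBlocks_mul hY.1 k⟩) fun i => ⟨h.raises i, by
      have := hρ (e.symm ⟨rowSingle i, trivial⟩)
      simpa [fockMap_rowSingle] using this⟩
    refine eq_top_of_single_mem S fun k a b => ?_
    have := (hR a b (by rw [a.2, b.2])).2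
    convert this using 1
    ext j x y
    rw [raisingBlocks_apply, Matrix.submatrix_apply]
    by_cases hj : j = k
    · subst hj
      rw [Pi.single_eq_same]
      simp [Matrix.single_apply, Subtype.ext_iff]
    · have hb : (b : Φ) ≠ y := by
        intro h0
        have h1 := b.2
        rw [h0, y.2] at h1
        exact hj (Fin.ext h1)
      rw [Pi.single_eq_of_ne hj, Matrix.single_apply, if_neg fun h0 => hb h0.2]
      rfl

/-- Hilbert spaces: the `k`-th block has size `n.choose (k + 1)` by `n.choose k`. The nonzero tripotents
are the unit vectors, which all have the same class. -/
theorem hasInvariant_C1_one (hn : 1 ≤ n) (hZ : IsoToMatrices Z (C1 1 n)) :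
    HasInvariant.{u, v, w} Z
      {x : Fin n → ℤ | ∀ k, 0 ≤ x k}
      {x : Fin n → ℤ | ∀ k, 0 ≤ x k ∧ x k ≤ n.choose (k + 1)}
      {x : Fin n → ℤ | ∀ k, 0 ≤ x k ∧ x k ≤ n.choose k}
      {fun k : Fin n => ((n - 1).choose k : ℤ)} := by
  obtain ⟨n, rfl⟩ : ∃ m, n = m + 1 := ⟨n - 1, by omega⟩
  obtain ⟨e, he⟩ := hZ
  obtain ⟨Φ, _, _, deg, c, h⟩ := exists_isFock (n + 1)
  have hm := h.isModel e he
  have i1 : ∀ k : Fin (n + 1), Nonempty {x // deg x = (k : ℕ) + 1} := fun k =>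
    nonempty_subtype.2 (h.exists_deg_eq (by omega))
  have i2 : ∀ k : Fin (n + 1), Nonempty {x // deg x = (k : ℕ)} := fun k =>
    nonempty_subtype.2 (h.exists_deg_eq (by omega))
  have hd : Module.finrank ℂ (Rect (fun k : Fin (n + 1) => {x // deg x = (k : ℕ) + 1})
      fun k => {x // deg x = (k : ℕ)}) =
        ∑ q ∈ Finset.range (n + 1), (n + 1).choose (q + 1) * (n + 1).choose q := by
    rw [Module.finrank_pi_fintype, ← Fin.sum_univ_eq_sum_range
      fun q => (n + 1).choose (q + 1) * (n + 1).choose q]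
    refine Finset.sum_congr rfl fun k _ => ?_
    rw [Module.finrank_matrix, h.card_subtype, h.card_subtype, Module.finrank_self, mul_one]
  have htri : ∀ g, (e (tri g g g) : Matrix (Fin 1) (Fin (n + 1)) ℂ) =
      ((e g : Matrix (Fin 1) (Fin (n + 1)) ℂ) * (e g : Matrix (Fin 1) (Fin (n + 1)) ℂ)ᴴ) 0 0 •
        (e g : Matrix (Fin 1) (Fin (n + 1)) ℂ) := by
    intro g
    rw [he, ← two_smul ℂ, smul_smul]
    ext i j
    rw [Subsingleton.elim i 0, Matrix.smul_apply, Matrix.mul_apply, Fin.sum_univ_one]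
    simp
  refine hm.hasInvariant
    (hm.hasLift_of_generatesSmall (by rw [hd]; exact generatesSmall_C1_one hn e he))
    (hm.hasLift_of_generatesSmall (by rw [hd]; exact generatesSmall_C1_one hn e he))
    (AddEquiv.refl _) ?_ ?_ ?_ ?_
  · exact Set.image_id _
  · simp only [h.card_subtype]
    exact Set.image_id _
  · simp only [h.card_subtype]
    exact Set.image_id _
  · refine (Set.image_id _).trans ?_
    have ht := fun g k => h.trace_raisingBlocks (e g : Matrix (Fin 1) (Fin (n + 1)) ℂ) k
    ext x
    rw [Set.mem_singleton_iff]
    constructor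
    · rintro ⟨g, hg, hx⟩
      have h1 := htri g
      rw [hg.2] at h1
      have h2 : (e g : Matrix (Fin 1) (Fin (n + 1)) ℂ) ≠ 0 := fun h0 =>
        hg.1 (e.injective (Subtype.ext (by rw [h0, map_zero]; rfl)))
      have h3 : ((e g : Matrix (Fin 1) (Fin (n + 1)) ℂ) *
          (e g : Matrix (Fin 1) (Fin (n + 1)) ℂ)ᴴ) 0 0 = 1 := by
        refine smul_left_injective ℂ h2 ?_
        change _ • _ = (1 : ℂ) • _
        rw [← h1, one_smul]
      funext k
      have h4 := (hx k).trans (ht g k)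
      rw [h3, one_mul] at h4
      exact_mod_cast h4
    · rintro rfl
      let g : Z := e.symm ⟨rowSingle 0, trivial⟩
      have h1 : (e g : Matrix (Fin 1) (Fin (n + 1)) ℂ) = rowSingle 0 := by simp [g]
      have h2 : ((e g : Matrix (Fin 1) (Fin (n + 1)) ℂ) *
          (e g : Matrix (Fin 1) (Fin (n + 1)) ℂ)ᴴ) 0 0 = 1 := by
        rw [h1]
        simp [rowSingle]
      refine ⟨g, ⟨fun h0 => ?_, e.injective (Subtype.ext ?_)⟩, fun k => ?_⟩
      · rw [h0] at h2
        simp at h2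
      · rw [htri, h2, one_smul]
      · refine Eq.trans ?_ (ht g k).symm
        rw [h2, one_mul]
        exact Int.cast_natCast _

end Fock

end KJB

end

theorem mainTheorem1 (Z : Type u) [NormedAddCommGroup Z] [NormedSpace ℂ Z] [CompleteSpace Z]
    [JBStarTriple Z] :
    -- (a)(i) Hilbert spaces
    (∀ n : ℕ, 1 ≤ n → IsoToMatrices Z (C1 1 n) →
      HasInvariant.{u, v, w} Z
        {x : Fin n → ℤ | ∀ k, 0 ≤ x k}
        {x : Fin n → ℤ | ∀ k, 0 ≤ x k ∧ x k ≤ n.choose (k + 1)}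
        {x : Fin n → ℤ | ∀ k, 0 ≤ x k ∧ x k ≤ n.choose k}
        {fun k : Fin n => ((n - 1).choose k : ℤ)}) ∧
    -- (a)(ii) rectangular factors
    (∀ n m : ℕ, 2 ≤ n → 2 ≤ m → IsoToMatrices Z (C1 n m) →
      HasInvariant.{u, v, w} Z
        {x : ℤ × ℤ | 0 ≤ x.1 ∧ 0 ≤ x.2}
        (Set.Icc (0 : ℤ) n ×ˢ Set.Icc (0 : ℤ) m)
        (Set.Icc (0 : ℤ) m ×ˢ Set.Icc (0 : ℤ) n)
        {x : ℤ × ℤ | ∃ r : ℕ, 1 ≤ r ∧ r ≤ n ∧ r ≤ m ∧ x = ((r : ℤ), (r : ℤ))}) ∧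
    -- (b) symplectic factors
    (∀ n : ℕ, 10 ≤ Module.finrank ℂ Z → IsoToMatrices Z (C2 n) →
      HasInvariant.{u, v, w} Z
        (Set.Ici (0 : ℤ)) (Set.Icc (0 : ℤ) n) (Set.Icc (0 : ℤ) n)
        {x : ℤ | Even x ∧ 2 ≤ x ∧ x ≤ n}) ∧
    -- (c) hermitian factors
    (∀ n : ℕ, 2 ≤ n → IsoToMatrices Z (C3 n) →
      HasInvariant.{u, v, w} Z
        (Set.Ici (0 : ℤ)) (Set.Icc (0 : ℤ) n) (Set.Icc (0 : ℤ) n) (Set.Icc (1 : ℤ) n)) ∧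
    -- (d)(i) spin factors of even dimension `2n`
    (∀ n : ℕ, 2 ≤ n → IsSpinFactor Z (2 * n - 1) →
      HasInvariantMinMax.{u, v, w} Z
        {x : ℤ × ℤ | 0 ≤ x.1 ∧ 0 ≤ x.2}
        (Set.Icc (0 : ℤ) (2 ^ (n - 1)) ×ˢ Set.Icc (0 : ℤ) (2 ^ (n - 1)))
        (Set.Icc (0 : ℤ) (2 ^ (n - 1)) ×ˢ Set.Icc (0 : ℤ) (2 ^ (n - 1)))
        ((2 : ℤ) ^ (n - 2), (2 : ℤ) ^ (n - 2)) ((2 : ℤ) ^ (n - 1), (2 : ℤ) ^ (n - 1))) ∧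
    -- (d)(ii) spin factors of odd dimension `2n + 1`
    (∀ n : ℕ, 2 ≤ n → IsSpinFactor Z (2 * n) →
      HasInvariantMinMax.{u, v, w} Z
        (Set.Ici (0 : ℤ)) (Set.Icc (0 : ℤ) (2 ^ n)) (Set.Icc (0 : ℤ) (2 ^ n))
        ((2 : ℤ) ^ (n - 1)) ((2 : ℤ) ^ n)) := by
  exact ⟨fun n hn h => KJB.hasInvariant_C1_one hn h, fun n m hn hm h => KJB.hasInvariant_C1 hn hm h,
    fun n hd h => KJB.hasInvariant_C2 hd h, fun n hn h => KJB.hasInvariant_C3 hn h,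
    fun n hn h => KJB.hasInvariantMinMax_spin_even hn h,
    fun n hn h => KJB.hasInvariantMinMax_spin_odd hn h⟩
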